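/- Let $E=(E^0,E^1,d,r)$ be a topological graph: $E^0,E^1$ are locally compact Hausdorff spaces, $d\colon E^1\to E^0$ is a local homeomorphism and $r\colon E^1\to E^0$ is continuous. Let $$C_d(E^1)=\{\xi\in C(E^1)\mid \langle\xi,\xi\rangle\in C_0(E^0)\},\qquad \langle\xi,\eta\rangle(v)=\sum_{d(e)=v}\overline{\xi(e)}\,\eta(e),$$ with norm $\|\xi\|=\sup_v\langle\xi,\xi\rangle(v)^{1/2}$, right action $(\xi f)(e)=\xi(e)f(d(e))$ and left action $(\pi_r(f)\xi)(e)=f(r(e))\xi(e)$ of $f\in C_0(E^0)$, and let $\mathcal K(C_d(E^1))$ be the closed linear span of the operators $\theta_{\xi,\eta}\colon\zeta\mapsto\xi\langle\eta,\zeta\rangle$. For $n\ge 2$ let $E^n=\{(e_n,\dots,e_1)\in (E^1)^n\mid d(e_{k+1})=r(e_k)\ (1\le k<n)\}$ with $d^n(e_n,\dots,e_1)=d(e_1)$, $r^n(e_n,\dots,e_1)=r(e_n)$; let $d^1=d$, $r^1=r$ and $d^0=r^0=\mathrm{id}_{E^0}$. Define $C_d(E^n)$ from $d^n$ in the same way;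 in particular $C_d(E^0)=C_0(E^0)$. A Toeplitz $E$-pair on a $C^*$-algebra $A$ is a pair $T=(T^0,T^1)$ of a $*$-homomorphism $T^0\colon C_0(E^0)\to A$ and a linear map $T^1\colon C_d(E^1)\to A$ with $T^1(\xi)^*T^1(\eta)=T^0(\langle\xi,\eta\rangle)$ and $T^0(f)T^1(\xi)=T^1(\pi_r(f)\xi)$. Let $C^*(T)\subset A$ be the $C^*$-subalgebra generated by the images of $T^0$ and $T^1$. For $n\geq 1$ let $T^n\colon C_d(E^n)\to C^*(T)$ be the continuous linear map with $T^n(\xi_n\otimes\cdots\otimes\xi_1)=T^1(\xi_n)\cdots T^1(\xi_1)$, where $(\xi_n\otimes\cdots\otimes\xi_1)(e_n,\dots,e_1)=\xi_n(e_n)\cdots\xi_1(e_1)$, and let $\Phi^1\colon\mathcal K(C_d(E^1))\to C^*(T)$ be the continuous linear map with $\Phi^1(\theta_{\xi,\eta})=T^1(\xi)T^1(\eta)^*$. Put $E^0_{\rm sce}=E^0\setminus\overline{r(E^1)}$, $E^0_{\rm fin}=\{v\mid r^{-1}(U)\text{ is compact for some neighbourhood }U\text{ of }v\}$ and $E^0_{\rm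 rg}=E^0_{\rm fin}\setminus\overline{E^0_{\rm sce}}$. The pair $T$ is a Cuntz-Krieger $E$-pair if $T^0(f)=\Phi^1(\pi_r(f))$ for all $f\in C_0(E^0_{\rm rg})$. Let $\mathcal O(E)$ be the universal $C^*$-algebra generated by a Cuntz-Krieger $E$-pair $t=(t^0,t^1)$; for a Cuntz-Krieger $E$-pair $T$ let $\rho_T\colon\mathcal O(E)\to C^*(T)$ be the $*$-homomorphism with $\rho_T\circ t^i=T^i$ $(i=0,1)$, and let $\mathcal F_T\subset C^*(T)$ be the closed linear span of $\{T^k(\xi)T^k(\eta)^*\mid \xi,\eta\in C_d(E^k),\ k\ge 0\}$. **Theorem (gauge-invariant uniqueness).** For a topological graph $E$ and a Cuntz-Krieger $E$-pair $T=(T^0,T^1)$, the following are equivalent: 1. The map $\rho_T\colon\mathcal O(E)\to C^*(T)$ is an isomorphism. 2. The map $T^0$ is injective, and for every $z\in\mathbb C$ with $|z|=1$ there is an automorphism $\beta'_z$ of $C^*(T)$ such that $\beta'_z(T^0(f))=T^0(f)$ and $\beta'_z(T^1(\xi))=zT^1(\xi)$ for all $f\in C_0(E^0)$ and $\xi\in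 C_d(E^1)$. 3. The map $T^0$ is injective, and there is a conditional expectation $\Psi_T$ from $C^*(T)$ onto $\mathcal F_T$ such that $\Psi_T(T^n(\xi)T^m(\eta)^*)=\delta_{n,m}T^n(\xi)T^m(\eta)^*$ for all $n,m\ge 0$, $\xi\in C_d(E^n)$ and $\eta\in C_d(E^m)$. -/

import Mathlib

open Filter Topology
open scoped ZeroAtInfty ENNReal TensorProduct BoundedContinuousFunction

universe u

noncomputable section

/-! ### Topological graphs -/

/-- A topological graph `(E⁰, E¹, d, r)` with vertex space `E⁰ = V`: the edge space `E¹ = Edge` is a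
locally compact Hausdorff space, the domain map `d` is a local homeomorphism and the range map `r`
is continuous. (The theorem assumes that `V` is locally compact and Hausdorff.) -/
structure TopGraph (V : Type u) [TopologicalSpace V] where
  Edge : Type u
  [top : TopologicalSpace Edge]
  [t2 : T2Space Edge]
  [lc : LocallyCompactSpace Edge]
  d : Edge → V
  r : Edge → V
  isLocalHomeomorph_d : IsLocalHomeomorph d
  continuous_r : Continuous r

namespace TopGraph

attribute [instance] TopGraph.top TopGraph.t2 TopGraph.lc

variable {V : Type u} [TopologicalSpace V]

/-- The open set `E⁰_sce` of sources. -/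
def sce (E : TopGraph V) : Set V := (closure (Set.range E.r))ᶜ

/-- The open set `E⁰_fin` of vertices with a neighbourhood whose preimage under `r` is compact. -/
def fin (E : TopGraph V) : Set V := {v | ∃ U ∈ 𝓝 v, IsCompact (E.r ⁻¹' U)}

/-- The open set `E⁰_rg` of regular vertices. -/
def rg (E : TopGraph V) : Set V := E.fin \ closure E.sce

/-! ### Path spaces -/

/-- The graph with vertex space `V`, edge space `V` and `d = r = id`: paths of length `0`. -/
def idGraph (V : Type u) [TopologicalSpace V] [T2Space V] [LocallyCompactSpace V] : TopGraph V where
  Edge := V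
  d := id
  r := id
  isLocalHomeomorph_d := (Homeomorph.refl V).isLocalHomeomorph
  continuous_r := continuous_id

/-- The pairs `(e, p)` with `d e = r p`. -/
def CompEdge (E F : TopGraph V) : Type u := {x : E.Edge × F.Edge // E.d x.1 = F.r x.2}

instance (E F : TopGraph V) : TopologicalSpace (CompEdge E F) :=
  inferInstanceAs (TopologicalSpace {x : E.Edge × F.Edge // E.d x.1 = F.r x.2})

instance (E F : TopGraph V) : T2Space (CompEdge E F) :=
  inferInstanceAs (T2Space {x : E.Edge × F.Edge // E.d x.1 = F.r x.2})

theorem compEdge_locallyCompact [T2Space V] (E F : TopGraph V) :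
    LocallyCompactSpace (CompEdge E F) := by
  have hc : IsClosed {x : E.Edge × F.Edge | E.d x.1 = F.r x.2} :=
    isClosed_eq (E.isLocalHomeomorph_d.continuous.comp continuous_fst)
      (F.continuous_r.comp continuous_snd)
  exact hc.isClosedEmbedding_subtypeVal.locallyCompactSpace

theorem compEdge_isOpenMap_snd (E F : TopGraph V) :
    IsOpenMap (fun x : CompEdge E F => x.1.2) := by
  intro W hW
  rw [isOpen_iff_mem_nhds]
  rintro p ⟨x, hx, rfl⟩
  obtain ⟨O, hO, rfl⟩ := isOpen_induced_iff.1 hW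
  obtain ⟨A, B, hA, hB, hxA, hxB, hAB⟩ := isOpen_prod_iff.1 hO x.1.1 x.1.2 hx
  have hopen : IsOpen (B ∩ F.r ⁻¹' (E.d '' A)) :=
    hB.inter ((E.isLocalHomeomorph_d.isOpenMap A hA).preimage F.continuous_r)
  refine mem_of_superset (hopen.mem_nhds ⟨hxB, x.1.1, hxA, x.2⟩) ?_
  rintro q ⟨hqB, e, heA, heq⟩
  exact ⟨⟨(e, q), heq⟩, hAB ⟨heA, hqB⟩, rfl⟩

theorem compEdge_isLocalHomeomorph_snd (E F : TopGraph V) :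
    IsLocalHomeomorph (fun x : CompEdge E F => x.1.2) := by
  rw [isLocalHomeomorph_iff_isOpenEmbedding_restrict]
  intro x
  have hE := E.isLocalHomeomorph_d
  have hcont : Continuous (fun y : CompEdge E F => y.1.1) :=
    continuous_fst.comp continuous_subtype_val
  have hU : IsOpen {y : CompEdge E F | y.1.1 ∈ (hE.localInverseAt x.1.1).target} :=
    (hE.localInverseAt x.1.1).open_target.preimage hcont
  refine ⟨_, hU.mem_nhds hE.self_mem_localInverseAt_target, ?_⟩
  refine IsOpenEmbedding.of_continuous_injective_isOpenMap ?_ ?_ ?_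
  · exact (continuous_snd.comp continuous_subtype_val).comp continuous_subtype_val
  · rintro ⟨⟨⟨e, p⟩, hep⟩, he⟩ ⟨⟨⟨e', p'⟩, hep'⟩, he'⟩ h
    have hp : p = p' := h
    subst hp
    have : e = e' := hE.injOn_localInverseAt_target he he' (hep.trans hep'.symm)
    subst this
    rfl
  · exact (compEdge_isOpenMap_snd E F).domRestrict hU

/-- The composition of two topological graphs on the same vertex space: the edges are the pairs
`(e, p)` with `d e = r p`, the domain of `(e, p)` is `d p`, and its range is `r e`. -/
def comp [T2Space V] (E F : TopGraph V) : TopGraph V where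
  Edge := CompEdge E F
  lc := compEdge_locallyCompact E F
  d := fun x => F.d x.1.2
  r := fun x => E.r x.1.1
  isLocalHomeomorph_d := F.isLocalHomeomorph_d.comp (compEdge_isLocalHomeomorph_snd E F)
  continuous_r := E.continuous_r.comp (continuous_fst.comp continuous_subtype_val)

/-- The triple `(Eⁿ, dⁿ, rⁿ)`, the `n`-fold composition of `(E¹, d, r)`. A path of length `n + 1` is
`(eₙ₊₁, p)` with `p` a path of length `n` and `d eₙ₊₁ = r p`; a path of length `0` is a vertex.
Thus a path of length `n` is `(eₙ, (…, (e₁, v)))` with `d eₖ₊₁ = r eₖ` and `d e₁ = v`. -/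
def path [T2Space V] [LocallyCompactSpace V] (E : TopGraph V) : ℕ → TopGraph V
  | 0 => idGraph V
  | n + 1 => E.comp (path E n)

/-! ### The Hilbert module `C_d(E¹)` -/

/-- `h` has continuous fibrewise sums along `d` which vanish at infinity. -/
structure FibreSummable (E : TopGraph V) (h : E.Edge → ℝ) : Prop where
  summable : ∀ v, Summable fun e : E.d ⁻¹' {v} => h e
  continuous_tsum : Continuous fun v => ∑' e : E.d ⁻¹' {v}, h e
  zero_at_infty : Tendsto (fun v => ∑' e : E.d ⁻¹' {v}, h e) (cocompact V) (𝓝 0)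

theorem norm_tsum_sub_sum_le {ι G : Type*} [NormedAddCommGroup G] [CompleteSpace G]
    {F : ι → G} {h : ι → ℝ} (hle : ∀ i, ‖F i‖ ≤ h i) (hs : Summable h) (t : Finset ι) :
    ‖∑' i, F i - ∑ i ∈ t, F i‖ ≤ ∑' i, h i - ∑ i ∈ t, h i := by
  have hF : Summable F := Summable.of_norm_bounded hs hle
  rw [← hF.sum_add_tsum_compl (s := t), ← hs.sum_add_tsum_compl (s := t), add_sub_cancel_left,
    add_sub_cancel_left]
  exact tsum_of_norm_bounded (hs.subtype _).hasSum fun i => hle i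

theorem continuous_fibreSum (E : TopGraph V) {G : Type*} [NormedAddCommGroup G] [CompleteSpace G]
    {F : E.Edge → G} {h : E.Edge → ℝ} (hF : Continuous F) (hh : Continuous h)
    (hle : ∀ e, ‖F e‖ ≤ h e) (hs : ∀ v, Summable fun e : E.d ⁻¹' {v} => h e)
    (hc : Continuous fun v => ∑' e : E.d ⁻¹' {v}, h e) :
    Continuous fun v => ∑' e : E.d ⁻¹' {v}, F e := by
  have hE := E.isLocalHomeomorph_d
  rw [continuous_iff_continuousAt]
  intro v
  rw [Metric.continuousAt_iff']
  intro ε hε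
  obtain ⟨s, hsε⟩ : ∃ s : Finset (E.d ⁻¹' {v}),
      ∑' e : E.d ⁻¹' {v}, h e - ∑ e ∈ s, h e < ε / 3 := by
    have := (hs v).hasSum.eventually (lt_mem_nhds (sub_lt_self _ (by positivity : 0 < ε / 3)))
    obtain ⟨s, hs⟩ := this.exists
    exact ⟨s, by linarith⟩
  let σ : E.d ⁻¹' {v} → V → E.Edge := fun e => hE.localInverseAt e.1
  have hd : ∀ e : E.d ⁻¹' {v}, E.d e.1 = v := fun e => e.2
  have hσv : ∀ e, σ e v = e.1 := fun e => by
    have := hE.localInverseAt_apply_self (x := e.1)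
    rwa [hd] at this
  have hmem : ∀ e : E.d ⁻¹' {v}, v ∈ (hE.localInverseAt e.1).source := fun e => by
    have := hE.apply_self_mem_localInverseAt_source (x := e.1)
    rwa [hd] at this
  have hσc : ∀ e, ContinuousAt (σ e) v := fun e =>
    (hE.localInverseAt e.1).continuousAt (hmem e)
  have hσd : ∀ᶠ w in 𝓝 v, ∀ e ∈ s, E.d (σ e w) = w := by
    rw [eventually_all_finset]
    intro e _
    filter_upwards [(hE.localInverseAt e.1).open_source.mem_nhds (hmem e)] with w hw
    exact hE.apply_localInverseAt_of_mem hw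
  have hσne : ∀ᶠ w in 𝓝 v, ∀ e ∈ s, ∀ e' ∈ s, e ≠ e' → σ e w ≠ σ e' w := by
    rw [eventually_all_finset]
    intro e _
    rw [eventually_all_finset]
    intro e' _
    by_cases hee : e = e'
    · simp [hee]
    · have : σ e v ≠ σ e' v := by
        rw [hσv, hσv]
        exact fun h => hee (Subtype.ext h)
      filter_upwards [((hσc e).ne_iff_eventually_ne (hσc e')).1 this] with w hw _
      exact hw
  have hA : ContinuousAt (fun w => ∑' e : E.d ⁻¹' {w}, h e - ∑ e ∈ s, h (σ e w)) v :=
    hc.continuousAt.sub (tendsto_finsetSum _ fun e _ => hh.continuousAt.comp (hσc e))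
  have hB : ContinuousAt (fun w => ∑ e ∈ s, F (σ e w)) v :=
    tendsto_finsetSum _ fun e _ => hF.continuousAt.comp (hσc e)
  have key : ∀ᶠ w in 𝓝 v, ‖∑' e : E.d ⁻¹' {w}, F e - ∑ e ∈ s, F (σ e w)‖ ≤
      ∑' e : E.d ⁻¹' {w}, h e - ∑ e ∈ s, h (σ e w) := by
    filter_upwards [hσd, hσne] with w hw1 hw2
    classical
    let j : s ↪ E.d ⁻¹' {w} := ⟨fun e => ⟨σ e.1 w, hw1 e.1 e.2⟩, fun a b hab => by
      by_contra hne
      exact hw2 a.1 a.2 b.1 b.2 (fun h => hne (Subtype.ext h)) (congrArg Subtype.val hab)⟩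
    have hj : ∀ {M : Type _} [AddCommMonoid M] (f : E.Edge → M),
        ∑ e ∈ s.attach.map j, f e = ∑ e ∈ s, f (σ e w) := by
      intro M _ f
      rw [Finset.sum_map]
      exact Finset.sum_attach s (fun e => f (σ e w))
    have hj' : ∑ e ∈ s.attach.map j, h e = ∑ e ∈ s, h (σ e w) := by
      rw [Finset.sum_map]
      exact Finset.sum_attach s (fun e => h (σ e w))
    rw [← hj F, ← hj']
    exact norm_tsum_sub_sum_le (F := fun e : E.d ⁻¹' {w} => F e) (h := fun e : E.d ⁻¹' {w} => h e)
      (fun e => hle e) (hs w) _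
  have hAε : ∀ᶠ w in 𝓝 v, ∑' e : E.d ⁻¹' {w}, h e - ∑ e ∈ s, h (σ e w) < ε / 3 := by
    refine hA.eventually (gt_mem_nhds ?_)
    simpa only [hσv] using hsε
  have k0 := key.self_of_nhds
  have a0 := hAε.self_of_nhds
  filter_upwards [key, hAε, Metric.continuousAt_iff'.1 hB (ε / 3) (by positivity)] with w k1 a1 b1
  rw [dist_eq_norm] at b1 ⊢
  have heq : ∑' e : E.d ⁻¹' {w}, F e - ∑' e : E.d ⁻¹' {v}, F e =
      (∑' e : E.d ⁻¹' {w}, F e - ∑ e ∈ s, F (σ e w)) +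
      (∑ e ∈ s, F (σ e w) - ∑ e ∈ s, F (σ e v)) -
      (∑' e : E.d ⁻¹' {v}, F e - ∑ e ∈ s, F (σ e v)) := by abel
  rw [heq]
  refine (norm_sub_le _ _).trans_lt ?_
  have := norm_add_le (∑' e : E.d ⁻¹' {w}, F e - ∑ e ∈ s, F (σ e w))
    (∑ e ∈ s, F (σ e w) - ∑ e ∈ s, F (σ e v))
  linarith

theorem FibreSummable.zero_at_infty_of_le {E : TopGraph V} {G : Type*} [NormedAddCommGroup G]
    [CompleteSpace G] {F : E.Edge → G} {h : E.Edge → ℝ} (H : E.FibreSummable h)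
    (hle : ∀ e, ‖F e‖ ≤ h e) :
    Tendsto (fun v => ∑' e : E.d ⁻¹' {v}, F e) (cocompact V) (𝓝 0) :=
  squeeze_zero_norm (fun v => tsum_of_norm_bounded (H.summable v).hasSum fun e => hle e)
    H.zero_at_infty

theorem FibreSummable.of_le {E : TopGraph V} {g h : E.Edge → ℝ} (H : E.FibreSummable h)
    (hg : Continuous g) (hh : Continuous h) (hle : ∀ e, ‖g e‖ ≤ h e) : E.FibreSummable g where
  summable v := Summable.of_norm_bounded (H.summable v) fun e => hle e
  continuous_tsum := continuous_fibreSum E hg hh hle H.summable H.continuous_tsum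
  zero_at_infty := H.zero_at_infty_of_le hle

theorem FibreSummable.add {E : TopGraph V} {g h : E.Edge → ℝ} (G : E.FibreSummable g)
    (H : E.FibreSummable h) : E.FibreSummable (fun e => g e + h e) := by
  have : ∀ v, ∑' e : E.d ⁻¹' {v}, (g e + h e) =
      ∑' e : E.d ⁻¹' {v}, g e + ∑' e : E.d ⁻¹' {v}, h e := fun v =>
    (G.summable v).tsum_add (H.summable v)
  refine ⟨fun v => (G.summable v).add (H.summable v), ?_, ?_⟩
  · simp only [this]
    exact G.continuous_tsum.add H.continuous_tsum
  · simp only [this]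
    simpa using G.zero_at_infty.add H.zero_at_infty

theorem FibreSummable.const_mul {E : TopGraph V} {h : E.Edge → ℝ}
    (H : E.FibreSummable h) (c : ℝ) : E.FibreSummable (fun e => c * h e) := by
  refine ⟨fun v => (H.summable v).mul_left c, ?_, ?_⟩
  · simp only [tsum_mul_left]
    exact H.continuous_tsum.const_mul c
  · simp only [tsum_mul_left]
    simpa using H.zero_at_infty.const_mul c

/-- `C_d(E¹)` as a linear subspace of `C(E¹)`: the continuous `ξ` for which
`v ↦ ∑_{d e = v} |ξ e|²` is finite, continuous and vanishing at infinity. -/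
def cdSubmodule (E : TopGraph V) : Submodule ℂ C(E.Edge, ℂ) where
  carrier := {ξ | E.FibreSummable fun e => ‖ξ e‖ ^ 2}
  zero_mem' := by
    refine ⟨fun v => ?_, ?_, ?_⟩ <;> simp [continuous_const, tendsto_const_nhds]
  add_mem' hξ hη := by
    refine ((hξ.add hη).const_mul 2).of_le (by fun_prop) (by fun_prop) fun e => ?_
    rename_i ξ η
    have h1 : ‖(ξ + η) e‖ ≤ ‖ξ e‖ + ‖η e‖ := norm_add_le _ _
    rw [Real.norm_of_nonneg (by positivity)]
    nlinarith [norm_nonneg ((ξ + η) e), sq_nonneg (‖ξ e‖ - ‖η e‖)]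
  smul_mem' c ξ hξ := by
    have : (fun e => ‖(c • ξ) e‖ ^ 2) = fun e => ‖c‖ ^ 2 * ‖ξ e‖ ^ 2 := by
      funext e
      simp [mul_pow]
    change E.FibreSummable fun e => ‖(c • ξ) e‖ ^ 2
    rw [this]
    exact FibreSummable.const_mul hξ _

/-- `C_d(E¹)` as a type of its own, so that it can carry its own norm. -/
def Cd (E : TopGraph V) : Type u := E.cdSubmodule

variable {E : TopGraph V}

instance : AddCommGroup E.Cd := inferInstanceAs (AddCommGroup E.cdSubmodule)
instance : Module ℂ E.Cd := inferInstanceAs (Module ℂ E.cdSubmodule)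
instance : FunLike E.Cd E.Edge ℂ where
  coe ξ := ξ.1
  coe_injective _ _ h := Subtype.ext (DFunLike.coe_injective h)

namespace Cd

theorem fibreSummable (ξ : E.Cd) : E.FibreSummable fun e => ‖ξ e‖ ^ 2 := ξ.2

theorem continuous (ξ : E.Cd) : Continuous ξ := ξ.1.continuous

/-- An element of `C_d(E¹)` from a function. -/
def mk (f : E.Edge → ℂ) (hf : Continuous f) (h : E.FibreSummable fun e => ‖f e‖ ^ 2) : E.Cd :=
  ⟨⟨f, hf⟩, h⟩

@[simp] theorem mk_apply (f : E.Edge → ℂ) (hf : Continuous f)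
    (h : E.FibreSummable fun e => ‖f e‖ ^ 2) (e : E.Edge) : mk f hf h e = f e := rfl

@[simp] theorem add_apply (ξ η : E.Cd) (e : E.Edge) : (ξ + η) e = ξ e + η e := rfl
@[simp] theorem zero_apply (e : E.Edge) : (0 : E.Cd) e = 0 := rfl
@[simp] theorem smul_apply (c : ℂ) (ξ : E.Cd) (e : E.Edge) : (c • ξ) e = c * ξ e := rfl

@[ext] theorem ext {ξ η : E.Cd} (h : ∀ e, ξ e = η e) : ξ = η := DFunLike.ext _ _ h

theorem norm_star_mul_le (ξ η : E.Cd) (e : E.Edge) :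
    ‖star (ξ e) * η e‖ ≤ ‖ξ e‖ ^ 2 + ‖η e‖ ^ 2 := by
  rw [norm_mul, norm_star]
  nlinarith [sq_nonneg (‖ξ e‖ - ‖η e‖), norm_nonneg (ξ e), norm_nonneg (η e)]

/-- The `C₀(E⁰)`-valued inner product `⟨ξ, η⟩(v) = ∑_{d e = v} conj (ξ e) * η e`. -/
def inner (ξ η : E.Cd) : C₀(V, ℂ) where
  toFun v := ∑' e : E.d ⁻¹' {v}, star (ξ e) * η e
  continuous_toFun :=
    continuous_fibreSum E (F := fun e => star (ξ e) * η e)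
      (h := fun e => ‖ξ e‖ ^ 2 + ‖η e‖ ^ 2)
      (ξ.continuous.star.mul η.continuous)
      ((ξ.continuous.norm.pow 2).add (η.continuous.norm.pow 2))
      (norm_star_mul_le ξ η) (ξ.fibreSummable.add η.fibreSummable).summable
      (ξ.fibreSummable.add η.fibreSummable).continuous_tsum
  zero_at_infty' :=
    (ξ.fibreSummable.add η.fibreSummable).zero_at_infty_of_le (norm_star_mul_le ξ η)

theorem inner_apply (ξ η : E.Cd) (v : V) :
    inner ξ η v = ∑' e : E.d ⁻¹' {v}, star (ξ e) * η e := rfl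

theorem inner_self_apply (ξ : E.Cd) (v : V) :
    inner ξ ξ v = ((∑' e : E.d ⁻¹' {v}, ‖ξ e‖ ^ 2 : ℝ) : ℂ) := by
  rw [inner_apply, Complex.ofReal_tsum]
  refine tsum_congr fun e => ?_
  rw [Complex.ofReal_pow, ← Complex.conj_mul']
  rfl

/-- The norm `‖ξ‖ = sup_v ⟨ξ, ξ⟩(v)^{1/2}`. -/
instance : Norm E.Cd := ⟨fun ξ => ⨆ v, √(∑' e : E.d ⁻¹' {v}, ‖ξ e‖ ^ 2)⟩

theorem norm_def (ξ : E.Cd) : ‖ξ‖ = ⨆ v, √(∑' e : E.d ⁻¹' {v}, ‖ξ e‖ ^ 2) := rfl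

/-- The restriction of `ξ` to a fibre of `d`. -/
def res (v : V) : E.Cd →ₗ[ℂ] lp (fun _ : E.d ⁻¹' {v} => ℂ) 2 where
  toFun ξ := ⟨fun e => ξ e, by
    refine (memℓp_gen_iff (by simp)).2 ?_
    simpa using ξ.fibreSummable.summable v⟩
  map_add' _ _ := rfl
  map_smul' _ _ := rfl

theorem norm_res (v : V) (ξ : E.Cd) : ‖res v ξ‖ = √(∑' e : E.d ⁻¹' {v}, ‖ξ e‖ ^ 2) := by
  rw [lp.norm_eq_tsum_rpow (by simp), Real.sqrt_eq_rpow]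
  simp only [ENNReal.toReal_ofNat, Real.rpow_ofNat]
  rfl

theorem norm_eq_iSup_res (ξ : E.Cd) : ‖ξ‖ = ⨆ v, ‖res v ξ‖ := by
  simp only [norm_res, norm_def]

theorem bddAbove_res (ξ : E.Cd) : BddAbove (Set.range fun v => ‖res v ξ‖) := by
  refine ⟨√‖(inner ξ ξ).toBCF‖, ?_⟩
  rintro _ ⟨v, rfl⟩
  simp only [norm_res]
  refine Real.sqrt_le_sqrt ?_
  have h := (inner ξ ξ).toBCF.norm_coe_le_norm v
  have h2 : (inner ξ ξ).toBCF v = inner ξ ξ v := rfl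
  rw [h2, inner_self_apply, Complex.norm_real] at h
  exact (le_abs_self _).trans h

theorem norm_res_le (v : V) (ξ : E.Cd) : ‖res v ξ‖ ≤ ‖ξ‖ := by
  rw [norm_eq_iSup_res]
  exact le_ciSup (bddAbove_res ξ) v

theorem norm_nonneg' (ξ : E.Cd) : 0 ≤ ‖ξ‖ := by
  rw [norm_eq_iSup_res]
  exact Real.iSup_nonneg fun v => norm_nonneg _

theorem norm_le_of_res {ξ : E.Cd} {M : ℝ} (hM : 0 ≤ M) (h : ∀ v, ‖res v ξ‖ ≤ M) : ‖ξ‖ ≤ M := by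
  rw [norm_eq_iSup_res]
  exact Real.iSup_le h hM

theorem norm_apply_le (ξ : E.Cd) (e : E.Edge) : ‖ξ e‖ ≤ ‖ξ‖ :=
  (lp.norm_apply_le_norm (by simp) (res (E.d e) ξ) ⟨e, rfl⟩).trans (norm_res_le _ ξ)

theorem normCore (E : TopGraph V) : NormedSpace.Core ℂ E.Cd where
  norm_nonneg := norm_nonneg'
  norm_smul c ξ := by
    simp only [norm_eq_iSup_res, map_smul, norm_smul]
    rw [Real.mul_iSup_of_nonneg (norm_nonneg c)]
  norm_triangle ξ η := by
    refine norm_le_of_res (add_nonneg (norm_nonneg' ξ) (norm_nonneg' η)) fun v => ?_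
    rw [map_add]
    exact (norm_add_le _ _).trans (add_le_add (norm_res_le v ξ) (norm_res_le v η))
  norm_eq_zero_iff ξ := by
    constructor
    · intro h
      ext e
      have := norm_apply_le ξ e
      rw [h] at this
      exact norm_le_zero_iff.1 this
    · rintro rfl
      simp [norm_eq_iSup_res]

instance : NormedAddCommGroup E.Cd := NormedAddCommGroup.ofCore (normCore E)
instance : NormedSpace ℂ E.Cd := NormedSpace.ofCore (normCore E)

theorem inner_apply_eq (ξ η : E.Cd) (v : V) :
    inner ξ η v = Inner.inner ℂ (res v ξ) (res v η) := by
  rw [lp.inner_eq_tsum, inner_apply]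
  refine tsum_congr fun e => ?_
  rw [RCLike.inner_apply, mul_comm]
  rfl

theorem norm_inner_apply_le (ξ η : E.Cd) (v : V) : ‖inner ξ η v‖ ≤ ‖ξ‖ * ‖η‖ := by
  rw [inner_apply_eq]
  exact (norm_inner_le_norm _ _).trans
    (mul_le_mul (norm_res_le v ξ) (norm_res_le v η) (norm_nonneg _) (norm_nonneg _))

theorem norm_le_of_bound {ξ η : E.Cd} {M : ℝ} (hM : 0 ≤ M) (h : ∀ e, ‖ξ e‖ ≤ M * ‖η e‖) :
    ‖ξ‖ ≤ M * ‖η‖ := by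
  refine norm_le_of_res (mul_nonneg hM (norm_nonneg _)) fun v => ?_
  refine le_trans ?_ (mul_le_mul_of_nonneg_left (norm_res_le v η) hM)
  rw [norm_res, norm_res, ← Real.sqrt_sq hM, ← Real.sqrt_mul (sq_nonneg M), ← tsum_mul_left]
  refine Real.sqrt_le_sqrt ((ξ.fibreSummable.summable v).tsum_le_tsum (fun e => ?_)
    ((η.fibreSummable.summable v).mul_left _))
  rw [← mul_pow]
  exact pow_le_pow_left₀ (norm_nonneg _) (h e) 2

/-- Multiplication by a bounded continuous function `g` on `E¹`. -/
def mulOp (g : E.Edge →ᵇ ℂ) : E.Cd →L[ℂ] E.Cd :=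
  LinearMap.mkContinuous
    { toFun := fun ξ => mk (fun e => g e * ξ e) (g.continuous.mul ξ.continuous) (by
        refine (ξ.fibreSummable.const_mul (‖g‖ ^ 2)).of_le
          ((g.continuous.mul ξ.continuous).norm.pow 2)
          ((ξ.continuous.norm.pow 2).const_mul _) fun e => ?_
        rw [Real.norm_of_nonneg (by positivity), norm_mul, mul_pow]
        gcongr
        exact g.norm_coe_le_norm e)
      map_add' := fun ξ η => by ext e; simp [mul_add]
      map_smul' := fun c ξ => by ext e; simp [mul_left_comm] }
    ‖g‖ fun ξ => norm_le_of_bound (norm_nonneg g) fun e => by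
      rw [LinearMap.coe_mk, AddHom.coe_mk, mk_apply, norm_mul]
      gcongr
      exact g.norm_coe_le_norm e

@[simp] theorem mulOp_apply (g : E.Edge →ᵇ ℂ) (ξ : E.Cd) (e : E.Edge) :
    mulOp g ξ e = g e * ξ e := rfl

/-- The left action `(π_r(f) ξ)(e) = f (r e) * ξ e` of `C₀(E⁰)`. -/
def leftAct (f : C₀(V, ℂ)) : E.Cd →L[ℂ] E.Cd :=
  mulOp (f.toBCF.compContinuous ⟨E.r, E.continuous_r⟩)

@[simp] theorem leftAct_apply (f : C₀(V, ℂ)) (ξ : E.Cd) (e : E.Edge) :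
    leftAct f ξ e = f (E.r e) * ξ e := rfl

/-- The right action `(ξ f)(e) = ξ e * f (d e)` of `C₀(E⁰)`. -/
def rightAct (f : C₀(V, ℂ)) : E.Cd →L[ℂ] E.Cd :=
  mulOp (f.toBCF.compContinuous ⟨E.d, E.isLocalHomeomorph_d.continuous⟩)

@[simp] theorem rightAct_apply (f : C₀(V, ℂ)) (ξ : E.Cd) (e : E.Edge) :
    rightAct f ξ e = f (E.d e) * ξ e := rfl

/-- The rank one operator `θ_{ξ,η} : ζ ↦ ξ ⟨η, ζ⟩`. -/
def theta (ξ η : E.Cd) : E.Cd →L[ℂ] E.Cd :=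
  LinearMap.mkContinuous
    { toFun := fun ζ => rightAct (inner η ζ) ξ
      map_add' := fun ζ ζ' => by
        ext e
        simp [inner_apply_eq, add_mul]
      map_smul' := fun c ζ => by
        ext e
        simp [inner_apply_eq, mul_assoc] }
    (‖η‖ * ‖ξ‖) fun ζ => by
      rw [mul_right_comm]
      refine norm_le_of_bound (by positivity) fun e => ?_
      rw [LinearMap.coe_mk, AddHom.coe_mk, rightAct_apply, norm_mul]
      gcongr
      exact norm_inner_apply_le η ζ _

theorem theta_apply (ξ η ζ : E.Cd) : theta ξ η ζ = rightAct (inner η ζ) ξ := rfl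

variable (E) in
/-- `K(C_d(E¹))`, the operator norm closure of the linear span of the operators `θ_{ξ,η}`. -/
def compact : Submodule ℂ (E.Cd →L[ℂ] E.Cd) :=
  (Submodule.span ℂ (Set.range fun p : E.Cd × E.Cd => theta p.1 p.2)).topologicalClosure

instance : IsBoundedSMul ℂ (compact E) where
  dist_smul_pair' c x y := dist_smul_pair c (x : E.Cd →L[ℂ] E.Cd) (y : E.Cd →L[ℂ] E.Cd)
  dist_pair_smul' c c' x := dist_pair_smul c c' (x : E.Cd →L[ℂ] E.Cd)

theorem theta_mem_compact (ξ η : E.Cd) : theta ξ η ∈ compact E :=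
  Submodule.le_topologicalClosure _ (Submodule.subset_span ⟨(ξ, η), rfl⟩)

end Cd

/-! ### Elementary tensors -/

/-- The fibre of `E.comp F` over `v` as a union of fibres of `E`. -/
def compFibreEquiv [T2Space V] (E F : TopGraph V) (v : V) :
    (Σ p : F.d ⁻¹' {v}, E.d ⁻¹' {F.r p}) ≃ (E.comp F).d ⁻¹' {v} where
  toFun x := ⟨⟨(x.2.1, x.1.1), x.2.2⟩, x.1.2⟩
  invFun x := ⟨⟨x.1.1.2, x.2⟩, ⟨x.1.1.1, x.1.2⟩⟩
  left_inv _ := rfl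
  right_inv _ := rfl

theorem FibreSummable.comp [T2Space V] {E F : TopGraph V} {h : (E.comp F).Edge → ℝ}
    {H : F.Edge → ℝ} (hH : F.FibreSummable H) (h0 : ∀ x, 0 ≤ h x)
    (hs : ∀ p, HasSum (fun e : E.d ⁻¹' {F.r p} => h ⟨(e.1, p), e.2⟩) (H p)) :
    (E.comp F).FibreSummable h := by
  have hsum : ∀ v, Summable fun x : (Σ p : F.d ⁻¹' {v}, E.d ⁻¹' {F.r p}) =>
      h (compFibreEquiv E F v x).1 := fun v => by
    refine (summable_sigma_of_nonneg fun x => h0 _).2 ⟨fun p => (hs p).summable, ?_⟩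
    exact (hH.summable v).congr fun p => ((hs p).tsum_eq.symm)
  have hts : ∀ v, ∑' x : (E.comp F).d ⁻¹' {v}, h x = ∑' p : F.d ⁻¹' {v}, H p := fun v => by
    rw [← (compFibreEquiv E F v).tsum_eq, (hsum v).tsum_sigma]
    exact tsum_congr fun p => (hs p).tsum_eq
  refine ⟨fun v => (compFibreEquiv E F v).summable_iff.1 (hsum v), ?_, ?_⟩
  · simp only [hts]
    exact hH.continuous_tsum
  · simp only [hts]
    exact hH.zero_at_infty

variable {F : TopGraph V}

theorem tensor_fibreSummable [T2Space V] (ξ : E.Cd) (η : F.Cd) :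
    (E.comp F).FibreSummable fun x => ‖ξ x.1.1 * η x.1.2‖ ^ 2 := by
  have hS : ∀ w, ∑' e : E.d ⁻¹' {w}, ‖ξ e‖ ^ 2 ≤ ‖ξ‖ ^ 2 := fun w => by
    have := Cd.norm_res_le w ξ
    rw [Cd.norm_res] at this
    exact (Real.sqrt_le_left (norm_nonneg _)).1 this
  have hS0 : ∀ w, 0 ≤ ∑' e : E.d ⁻¹' {w}, ‖ξ e‖ ^ 2 := fun w => tsum_nonneg fun e => by positivity
  have hH : F.FibreSummable fun p => (∑' e : E.d ⁻¹' {F.r p}, ‖ξ e‖ ^ 2) * ‖η p‖ ^ 2 := by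
    refine (η.fibreSummable.const_mul (‖ξ‖ ^ 2)).of_le
      ((ξ.fibreSummable.continuous_tsum.comp F.continuous_r).mul (η.continuous.norm.pow 2))
      ((η.continuous.norm.pow 2).const_mul _) fun p => ?_
    rw [Real.norm_of_nonneg (mul_nonneg (hS0 _) (by positivity))]
    exact mul_le_mul_of_nonneg_right (hS _) (by positivity)
  refine hH.comp (fun x => by positivity) fun p => ?_
  simp only [norm_mul, mul_pow]
  exact (ξ.fibreSummable.summable (F.r p)).hasSum.mul_right _

/-- The elementary tensor `ξ ⊗ η`, that is the function `(e, p) ↦ ξ e * η p`. -/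
def tensor [T2Space V] : E.Cd →ₗ[ℂ] F.Cd →ₗ[ℂ] (E.comp F).Cd :=
  LinearMap.mk₂ ℂ
    (fun ξ η => Cd.mk (E := E.comp F) (fun x => ξ x.1.1 * η x.1.2)
      ((ξ.continuous.comp (continuous_fst.comp continuous_subtype_val)).mul
        (η.continuous.comp (continuous_snd.comp continuous_subtype_val)))
      (tensor_fibreSummable ξ η))
    (fun _ _ _ => by ext x; exact add_mul _ _ _)
    (fun _ _ _ => by ext x; exact mul_assoc _ _ _)
    (fun _ _ _ => by ext x; exact mul_add _ _ _)
    (fun _ _ _ => by ext x; exact mul_left_comm _ _ _)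

theorem tensor_apply [T2Space V] (ξ : E.Cd) (η : F.Cd) (x : (E.comp F).Edge) :
    tensor ξ η x = ξ x.1.1 * η x.1.2 := rfl

/-- `C_{d⁰}(E⁰)` is `C₀(E⁰)`. -/
def cdZero [T2Space V] [LocallyCompactSpace V] : (idGraph V).Cd →ₗ[ℂ] C₀(V, ℂ) where
  toFun ξ :=
    { toFun := ξ
      continuous_toFun := ξ.continuous
      zero_at_infty' := by
        have h := ξ.fibreSummable.zero_at_infty
        have h1 : (fun v => ∑' e : (idGraph V).d ⁻¹' {v}, ‖ξ e‖ ^ 2) = fun v => ‖ξ v‖ ^ 2 := by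
          funext v
          exact tsum_singleton (β := V) v (fun e : V => ‖ξ e‖ ^ 2)
        rw [h1] at h
        have h2 := h.sqrt
        simp only [Real.sqrt_sq (norm_nonneg _), Real.sqrt_zero] at h2
        exact tendsto_zero_iff_norm_tendsto_zero.2 h2 }
  map_add' _ _ := rfl
  map_smul' _ _ := rfl

end TopGraph

/-! ### Toeplitz pairs and Cuntz-Krieger pairs -/

open TopGraph

/-- A Toeplitz `E`-pair on a C⋆-algebra `A`. -/
structure ToeplitzPair {V : Type u} [TopologicalSpace V] (E : TopGraph V)
    (A : Type*) [NonUnitalCStarAlgebra A] where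
  T0 : C₀(V, ℂ) →⋆ₙₐ[ℂ] A
  T1 : E.Cd →ₗ[ℂ] A
  star_mul_T1 : ∀ ξ η : E.Cd, star (T1 ξ) * T1 η = T0 (Cd.inner ξ η)
  T0_mul_T1 : ∀ (f : C₀(V, ℂ)) (ξ : E.Cd), T0 f * T1 ξ = T1 (Cd.leftAct f ξ)

namespace ToeplitzPair

variable {V : Type u} [TopologicalSpace V] {E : TopGraph V}
  {A : Type*} [NonUnitalCStarAlgebra A]

/-- The continuous linear extension of `ξ ⊗ η ↦ T¹(ξ) S(η)` from the linear span of the elementary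
tensors `ξ ⊗ η` to `C_d` of the composed graph. -/
def step [T2Space V] (T : ToeplitzPair E A) {F : TopGraph V} (S : F.Cd →ₗ[ℂ] A) :
    (E.comp F).Cd →L[ℂ] A :=
  LinearMap.extendOfNorm
    (TensorProduct.lift ((LinearMap.mul ℂ A).compl₁₂ T.T1 S))
    (TensorProduct.lift (tensor (E := E) (F := F)))

/-- The linear maps `Tⁿ : C_d(Eⁿ) → A`: `T⁰` is the given map, and `Tⁿ⁺¹` is the continuous linear
extension of `ξ ⊗ η ↦ T¹(ξ) Tⁿ(η)`, where `ξ ∈ C_d(E¹)` and `η ∈ C_d(Eⁿ)`. The linear span of these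
elementary tensors is dense in `C_d(Eⁿ⁺¹)`. -/
def pathMap [T2Space V] [LocallyCompactSpace V] (T : ToeplitzPair E A) :
    (n : ℕ) → (E.path n).Cd →ₗ[ℂ] A
  | 0 => (T.T0 : C₀(V, ℂ) →ₗ[ℂ] A) ∘ₗ cdZero
  | n + 1 => (T.step (pathMap T n)).toLinearMap

/-- The map `Φ¹ : K(C_d(E¹)) → A`: the continuous linear extension of
`∑ᵢ cᵢ θ_{ξᵢ,ηᵢ} ↦ ∑ᵢ cᵢ T¹(ξᵢ) T¹(ηᵢ)⋆`. -/
def Phi (T : ToeplitzPair E A) : Cd.compact E →L[ℂ] A :=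
  LinearMap.extendOfNorm
    (Finsupp.linearCombination ℂ fun p : E.Cd × E.Cd => T.T1 p.1 * star (T.T1 p.2))
    (Finsupp.linearCombination ℂ fun p : E.Cd × E.Cd =>
      (⟨Cd.theta p.1 p.2, Cd.theta_mem_compact p.1 p.2⟩ : Cd.compact E))

/-- A Toeplitz pair is a Cuntz-Krieger pair if `T⁰(f) = Φ¹(π_r(f))` for `f ∈ C₀(E⁰_rg)`, that is for
all `f ∈ C₀(E⁰)` which vanish outside `E⁰_rg`. For such `f` the operator `π_r(f)` is in
`K(C_d(E¹))`. -/
def IsCuntzKrieger (T : ToeplitzPair E A) : Prop :=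
  ∀ f : C₀(V, ℂ), (∀ v ∉ E.rg, f v = 0) →
    ∃ h : Cd.leftAct f ∈ Cd.compact E, T.T0 f = T.Phi ⟨Cd.leftAct f, h⟩

theorem norm_T0_le (T : ToeplitzPair E A) (f : C₀(V, ℂ)) : ‖T.T0 f‖ ≤ ‖f‖ :=
  NonUnitalStarAlgHom.norm_apply_le T.T0 f

theorem norm_T1_le (T : ToeplitzPair E A) (ξ : E.Cd) : ‖T.T1 ξ‖ ≤ ‖ξ‖ := by
  have h0 : ‖Cd.inner ξ ξ‖ ≤ ‖ξ‖ * ‖ξ‖ := by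
    change ‖(Cd.inner ξ ξ).toBCF‖ ≤ _
    exact (BoundedContinuousFunction.norm_le (by positivity)).2 fun v =>
      Cd.norm_inner_apply_le ξ ξ v
  have h : ‖T.T1 ξ‖ * ‖T.T1 ξ‖ ≤ ‖ξ‖ * ‖ξ‖ := by
    rw [← CStarRing.norm_star_mul_self, T.star_mul_T1]
    exact (T.norm_T0_le _).trans h0
  exact abs_le_of_sq_le_sq' (by nlinarith) (norm_nonneg _) |>.2

/-- `C⋆(T)`, the C⋆-subalgebra generated by the images of `T⁰` and `T¹`. -/
def cstar (T : ToeplitzPair E A) : NonUnitalStarSubalgebra ℂ A :=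
  (NonUnitalStarAlgebra.adjoin ℂ (Set.range T.T0 ∪ Set.range T.T1)).topologicalClosure

instance (T : ToeplitzPair E A) : IsClosed (T.cstar : Set A) :=
  NonUnitalStarSubalgebra.isClosed_topologicalClosure _

theorem T0_mem (T : ToeplitzPair E A) (f : C₀(V, ℂ)) : T.T0 f ∈ T.cstar :=
  NonUnitalStarSubalgebra.le_topologicalClosure _
    (NonUnitalStarAlgebra.subset_adjoin ℂ _ (Or.inl ⟨f, rfl⟩))

theorem T1_mem (T : ToeplitzPair E A) (ξ : E.Cd) : T.T1 ξ ∈ T.cstar :=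
  NonUnitalStarSubalgebra.le_topologicalClosure _
    (NonUnitalStarAlgebra.subset_adjoin ℂ _ (Or.inr ⟨ξ, rfl⟩))

/-- The pair `T`, regarded as a pair on `C⋆(T)`. -/
def restrict (T : ToeplitzPair E A) : ToeplitzPair E T.cstar where
  T0 := NonUnitalStarAlgHom.codRestrict T.T0 T.cstar T.T0_mem
  T1 :=
    { toFun := fun ξ => ⟨T.T1 ξ, T.T1_mem ξ⟩
      map_add' := fun ξ η => Subtype.ext (map_add T.T1 ξ η)
      map_smul' := fun c ξ => Subtype.ext (map_smul T.T1 c ξ) }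
  star_mul_T1 ξ η := Subtype.ext (T.star_mul_T1 ξ η)
  T0_mul_T1 f ξ := Subtype.ext (T.T0_mul_T1 f ξ)

/-- The map `Tⁿ`, with values in `C⋆(T)`. -/
abbrev Tn [T2Space V] [LocallyCompactSpace V] (T : ToeplitzPair E A) (n : ℕ) :
    (E.path n).Cd →ₗ[ℂ] T.cstar :=
  T.restrict.pathMap n

/-- `F_T`, the closed linear span of the elements `Tᵏ(ξ) Tᵏ(η)⋆` of `C⋆(T)`. -/
def core [T2Space V] [LocallyCompactSpace V] (T : ToeplitzPair E A) : Submodule ℂ T.cstar :=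
  (Submodule.span ℂ
    {x | ∃ (k : ℕ) (ξ η : (E.path k).Cd), x = T.Tn k ξ * star (T.Tn k η)}).topologicalClosure

end ToeplitzPair

/-! ### The universal algebra `O(E)` -/

/-- A Cuntz-Krieger `E`-pair together with the C⋆-algebra on which it lives. -/
structure CKPair {V : Type u} [TopologicalSpace V] (E : TopGraph V) where
  Alg : Type u
  [inst : NonUnitalCStarAlgebra Alg]
  pair : ToeplitzPair E Alg
  isCuntzKrieger : pair.IsCuntzKrieger

attribute [instance] CKPair.inst

section Universal

variable {V : Type u} [TopologicalSpace V] (E : TopGraph V)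

/-- The C⋆-algebra of bounded families `(x_S)`, where `S` runs through all Cuntz-Krieger `E`-pairs and
`x_S` is in the algebra of `S`. -/
abbrev CKProd : Type (u + 1) := lp (fun S : CKPair E => S.Alg) ∞

/-- The universal Cuntz-Krieger pair `t = (t⁰, t¹)`, as the direct sum `(t⁰(f))_S = S⁰(f)`,
`(t¹(ξ))_S = S¹(ξ)` of all Cuntz-Krieger pairs `S`. -/
def univPair : ToeplitzPair E (CKProd E) where
  T0 :=
    { toFun := fun f => ⟨fun S => S.pair.T0 f, memℓp_infty ⟨‖f‖, by
        rintro _ ⟨S, rfl⟩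
        exact S.pair.norm_T0_le f⟩⟩
      map_smul' := fun c f => by ext S; exact map_smul S.pair.T0 c f
      map_zero' := by ext S; exact map_zero S.pair.T0
      map_add' := fun f g => by ext S; exact map_add S.pair.T0 f g
      map_mul' := fun f g => by ext S; exact map_mul S.pair.T0 f g
      map_star' := fun f => by ext S; exact map_star S.pair.T0 f }
  T1 :=
    { toFun := fun ξ => ⟨fun S => S.pair.T1 ξ, memℓp_infty ⟨‖ξ‖, by
        rintro _ ⟨S, rfl⟩
        exact S.pair.norm_T1_le ξ⟩⟩
      map_add' := fun ξ η => by ext S; exact map_add S.pair.T1 ξ η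
      map_smul' := fun c ξ => by ext S; exact map_smul S.pair.T1 c ξ }
  star_mul_T1 ξ η := by ext S; exact S.pair.star_mul_T1 ξ η
  T0_mul_T1 f ξ := by ext S; exact S.pair.T0_mul_T1 f ξ

/-- `O(E)`, the universal C⋆-algebra generated by a Cuntz-Krieger `E`-pair: the C⋆-algebra generated
by the direct sum `t` of all Cuntz-Krieger `E`-pairs. -/
abbrev OE : Type (u + 1) := (univPair E).cstar

/-- The canonical map `t⁰ : C₀(E⁰) → O(E)`. -/
def t0 : C₀(V, ℂ) →⋆ₙₐ[ℂ] OE E := (univPair E).restrict.T0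

/-- The canonical map `t¹ : C_d(E¹) → O(E)`. -/
def t1 : E.Cd →ₗ[ℂ] OE E := (univPair E).restrict.T1

variable {E}

/-- The coordinate projection of the product onto the algebra of the pair `S`. -/
def evalCK (S : CKPair E) : CKProd E →⋆ₙₐ[ℂ] S.Alg where
  toFun x := x S
  map_smul' _ _ := rfl
  map_zero' := rfl
  map_add' _ _ := rfl
  map_mul' _ _ := rfl
  map_star' _ := rfl

theorem evalCK_mem (S : CKPair E) (x : OE E) : evalCK S x ∈ S.pair.cstar := by
  have hc : Continuous (evalCK S) := by
    have : LipschitzWith 1 (evalCK S) := LipschitzWith.of_dist_le_mul fun x y => by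
      rw [dist_eq_norm, dist_eq_norm, ← map_sub, NNReal.coe_one, one_mul]
      exact lp.norm_apply_le_norm ENNReal.top_ne_zero (x - y) S
    exact this.continuous
  have h := NonUnitalStarSubalgebra.map_topologicalClosure_le (φ := evalCK S)
    (NonUnitalStarAlgebra.adjoin ℂ (Set.range (univPair E).T0 ∪ Set.range (univPair E).T1)) hc
  have h1 := h ⟨x, x.2, rfl⟩
  rw [NonUnitalStarAlgHom.map_adjoin, Set.image_union, ← Set.range_comp, ← Set.range_comp] at h1
  exact h1

/-- The canonical map `ρ_T : O(E) → C⋆(T)` of a Cuntz-Krieger pair `T`. -/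
def rho {A : Type u} [NonUnitalCStarAlgebra A] (T : ToeplitzPair E A)
    (hT : T.IsCuntzKrieger) : OE E →⋆ₙₐ[ℂ] T.cstar :=
  NonUnitalStarAlgHom.codRestrict
    ((evalCK ⟨A, T, hT⟩).comp (NonUnitalStarSubalgebraClass.subtype (univPair E).cstar))
    T.cstar (evalCK_mem ⟨A, T, hT⟩)

theorem rho_t0 {A : Type u} [NonUnitalCStarAlgebra A] (T : ToeplitzPair E A)
    (hT : T.IsCuntzKrieger) (f : C₀(V, ℂ)) : rho T hT (t0 E f) = T.restrict.T0 f := rfl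

theorem rho_t1 {A : Type u} [NonUnitalCStarAlgebra A] (T : ToeplitzPair E A)
    (hT : T.IsCuntzKrieger) (ξ : E.Cd) : rho T hT (t1 E ξ) = T.restrict.T1 ξ := rfl

end Universal

/-- `P` is a conditional expectation from the C⋆-algebra `C` onto `B`: a positive contractive linear
projection onto `B` which is `B`-bilinear. -/
structure IsConditionalExpectation {C : Type*} [NonUnitalCStarAlgebra C] (B : Submodule ℂ C)
    (P : C →ₗ[ℂ] C) : Prop where
  mem : ∀ x, P x ∈ B
  apply_of_mem : ∀ b ∈ B, P b = b
  norm_le : ∀ x, ‖P x‖ ≤ ‖x‖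
  positive : ∀ x, ∃ y, P (star x * x) = star y * y
  map_mul_left : ∀ b ∈ B, ∀ x, P (b * x) = b * P x
  map_mul_right : ∀ b ∈ B, ∀ x, P (x * b) = P x * b

end

/-!
The implication (i) ⇒ (ii) needs a gauge action on `O(E)` and the injectivity of `t⁰`. As `O(E)`
lies in the product over all Cuntz-Krieger pairs, the gauge action permutes the coordinates by
`(S⁰, S¹) ↦ (S⁰, z S¹)` (`gaugeOE`). For the injectivity of `t⁰` it is enough to have one injective
Cuntz-Krieger pair (`t0_injective`). It acts on `ℓ²(X)`, where `X` is the set of boundary paths,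
that is the infinite paths and the finite paths whose domain is not regular: `T⁰(f)` is
multiplication by `f ∘ r`, and `T¹(ξ)` maps `δ_x` to the sum of the vectors `ξ(e) δ_{e x}`. The
Cuntz-Krieger relation holds since a boundary path whose range is regular has a first edge, and `T⁰`
is injective since every regular vertex receives an edge.

For (ii) ⇒ (iii) the conditional expectation is the average over the circle (`IsGauge.average`). The
elements `Tⁿ(ξ) Tᵐ(η)⋆` span a dense subspace of `C⋆(T)` (`mem_closure_monomials_restrict`), and
`β_z` multiplies them by `z ^ (n - m)`.

For (iii) ⇒ (i) let `ρ_T(x) = 0`. The map `ρ_T` intertwines the average `Ψ` of the gauge action on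
`O(E)` with `Ψ_T`, hence `ρ_T(Ψ(x⋆ x)) = 0`. The average is faithful, so it remains to see that
`ρ_T` is isometric on the core. The core is the closure of the union of the algebras `F₀ =
t⁰(C₀(E⁰))` and `Fₙ₊₁ = t⁰(C₀(E⁰)) + span {t¹(ξ) a t¹(η)⋆ | a ∈ Fₙ}` (`level`), and the claim is
proved by induction on `n` (`norm_le_norm_map_of_mem_level`). It is first extended from `Fₙ` to the
ideal `span {t¹(ξ) a t¹(η)⋆}` of `Fₙ₊₁`. Let then `x = t⁰(g) + y` be in `Fₙ₊₁`, with `y` in the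
ideal. If `v` is not regular, then `|g(v)|` is at most the norm of `ρ_T(x) = T⁰(g) + ρ_T(y)`,
because `T⁰` is injective (`norm_apply_le_of_notMem_rg`). So `g` is, up to a function of norm at
most `‖ρ_T(x)‖`, a function which vanishes outside of the regular vertices, and by the
Cuntz-Krieger relation such a function is in the closure of the ideal.

The levels are not closed, so the arguments with quotients of C⋆-algebras are replaced by estimates
for powers: the growth rate of `‖x ^ N‖` for a self-adjoint `x` is its norm
(`norm_le_of_norm_succPow_le`), and constant factors do not matter.
-/

noncomputable section

/-! ### Powers and norms in a non-unital C⋆-algebra -/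

/-- The power `x ^ (n + 1)` in a semigroup without unit. -/
def succPow {A : Type*} [Mul A] (x : A) : ℕ → A
  | 0 => x
  | n + 1 => x * succPow x n

theorem succPow_mul_succPow {A : Type*} [Semigroup A] (x : A) (m n : ℕ) :
    succPow x m * succPow x n = succPow x (m + n + 1) := by
  induction m with
  | zero => simp [succPow]
  | succ m ih =>
    rw [succPow, mul_assoc, ih, show m + 1 + n + 1 = (m + n + 1) + 1 by ring]
    rfl

theorem isSelfAdjoint_succPow {A : Type*} [Semigroup A] [StarMul A] {x : A}
    (hx : IsSelfAdjoint x) (n : ℕ) : IsSelfAdjoint (succPow x n) := by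
  induction n with
  | zero => exact hx
  | succ n ih =>
    have h : x * succPow x n = succPow x n * x := by
      have := (succPow_mul_succPow x 0 n).trans (by rw [zero_add, ← add_zero n])
      rw [add_zero] at this
      exact this.trans (succPow_mul_succPow x n 0).symm
    rw [IsSelfAdjoint, succPow, star_mul, ih.star_eq, hx.star_eq, h]

theorem map_succPow {A B F : Type*} [Mul A] [Mul B] [FunLike F A B] [MulHomClass F A B] (φ : F)
    (x : A) (n : ℕ) : φ (succPow x n) = succPow (φ x) n := by
  induction n with
  | zero => rfl
  | succ n ih => rw [succPow, map_mul, ih, succPow]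

theorem norm_succPow_le {A : Type*} [NonUnitalNormedRing A] (x : A) (n : ℕ) :
    ‖succPow x n‖ ≤ ‖x‖ ^ (n + 1) := by
  induction n with
  | zero => simp [succPow]
  | succ n ih =>
    rw [succPow, pow_succ' ‖x‖ (n + 1)]
    exact (norm_mul_le _ _).trans (by gcongr)

theorem norm_mul_self_of_isSelfAdjoint {A : Type*} [NonUnitalCStarAlgebra A] {x : A}
    (hx : IsSelfAdjoint x) : ‖x * x‖ = ‖x‖ ^ 2 := by
  have := CStarRing.norm_star_mul_self (x := x)
  rw [hx.star_eq] at this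
  rw [this, sq]

theorem norm_succPow_two_pow {A : Type*} [NonUnitalCStarAlgebra A] {x : A}
    (hx : IsSelfAdjoint x) (k : ℕ) : ‖succPow x (2 ^ k - 1)‖ = ‖x‖ ^ 2 ^ k := by
  induction k with
  | zero => simp [succPow]
  | succ k ih =>
    have hk : 2 ^ (k + 1) - 1 = (2 ^ k - 1) + (2 ^ k - 1) + 1 := by
      have := Nat.one_le_two_pow (n := k)
      omega
    rw [hk, ← succPow_mul_succPow, norm_mul_self_of_isSelfAdjoint (isSelfAdjoint_succPow hx _), ih,
      ← pow_mul, pow_succ]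

/-- A growth rate of the powers of a self-adjoint element bounds its norm. -/
theorem norm_le_of_norm_succPow_le {A : Type*} [NonUnitalCStarAlgebra A] {x : A}
    (hx : IsSelfAdjoint x) {C M : ℝ} (hM : 0 ≤ M) (K : ℕ)
    (h : ∀ N, ‖succPow x (N + K)‖ ≤ C * M ^ N) : ‖x‖ ≤ M := by
  by_contra! hlt
  have hpos : 0 < ‖x‖ := hM.trans_lt hlt
  -- Along `N = 2 ^ k - 1 - K` the hypothesis reads `‖x‖ ^ (K + 1) ≤ C * (M / ‖x‖) ^ N`.
  have hlim : Tendsto (fun N => C * (M / ‖x‖) ^ N) atTop (𝓝 (C * 0)) :=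
    (tendsto_pow_atTop_nhds_zero_of_lt_one (by positivity) ((div_lt_one hpos).2 hlt)).const_mul C
  rw [mul_zero] at hlim
  obtain ⟨N₀, hN₀⟩ := eventually_atTop.1 (hlim.eventually_lt_const (pow_pos hpos (K + 1)))
  obtain ⟨k, hk⟩ : ∃ k, N₀ + K + 1 ≤ 2 ^ k := ⟨_, Nat.lt_two_pow_self.le⟩
  have h1 := hN₀ (2 ^ k - 1 - K) (by omega)
  have h2 := h (2 ^ k - 1 - K)
  rw [show 2 ^ k - 1 - K + K = 2 ^ k - 1 by omega, norm_succPow_two_pow hx] at h2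
  rw [div_pow, mul_div_assoc', div_lt_iff₀ (by positivity), ← pow_add,
    show K + 1 + (2 ^ k - 1 - K) = 2 ^ k by omega] at h1
  exact absurd h2 (not_le.2 h1)

/-! ### Functions vanishing at infinity -/

namespace ZeroAtInftyContinuousMap

variable {V : Type u} [TopologicalSpace V]

theorem norm_le_of_forall_le {f : C₀(V, ℂ)} {M : ℝ} (hM : 0 ≤ M) (h : ∀ v, ‖f v‖ ≤ M) :
    ‖f‖ ≤ M :=
  (BoundedContinuousFunction.norm_le (f := f.toBCF) hM).2 h

theorem norm_apply_le_norm (f : C₀(V, ℂ)) (v : V) : ‖f v‖ ≤ ‖f‖ :=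
  f.toBCF.norm_coe_le_norm v

/-- Truncation of a function at height `m`. -/
theorem exists_truncation (f : C₀(V, ℂ)) {m : ℝ} (hm : 0 < m) :
    ∃ g : C₀(V, ℂ), ‖g‖ ≤ m ∧ ∀ v, ‖f v‖ ≤ m → g v = f v := by
  have hpos : ∀ v, 0 < max m ‖f v‖ := fun v => lt_max_of_lt_left hm
  have hn : ∀ v, ‖f v * ((m / max m ‖f v‖ : ℝ) : ℂ)‖ = ‖f v‖ * (m / max m ‖f v‖) := fun v => by
    rw [norm_mul, Complex.norm_real, Real.norm_of_nonneg (div_nonneg hm.le (hpos v).le)]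
  refine ⟨{ toFun := fun v => f v * ((m / max m ‖f v‖ : ℝ) : ℂ)
            continuous_toFun := ?_
            zero_at_infty' := ?_ }, norm_le_of_forall_le hm.le fun v => ?_, fun v hv => ?_⟩
  · refine (map_continuous f).mul (Complex.continuous_ofReal.comp ?_)
    exact continuous_const.div (continuous_const.max (map_continuous f).norm) fun v => (hpos v).ne'
  · have h0 := tendsto_zero_iff_norm_tendsto_zero.1 (zero_at_infty f)
    refine squeeze_zero_norm (fun v => ?_) h0
    rw [hn]
    exact mul_le_of_le_one_right (norm_nonneg _) ((div_le_one (hpos v)).2 (le_max_left _ _))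
  · refine (hn v).trans_le ?_
    rw [mul_div_assoc', div_le_iff₀ (hpos v), mul_comm]
    exact mul_le_mul_of_nonneg_left (le_max_right _ _) hm.le
  · change f v * ((m / max m ‖f v‖ : ℝ) : ℂ) = f v
    rw [max_eq_left hv, div_self hm.ne', Complex.ofReal_one, mul_one]

theorem isCompact_le_norm (f : C₀(V, ℂ)) {ε : ℝ} (hε : 0 < ε) : IsCompact {v | ε ≤ ‖f v‖} := by
  have h0 := tendsto_zero_iff_norm_tendsto_zero.1 (zero_at_infty f)
  obtain ⟨t, ht, hts⟩ := mem_cocompact.1 (h0.eventually_lt_const hε)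
  refine ht.of_isClosed_subset (isClosed_le continuous_const (map_continuous f).norm) fun v hv => ?_
  by_contra hvt
  have h1 : ‖f v‖ < ε := hts hvt
  exact absurd h1 (not_lt.2 hv)

theorem exists_eq_one_on [T2Space V] [LocallyCompactSpace V] {K O : Set V} (hK : IsCompact K)
    (hO : IsOpen O) (hKO : K ⊆ O) :
    ∃ f : C₀(V, ℂ), (∀ v ∈ K, f v = 1) ∧ (∀ v ∉ O, f v = 0) ∧ ‖f‖ ≤ 1 := by
  obtain ⟨φ, h1, hc, hs, h01⟩ := exists_continuousMap_one_of_isCompact_subset_isOpen hK hO hKO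
  refine ⟨{ toFun := fun v => (φ v : ℂ)
            continuous_toFun := Complex.continuous_ofReal.comp φ.continuous
            zero_at_infty' := ?_ }, fun v hv => ?_, fun v hv => ?_,
    norm_le_of_forall_le zero_le_one fun v => ?_⟩
  · refine HasCompactSupport.is_zero_at_infty ?_
    exact HasCompactSupport.comp_left (g := fun x : ℝ => (x : ℂ)) hc Complex.ofReal_zero
  · change (φ v : ℂ) = 1
    rw [h1 hv]
    simp
  · change (φ v : ℂ) = 0
    rw [image_eq_zero_of_notMem_tsupport fun h => hv (hs h), Complex.ofReal_zero]
  · change ‖(φ v : ℂ)‖ ≤ 1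
    rw [Complex.norm_real, Real.norm_of_nonneg (h01 v).1]
    exact (h01 v).2

end ZeroAtInftyContinuousMap

/-! ### Compactly supported elements of `C_d` -/

theorem tsum_fibre_eq {X Y G : Type*} [NormedAddCommGroup G] {p : X → Y} {φ : X → G} {O : Set X}
    (hp : Set.InjOn p O) (hφ : ∀ x ∉ O, φ x = 0) {x : X} (hx : x ∈ O) :
    ∑' x' : p ⁻¹' {p x}, φ x' = φ x := by
  rw [tsum_eq_single (⟨x, rfl⟩ : p ⁻¹' {p x})]
  rintro ⟨x', hx'⟩ hne
  by_contra h
  have hx'O : x' ∈ O := by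
    by_contra h'
    exact h (hφ x' h')
  exact hne (Subtype.ext (hp hx'O hx hx'))

theorem tsum_fibre_eq_zero {X Y G : Type*} [NormedAddCommGroup G] {p : X → Y} {φ : X → G} {y : Y}
    {S : Set X} (hφ : ∀ x ∉ S, φ x = 0) (hy : y ∉ p '' S) :
    ∑' x' : p ⁻¹' {y}, φ x' = 0 := by
  have : ∀ x' : p ⁻¹' {y}, φ x' = 0 := fun x' => hφ _ fun h => hy ⟨_, h, x'.2⟩
  simp [this]

theorem summable_fibre {X Y G : Type*} [NormedAddCommGroup G] {p : X → Y} {φ : X → G} {O : Set X}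
    (hinj : Set.InjOn p O) (h0 : ∀ x ∉ O, φ x = 0) (y : Y) :
    Summable fun x : p ⁻¹' {y} => φ x := by
  by_cases hy : y ∈ p '' O
  · obtain ⟨x, hx, rfl⟩ := hy
    refine summable_of_ne_finset_zero (s := {⟨x, rfl⟩}) ?_
    rintro ⟨x', hx'⟩ hne
    by_contra h
    refine hne (Finset.mem_singleton.2 (Subtype.ext (hinj ?_ hx hx')))
    by_contra h'
    exact h (h0 x' h')
  · refine summable_zero.congr fun x => ?_
    exact (h0 _ fun h => hy ⟨_, h, x.2⟩).symm

section LocalSum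

variable {X Y G : Type*} [TopologicalSpace X] [TopologicalSpace Y] [T2Space Y]
  [NormedAddCommGroup G] {p : X → Y} {φ : X → G} {O : Set X}

/-- The push-forward of a compactly supported function which lives on an open set on which the
local homeomorphism `p` is injective. -/
theorem continuous_tsum_fibre (hp : IsLocalHomeomorph p) (hφ : Continuous φ)
    (hc : HasCompactSupport φ) (hO : IsOpen O) (hinj : Set.InjOn p O) (hs : tsupport φ ⊆ O) :
    Continuous fun y => ∑' x : p ⁻¹' {y}, φ x := by
  have h0 : ∀ x ∉ O, φ x = 0 := fun x hx => image_eq_zero_of_notMem_tsupport fun h => hx (hs h)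
  rw [continuous_iff_continuousAt]
  intro y
  by_cases hy : y ∈ p '' tsupport φ
  · obtain ⟨x, hx, rfl⟩ := hy
    have hmap := hp.map_nhds_eq x
    rw [ContinuousAt, ← hmap, tendsto_map'_iff, tsum_fibre_eq hinj h0 (hs hx)]
    refine hφ.continuousAt.tendsto.congr' ?_
    filter_upwards [hO.mem_nhds (hs hx)] with x' hx'
    exact (tsum_fibre_eq hinj h0 hx').symm
  · have hcl : IsClosed (p '' tsupport φ) := (hc.isCompact.image hp.continuous).isClosed
    refine (continuousAt_const (y := (0 : G))).congr ?_
    filter_upwards [hcl.isOpen_compl.mem_nhds hy] with y' hy'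
    exact (tsum_fibre_eq_zero (fun x hx => image_eq_zero_of_notMem_tsupport hx) hy').symm

end LocalSum

namespace TopGraph

variable {V : Type u} [TopologicalSpace V]

theorem exists_isOpen_injOn (E : TopGraph V) (e : E.Edge) :
    ∃ O : Set E.Edge, IsOpen O ∧ e ∈ O ∧ Set.InjOn E.d O :=
  ⟨_, (E.isLocalHomeomorph_d.localInverseAt e).open_target,
    E.isLocalHomeomorph_d.self_mem_localInverseAt_target,
    E.isLocalHomeomorph_d.injOn_localInverseAt_target⟩

namespace Cd

variable {E : TopGraph V}

theorem sub_apply (ξ η : E.Cd) (e : E.Edge) : (ξ - η) e = ξ e - η e := rfl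

theorem mulOp_mul (g h : E.Edge →ᵇ ℂ) (ζ : E.Cd) : mulOp (g * h) ζ = mulOp g (mulOp h ζ) := by
  ext e
  simp [mul_assoc]

/-- Cut-off functions on the edge space. -/
theorem exists_cutoff {K O : Set E.Edge} (hK : IsCompact K) (hO : IsOpen O) (hKO : K ⊆ O) :
    ∃ χ : E.Edge →ᵇ ℂ, (∀ e ∈ K, χ e = 1) ∧ HasCompactSupport χ ∧ tsupport χ ⊆ O ∧
      (∀ e, ‖χ e‖ ≤ 1) ∧ ∀ e, ‖1 - χ e‖ ≤ 1 := by
  obtain ⟨φ, h1, hc, hs, h01⟩ := exists_continuousMap_one_of_isCompact_subset_isOpen hK hO hKO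
  have hn : ∀ e, ‖(φ e : ℂ)‖ ≤ 1 := fun e => by
    rw [Complex.norm_real, Real.norm_of_nonneg (h01 e).1]
    exact (h01 e).2
  refine ⟨BoundedContinuousFunction.ofNormedAddCommGroup (fun e => (φ e : ℂ))
    (Complex.continuous_ofReal.comp φ.continuous) 1 hn, fun e he => ?_, ?_, ?_, hn, fun e => ?_⟩
  · change (φ e : ℂ) = 1
    rw [h1 he]
    simp
  · exact HasCompactSupport.comp_left (g := fun x : ℝ => (x : ℂ)) hc Complex.ofReal_zero
  · refine (closure_mono fun x hx => ?_).trans hs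
    exact fun h => hx (show (φ x : ℂ) = 0 by simp [h])
  · change ‖1 - (φ e : ℂ)‖ ≤ 1
    rw [← Complex.ofReal_one, ← Complex.ofReal_sub, Complex.norm_real,
      Real.norm_of_nonneg (by linarith [(h01 e).2])]
    linarith [(h01 e).1]

/-- A subspace of `C_d(E¹)` is dense if it absorbs `ζ - g ζ` for suitable multipliers `g` which
vanish at prescribed edges. Finite products of such `g` make the fibre sums of `|g ζ|²` small near
any vertex, hence on any compact set of vertices. -/
theorem dense_of_forall_multiplier (W : Submodule ℂ E.Cd)
    (hW : ∀ e, ∃ g : E.Edge →ᵇ ℂ, g e = 0 ∧ (∀ e', ‖g e'‖ ≤ 1) ∧ ∀ ζ, ζ - mulOp g ζ ∈ W) :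
    Dense (W : Set E.Cd) := by
  classical
  let M : Set (E.Edge →ᵇ ℂ) := {g | (∀ e', ‖g e'‖ ≤ 1) ∧ ∀ ζ, ζ - mulOp g ζ ∈ W}
  have hone : (1 : E.Edge →ᵇ ℂ) ∈ M := by
    refine ⟨fun e => by simp, fun ζ => ?_⟩
    have : ζ - mulOp 1 ζ = 0 := by
      ext e
      simp [sub_apply]
    rw [this]
    exact W.zero_mem
  have hmul : ∀ g ∈ M, ∀ h ∈ M, g * h ∈ M := by
    rintro g ⟨hg, hg'⟩ h ⟨hh, hh'⟩
    refine ⟨fun e => ?_, fun ζ => ?_⟩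
    · rw [BoundedContinuousFunction.mul_apply, norm_mul]
      exact mul_le_one₀ (hg e) (norm_nonneg _) (hh e)
    · rw [mulOp_mul, ← sub_add_sub_cancel ζ (mulOp h ζ)]
      exact W.add_mem (hh' ζ) (hg' _)
  have hfin : ∀ s : Finset E.Edge, ∃ g ∈ M, ∀ e ∈ s, g e = 0 := by
    intro s
    induction s using Finset.induction_on with
    | empty => exact ⟨1, hone, by simp⟩
    | insert e s _ ih =>
      obtain ⟨g, hg, hgs⟩ := ih
      obtain ⟨h, hhe, hh⟩ := hW e
      refine ⟨h * g, hmul h hh g hg, fun e' he' => ?_⟩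
      rcases Finset.mem_insert.1 he' with rfl | he'
      · simp [hhe]
      · simp [hgs e' he']
  rw [Metric.dense_iff]
  intro ζ ε hε
  let N : (E.Edge →ᵇ ℂ) → V → ℝ := fun g v => ∑' e : E.d ⁻¹' {v}, ‖g e * ζ e‖ ^ 2
  have hNs : ∀ (g : E.Edge →ᵇ ℂ) v, Summable fun e : E.d ⁻¹' {v} => ‖g e * ζ e‖ ^ 2 := fun g v =>
    (mulOp g ζ).fibreSummable.summable v
  have hNc : ∀ g, Continuous (N g) := fun g => (mulOp g ζ).fibreSummable.continuous_tsum
  have hNle : ∀ g ∈ M, ∀ h v, N (g * h) v ≤ N h v := fun g hg h v => by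
    refine (hNs _ v).tsum_le_tsum (fun e => ?_) (hNs _ v)
    rw [BoundedContinuousFunction.mul_apply, mul_assoc, norm_mul]
    exact pow_le_pow_left₀ (by positivity) (mul_le_of_le_one_left (norm_nonneg _) (hg.1 e)) 2
  let δ : ℝ := ε / 2
  have hδ : 0 < δ := by positivity
  have hlocal : ∀ v, ∃ g ∈ M, N g v < δ ^ 2 := by
    intro v
    obtain ⟨s, hs⟩ := ((ζ.fibreSummable.summable v).hasSum.eventually
      (lt_mem_nhds (sub_lt_self _ (by positivity : 0 < δ ^ 2)))).exists
    obtain ⟨g, hg, hgs⟩ := hfin (s.image Subtype.val)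
    refine ⟨g, hg, ?_⟩
    have h := norm_tsum_sub_sum_le (F := fun e : E.d ⁻¹' {v} => ‖g e.1 * ζ e.1‖ ^ 2)
      (h := fun e => ‖ζ e.1‖ ^ 2) (fun e => ?_) (ζ.fibreSummable.summable v) s
    · rw [Finset.sum_eq_zero fun e he => ?_, sub_zero] at h
      · have := (Real.le_norm_self _).trans h
        change N g v ≤ _ at this
        linarith
      · rw [hgs e.1 (Finset.mem_image_of_mem _ he)]
        simp
    · rw [Real.norm_of_nonneg (by positivity), norm_mul]
      exact pow_le_pow_left₀ (by positivity)
        (mul_le_of_le_one_left (norm_nonneg _) (hg.1 e)) 2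
  obtain ⟨t, ht, hts⟩ := mem_cocompact.1
    (ζ.fibreSummable.zero_at_infty.eventually_lt_const (by positivity : 0 < δ ^ 2))
  obtain ⟨g, hg, hgt⟩ : ∃ g ∈ M, ∀ v ∈ t, N g v < δ ^ 2 := by
    refine ht.induction_on (p := fun S => ∃ g ∈ M, ∀ v ∈ S, N g v < δ ^ 2)
      ⟨1, hone, by simp⟩ (fun s t hst ⟨g, hg, h⟩ => ⟨g, hg, fun v hv => h v (hst hv)⟩) ?_ ?_
    · rintro S T ⟨g, hg, hS⟩ ⟨h, hh, hT⟩
      refine ⟨g * h, hmul g hg h hh, ?_⟩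
      rintro v (hv | hv)
      · rw [mul_comm]
        exact (hNle h hh g v).trans_lt (hS v hv)
      · exact (hNle g hg h v).trans_lt (hT v hv)
    · intro v _
      obtain ⟨g, hg, hgv⟩ := hlocal v
      exact ⟨_, mem_nhdsWithin_of_mem_nhds ((hNc g).continuousAt.eventually_lt_const hgv),
        g, hg, fun _ h => h⟩
  refine ⟨ζ - mulOp g ζ, ?_, hg.2 ζ⟩
  rw [mem_ball_iff_norm, sub_sub_cancel_left, norm_neg]
  refine lt_of_le_of_lt (norm_le_of_res hδ.le fun v => ?_) (half_lt_self hε)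
  rw [norm_res]
  refine (Real.sqrt_le_left hδ.le).2 ?_
  change N g v ≤ δ ^ 2
  by_cases hv : v ∈ t
  · exact (hgt v hv).le
  · have h1 : N 1 v < δ ^ 2 := by simpa [N] using hts hv
    rw [← mul_one g]
    exact (hNle g hg 1 v).trans h1.le

/-- A subspace of `C_d(E¹)` is dense if it contains all elements with small compact support. -/
theorem dense_of_forall_small_support (W : Submodule ℂ E.Cd)
    (hW : ∀ e : E.Edge, ∃ O : Set E.Edge, IsOpen O ∧ e ∈ O ∧
      ∀ ζ : E.Cd, HasCompactSupport ζ → tsupport ζ ⊆ O → ζ ∈ W) :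
    Dense (W : Set E.Cd) := by
  refine dense_of_forall_multiplier W fun e => ?_
  obtain ⟨O, hO, heO, h⟩ := hW e
  obtain ⟨χ, h1, hc, hs, -, hn⟩ := exists_cutoff (isCompact_singleton (x := e)) hO
    (Set.singleton_subset_iff.2 heO)
  refine ⟨1 - χ, by simp [h1 e rfl], fun e' => by simpa using hn e', fun ζ => ?_⟩
  have : ζ - mulOp (1 - χ) ζ = mulOp χ ζ := by
    ext e
    rw [sub_apply, mulOp_apply, mulOp_apply, BoundedContinuousFunction.sub_apply,
      BoundedContinuousFunction.coe_one, Pi.one_apply]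
    ring
  rw [this]
  exact h _ (hc.mul_right (f' := ζ))
    ((closure_mono (Function.support_mul_subset_left _ _)).trans hs)

/-- The compactly supported elements are dense in `C_d(E¹)`. -/
theorem dense_hasCompactSupport : Dense {ζ : E.Cd | HasCompactSupport ζ} := by
  let W : Submodule ℂ E.Cd :=
    { carrier := {ζ | HasCompactSupport ζ}
      add_mem' := fun h h' => HasCompactSupport.add h h'
      zero_mem' := HasCompactSupport.zero
      smul_mem' := fun c _ h => HasCompactSupport.comp_left (g := fun x => c * x) h (mul_zero c) }
  exact dense_of_forall_small_support W fun e =>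
    ⟨Set.univ, isOpen_univ, trivial, fun ζ h _ => h⟩

end Cd

variable [T2Space V] {E : TopGraph V}

theorem fibreSummable_of_injOn {h : E.Edge → ℝ} {O : Set E.Edge} (hh : Continuous h)
    (hc : HasCompactSupport h) (hO : IsOpen O) (hinj : Set.InjOn E.d O) (hs : tsupport h ⊆ O) :
    E.FibreSummable h where
  summable := summable_fibre hinj fun _ hx => image_eq_zero_of_notMem_tsupport fun h => hx (hs h)
  continuous_tsum := continuous_tsum_fibre E.isLocalHomeomorph_d hh hc hO hinj hs
  zero_at_infty := by
    refine tendsto_const_nhds.congr' ?_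
    filter_upwards [(hc.isCompact.image E.isLocalHomeomorph_d.continuous).compl_mem_cocompact]
      with v hv
    exact (tsum_fibre_eq_zero (fun x hx => image_eq_zero_of_notMem_tsupport hx) hv).symm

namespace Cd

/-- A compactly supported function which lives on an open set on which `d` is injective, as an
element of `C_d(E¹)`. -/
def ofInjOn {φ : E.Edge → ℂ} {O : Set E.Edge} (hφ : Continuous φ)
    (hc : HasCompactSupport φ) (hO : IsOpen O) (hinj : Set.InjOn E.d O) (hs : tsupport φ ⊆ O) :
    E.Cd :=
  mk φ hφ (fibreSummable_of_injOn (hφ.norm.pow 2)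
    (hc.comp_left (g := fun x => ‖x‖ ^ 2) (by simp)) hO hinj
    ((closure_mono (Function.support_subset_iff'.2 fun x hx => by
      simp [Function.notMem_support.1 hx])).trans hs))

@[simp] theorem ofInjOn_apply {φ : E.Edge → ℂ} {O : Set E.Edge} (hφ : Continuous φ)
    (hc : HasCompactSupport φ) (hO : IsOpen O) (hinj : Set.InjOn E.d O) (hs : tsupport φ ⊆ O)
    (e : E.Edge) : ofInjOn hφ hc hO hinj hs e = φ e := rfl

theorem exists_bump {K O : Set E.Edge} (hK : IsCompact K) (hO : IsOpen O) (hKO : K ⊆ O)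
    (hinj : Set.InjOn E.d O) :
    ∃ ζ : E.Cd, (∀ e ∈ K, ζ e = 1) ∧ (∀ e ∉ O, ζ e = 0) ∧ ‖ζ‖ ≤ 1 := by
  obtain ⟨χ, h1, hc, hs, hn, -⟩ := exists_cutoff hK hO hKO
  have h0 : ∀ e ∉ O, χ e = 0 := fun e he => image_eq_zero_of_notMem_tsupport fun h => he (hs h)
  refine ⟨ofInjOn χ.continuous hc hO hinj hs, h1, h0, norm_le_of_res zero_le_one fun v => ?_⟩
  rw [norm_res]
  refine Real.sqrt_le_one.2 ?_
  have h0' : ∀ e ∉ O, ‖χ e‖ ^ 2 = 0 := fun e he => by simp [h0 e he]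
  by_cases hv : v ∈ E.d '' O
  · obtain ⟨e, he, rfl⟩ := hv
    refine (tsum_fibre_eq hinj h0' he).trans_le ?_
    exact pow_le_one₀ (norm_nonneg _) (hn e)
  · exact (tsum_fibre_eq_zero h0' hv).trans_le zero_le_one

/-- The elements `ξ f` are dense in `C_d(E¹)`. -/
theorem dense_rightAct [LocallyCompactSpace V] :
    Dense {ζ : E.Cd | ∃ f : C₀(V, ℂ), rightAct f ζ = ζ} := by
  refine dense_hasCompactSupport.mono fun ζ hζ => ?_
  obtain ⟨f, hf, -, -⟩ := ZeroAtInftyContinuousMap.exists_eq_one_on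
    (hζ.isCompact.image E.isLocalHomeomorph_d.continuous) isOpen_univ (Set.subset_univ _)
  refine ⟨f, ?_⟩
  ext e
  rw [rightAct_apply]
  by_cases he : e ∈ tsupport ζ
  · rw [hf _ ⟨e, he, rfl⟩, one_mul]
  · rw [image_eq_zero_of_notMem_tsupport he, mul_zero]

end Cd
end TopGraph

/-! ### Regular vertices act by compact operators -/

namespace TopGraph

variable {V : Type u} [TopologicalSpace V] {E : TopGraph V}

theorem mem_range_r_of_mem_rg [T2Space V] {v : V} (hv : v ∈ E.rg) : v ∈ Set.range E.r := by
  obtain ⟨⟨U, hU, hc⟩, hs⟩ := hv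
  -- Near `v` the range of `r` is the compact set `r (r⁻¹ U)`, and `v` is in its closure.
  have hcl : v ∈ closure (Set.range E.r) := by
    by_contra h
    exact hs (subset_closure h)
  have h1 : v ∈ closure (E.r '' (E.r ⁻¹' U)) := by
    rw [Set.image_preimage_eq_inter_range, mem_closure_iff_nhds]
    intro t ht
    obtain ⟨w, ⟨hwt, hwU⟩, hw⟩ := mem_closure_iff_nhds.1 hcl _ (inter_mem ht hU)
    exact ⟨w, hwt, hwU, hw⟩
  rw [(hc.image E.continuous_r).isClosed.closure_eq] at h1
  exact Set.image_subset_range _ _ h1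

theorem isCompact_preimage_r {K : Set V} (hK : IsCompact K) (hcl : IsClosed K)
    (hf : K ⊆ E.fin) : IsCompact (E.r ⁻¹' K) := by
  obtain ⟨L, hL, hKL⟩ : ∃ L, IsCompact L ∧ E.r ⁻¹' K ⊆ L := by
    refine hK.induction_on (p := fun S => ∃ L, IsCompact L ∧ E.r ⁻¹' S ⊆ L)
      ⟨∅, isCompact_empty, by simp⟩ (fun s t hst ⟨L, hL, h⟩ => ⟨L, hL,
        (Set.preimage_mono hst).trans h⟩) ?_ ?_
    · rintro s t ⟨L, hL, h⟩ ⟨L', hL', h'⟩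
      exact ⟨L ∪ L', hL.union hL', Set.union_subset_union h h'⟩
    · intro v hv
      obtain ⟨U, hU, hc⟩ := hf hv
      exact ⟨U, mem_nhdsWithin_of_mem_nhds hU, _, hc, subset_rfl⟩
  exact hL.of_isClosed_subset (hcl.preimage E.continuous_r) hKL

namespace Cd

theorem mulOp_sub (g h : E.Edge →ᵇ ℂ) : mulOp (E := E) (g - h) = mulOp g - mulOp h := by
  ext ζ e
  exact sub_mul _ _ _

theorem norm_mulOp_le (g : E.Edge →ᵇ ℂ) : ‖mulOp (E := E) g‖ ≤ ‖g‖ :=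
  LinearMap.mkContinuous_norm_le _ (norm_nonneg g) _

theorem isClosed_compact : IsClosed (compact E : Set (E.Cd →L[ℂ] E.Cd)) :=
  Submodule.isClosed_topologicalClosure _

variable [T2Space V]

/-- Multiplication by a compactly supported function is a compact operator: a function with small
support acts as a rank one operator. -/
theorem mulOp_mem_compact (g : E.Edge →ᵇ ℂ) (hg : HasCompactSupport g) :
    mulOp g ∈ compact E := by
  let M : Set (E.Edge →ᵇ ℂ) :=
    {m | ∀ g : E.Edge →ᵇ ℂ, HasCompactSupport g → mulOp g - mulOp (m * g) ∈ compact E}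
  obtain ⟨m, hm, hmg⟩ : ∃ m ∈ M, ∀ e ∈ tsupport g, m e = 0 := by
    refine hg.isCompact.induction_on (p := fun S => ∃ m ∈ M, ∀ e ∈ S, m e = 0)
      ⟨1, fun g _ => ?_, by simp⟩ (fun s t hst ⟨m, hm, h⟩ => ⟨m, hm, fun e he => h e (hst he)⟩)
      ?_ ?_
    · rw [one_mul, sub_self]
      exact Submodule.zero_mem _
    · rintro s t ⟨m, hm, hs⟩ ⟨m', hm', ht⟩
      refine ⟨m * m', fun g hg => ?_, ?_⟩
      · rw [mul_assoc, ← sub_add_sub_cancel (mulOp g) (mulOp (m' * g))]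
        exact Submodule.add_mem _ (hm' g hg)
          (hm _ (HasCompactSupport.mul_left (f := m') (f' := g) hg))
      · rintro e (he | he)
        · simp [hs e he]
        · simp [ht e he]
    · intro e _
      obtain ⟨O, hO, heO, hinj⟩ := E.exists_isOpen_injOn e
      obtain ⟨K, hK, heK, hKO⟩ := exists_compact_subset hO heO
      obtain ⟨χ, h1, hc, hs, -, -⟩ := exists_cutoff hK hO hKO
      refine ⟨K, mem_nhdsWithin_of_mem_nhds (mem_interior_iff_mem_nhds.1 heK), 1 - χ,
        fun g hg => ?_, fun e he => by simp [h1 e he]⟩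
      have hg' : g - (1 - χ) * g = χ * g := by ring
      have hsO : tsupport (⇑(χ * g)) ⊆ O :=
        (closure_mono (Function.support_mul_subset_left _ _)).trans hs
      have hcc : HasCompactSupport (⇑(χ * g)) := hc.mul_right (f' := g)
      obtain ⟨η, hη1, hη0, -⟩ := exists_bump hcc hO hsO hinj
      have : mulOp (χ * g) = theta (ofInjOn (χ * g).continuous hcc hO hinj hsO) η := by
        ext ζ e
        rw [theta_apply, rightAct_apply, ofInjOn_apply, mulOp_apply]
        by_cases he : e ∈ tsupport (⇑(χ * g))
        · rw [inner_apply, tsum_fibre_eq (φ := fun e => star (η e) * ζ e) hinj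
            (fun x hx => by simp [hη0 x hx]) (hsO he), hη1 e he, star_one, one_mul, mul_comm]
        · rw [image_eq_zero_of_notMem_tsupport he, zero_mul, mul_zero]
      rw [← mulOp_sub, hg', this]
      exact theta_mem_compact _ _
  have : m * g = 0 := by
    ext e
    by_cases he : e ∈ tsupport g
    · simp [hmg e he]
    · simp [image_eq_zero_of_notMem_tsupport he]
  have h := hm g hg
  rwa [← mulOp_sub, this, sub_zero] at h

/-- The functions in `C₀(E⁰_rg)` act on `C_d(E¹)` by compact operators. -/
theorem leftAct_mem_compact {f : C₀(V, ℂ)} (hf : ∀ v ∉ E.rg, f v = 0) :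
    leftAct f ∈ compact E := by
  rw [← SetLike.mem_coe, ← isClosed_compact.closure_eq, Metric.mem_closure_iff]
  intro ε hε
  obtain ⟨g, hg, hgf⟩ := f.exists_truncation (half_pos hε)
  have hK := f.isCompact_le_norm (half_pos hε)
  have hcl : IsClosed {v | ε / 2 ≤ ‖f v‖} :=
    isClosed_le continuous_const (map_continuous f).norm
  have hKf : {v | ε / 2 ≤ ‖f v‖} ⊆ E.fin := fun v hv => by
    by_contra h
    have hv' : ε / 2 ≤ ‖f v‖ := hv
    rw [hf v fun h' => h h'.1, norm_zero] at hv'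
    linarith
  have hc := isCompact_preimage_r hK hcl hKf
  refine ⟨leftAct (f - g), mulOp_mem_compact _ ?_, ?_⟩
  · refine HasCompactSupport.of_support_subset_isCompact hc fun e he => ?_
    by_contra h
    have h' : ‖f (E.r e)‖ ≤ ε / 2 := (not_le.1 h).le
    exact he (sub_eq_zero.2 (hgf _ h').symm)
  · have : leftAct f - leftAct (f - g) = leftAct (E := E) g := by
      ext ζ e
      simp [sub_apply, sub_mul]
    rw [dist_eq_norm, this]
    refine (norm_mulOp_le _).trans_lt (lt_of_le_of_lt ?_ (half_lt_self hε))
    refine (BoundedContinuousFunction.norm_le (half_pos hε).le).2 fun e => ?_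
    exact (g.norm_apply_le_norm _).trans hg

/-! ### Elementary tensors span a dense subspace -/

variable {F : TopGraph V}

/-- A function on the composed graph with small compact support is an elementary tensor, since near
an edge `(e, p)` the edge `e` is determined by `p`. -/
theorem dense_range_tensor :
    Dense (LinearMap.range (TensorProduct.lift (tensor (E := E) (F := F))) :
      Set (E.comp F).Cd) := by
  refine dense_of_forall_small_support _ ?_
  rintro ⟨⟨e, p⟩, hep⟩
  obtain ⟨A, hA, heA, hAi⟩ := E.exists_isOpen_injOn e
  obtain ⟨B, hB, hpB, hBi⟩ := F.exists_isOpen_injOn p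
  have hcont1 : Continuous fun x : (E.comp F).Edge => x.1.1 :=
    continuous_fst.comp continuous_subtype_val
  have hcont2 : Continuous fun x : (E.comp F).Edge => x.1.2 :=
    continuous_snd.comp continuous_subtype_val
  refine ⟨{x | x.1.1 ∈ A ∧ x.1.2 ∈ B}, (hA.preimage hcont1).inter (hB.preimage hcont2),
    ⟨heA, hpB⟩, fun φ hc hs => ?_⟩
  have hO : IsOpen {x : (E.comp F).Edge | x.1.1 ∈ A ∧ x.1.2 ∈ B} :=
    (hA.preimage hcont1).inter (hB.preimage hcont2)
  have hinj : Set.InjOn (fun x : (E.comp F).Edge => x.1.2)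
      {x : (E.comp F).Edge | x.1.1 ∈ A ∧ x.1.2 ∈ B} := by
    rintro ⟨⟨e, p⟩, h⟩ ⟨he, -⟩ ⟨⟨e', p'⟩, h'⟩ ⟨he', -⟩ hpp
    obtain rfl : p = p' := hpp
    obtain rfl : e = e' := hAi he he' (h.trans h'.symm)
    rfl
  have h0 : ∀ x ∉ tsupport φ, φ x = 0 := fun x hx => image_eq_zero_of_notMem_tsupport hx
  have h0' : ∀ x ∉ {x : (E.comp F).Edge | x.1.1 ∈ A ∧ x.1.2 ∈ B}, φ x = 0 :=
    fun x hx => h0 x fun h => hx (hs h)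
  let φ' : F.Edge → ℂ := fun q => ∑' x : (fun x : (E.comp F).Edge => x.1.2) ⁻¹' {q}, φ x
  have hφ' : ∀ x : (E.comp F).Edge, x.1.1 ∈ A → x.1.2 ∈ B → φ' x.1.2 = φ x := fun x hxA hxB =>
    tsum_fibre_eq (p := fun x : (E.comp F).Edge => x.1.2) hinj h0' ⟨hxA, hxB⟩
  have hφ'0 : ∀ q ∉ (fun x : (E.comp F).Edge => x.1.2) '' tsupport φ, φ' q = 0 := fun q hq =>
    tsum_fibre_eq_zero h0 hq
  have hφ's : tsupport φ' ⊆ (fun x : (E.comp F).Edge => x.1.2) '' tsupport φ := by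
    refine closure_minimal (fun q hq => ?_) (hc.isCompact.image hcont2).isClosed
    by_contra h
    exact hq (hφ'0 q h)
  have hφ'B : tsupport φ' ⊆ B := by
    refine hφ's.trans ?_
    rintro _ ⟨x, hx, rfl⟩
    exact (hs hx).2
  have hφ'c : HasCompactSupport φ' :=
    (hc.isCompact.image hcont2).of_isClosed_subset isClosed_closure hφ's
  let η : F.Cd := ofInjOn (φ := φ') (continuous_tsum_fibre (compEdge_isLocalHomeomorph_snd E F)
    φ.continuous hc hO hinj hs) hφ'c hB hBi hφ'B
  obtain ⟨ξ, hξ1, hξ0, -⟩ := exists_bump (E := E) (hc.isCompact.image hcont1) hA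
    (by rintro _ ⟨x, hx, rfl⟩; exact (hs hx).1) hAi
  refine ⟨ξ ⊗ₜ η, ?_⟩
  rw [TensorProduct.lift.tmul]
  ext x
  rw [tensor_apply]
  change ξ x.1.1 * φ' x.1.2 = φ x
  by_cases hx : x ∈ tsupport φ
  · rw [hξ1 _ ⟨x, hx, rfl⟩, one_mul, hφ' x (hs hx).1 (hs hx).2]
  · rw [h0 x hx]
    by_cases hxA : x.1.1 ∈ A
    · by_cases hxB : x.1.2 ∈ B
      · rw [hφ' x hxA hxB, h0 x hx, mul_zero]
      · rw [hφ'0 x.1.2 fun h => hxB (hφ'B.trans subset_rfl (by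
          obtain ⟨y, hy, hyx⟩ := h
          exact absurd (hyx ▸ (hs hy).2) hxB)), mul_zero]
    · rw [hξ0 _ hxA, zero_mul]

end Cd
end TopGraph

/-! ### The inner product of `C_d` -/

namespace TopGraph
namespace Cd

variable {V : Type u} [TopologicalSpace V] {E F : TopGraph V}

theorem inner_add_left (ξ ξ' η : E.Cd) : inner (ξ + ξ') η = inner ξ η + inner ξ' η := by
  ext v
  simp [inner_apply_eq]

theorem inner_add_right (ξ η η' : E.Cd) : inner ξ (η + η') = inner ξ η + inner ξ η' := by
  ext v
  simp [inner_apply_eq]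

theorem inner_sub_left (ξ ξ' η : E.Cd) : inner (ξ - ξ') η = inner ξ η - inner ξ' η := by
  ext v
  simp [inner_apply_eq]

theorem inner_sub_right (ξ η η' : E.Cd) : inner ξ (η - η') = inner ξ η - inner ξ η' := by
  ext v
  simp [inner_apply_eq]

theorem inner_smul_left (c : ℂ) (ξ η : E.Cd) : inner (c • ξ) η = star c • inner ξ η := by
  ext v
  simp [inner_apply_eq, mul_comm]

theorem inner_smul_right (c : ℂ) (ξ η : E.Cd) : inner ξ (c • η) = c • inner ξ η := by
  ext v
  simp [inner_apply_eq]

theorem inner_zero_left (η : E.Cd) : inner (0 : E.Cd) η = 0 := by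
  ext v
  simp [inner_apply_eq]

theorem inner_zero_right (η : E.Cd) : inner η (0 : E.Cd) = 0 := by
  ext v
  simp [inner_apply_eq]

theorem star_inner (ξ η : E.Cd) : star (inner ξ η) = inner η ξ := by
  ext v
  rw [ZeroAtInftyContinuousMap.star_apply, inner_apply_eq, inner_apply_eq]
  exact inner_conj_symm _ _

theorem norm_inner_le (ξ η : E.Cd) : ‖inner ξ η‖ ≤ ‖ξ‖ * ‖η‖ :=
  ZeroAtInftyContinuousMap.norm_le_of_forall_le (by positivity) (norm_inner_apply_le ξ η)

theorem norm_inner_self (ξ : E.Cd) : ‖inner ξ ξ‖ = ‖ξ‖ ^ 2 := by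
  refine le_antisymm ((norm_inner_le ξ ξ).trans_eq (sq _).symm) ?_
  refine (Real.le_sqrt (norm_nonneg _) (norm_nonneg _)).1
    (norm_le_of_res (Real.sqrt_nonneg _) fun v => ?_)
  refine Real.le_sqrt_of_sq_le ?_
  have := (inner ξ ξ).norm_apply_le_norm v
  rwa [inner_apply_eq, inner_self_eq_norm_sq_to_K, norm_pow, RCLike.norm_ofReal,
    abs_of_nonneg (norm_nonneg _)] at this

theorem inner_rightAct_left (f : C₀(V, ℂ)) (ξ η : E.Cd) :
    inner (rightAct f ξ) η = star f * inner ξ η := by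
  ext v
  rw [ZeroAtInftyContinuousMap.mul_apply, inner_apply, inner_apply, ← tsum_mul_left]
  refine tsum_congr fun e => ?_
  have he : E.d e = v := e.2
  rw [rightAct_apply, he, star_mul, mul_assoc, mul_left_comm]
  rfl

theorem inner_rightAct_right (f : C₀(V, ℂ)) (ξ η : E.Cd) :
    inner ξ (rightAct f η) = inner ξ η * f := by
  ext v
  rw [ZeroAtInftyContinuousMap.mul_apply, inner_apply, inner_apply, ← tsum_mul_right]
  refine tsum_congr fun e => ?_
  have he : E.d e = v := e.2
  rw [rightAct_apply, he, mul_left_comm, mul_comm]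

theorem inner_tensor [T2Space V] (ξ ξ' : E.Cd) (η η' : F.Cd) :
    inner (tensor ξ η) (tensor ξ' η') = inner η (leftAct (inner ξ ξ') η') := by
  ext v
  have hs : Summable fun x : (E.comp F).d ⁻¹' {v} =>
      star (tensor ξ η x.1) * tensor ξ' η' x.1 :=
    Summable.of_norm_bounded (((tensor ξ η).fibreSummable.summable v).add
      ((tensor ξ' η').fibreSummable.summable v)) fun x => norm_star_mul_le _ _ x.1
  have h1 := ((compFibreEquiv E F v).summable_iff.2 hs).tsum_sigma
  rw [Function.comp_def] at h1
  rw [inner_apply, ← (compFibreEquiv E F v).tsum_eq, h1, inner_apply]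
  refine tsum_congr fun p => ?_
  rw [leftAct_apply, inner_apply, ← tsum_mul_right, ← tsum_mul_left]
  refine tsum_congr fun e => ?_
  change star (ξ e.1 * η p.1) * (ξ' e.1 * η' p.1) = _
  rw [star_mul]
  ring

theorem leftAct_tensor [T2Space V] (f : C₀(V, ℂ)) (ξ : E.Cd) (η : F.Cd) :
    leftAct f (tensor ξ η) = tensor (leftAct f ξ) η := by
  ext x
  exact (mul_assoc _ _ _).symm

/-- A closed subspace contains the values of a continuous linear map on `C_d` of a composed graph
if it contains the values on elementary tensors. -/
theorem map_mem_of_tensor [T2Space V] {G : Type*} [NormedAddCommGroup G] [NormedSpace ℂ G]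
    (f : (E.comp F).Cd →L[ℂ] G) {W : Submodule ℂ G} (hW : IsClosed (W : Set G))
    (h : ∀ (ξ : E.Cd) (η : F.Cd), f (tensor ξ η) ∈ W) (ζ : (E.comp F).Cd) : f ζ ∈ W := by
  refine (dense_range_tensor (E := E) (F := F)).induction (P := fun ζ => f ζ ∈ W) ?_
    (hW.preimage f.continuous) ζ
  rintro _ ⟨x, rfl⟩
  induction x using TensorProduct.induction_on with
  | zero => simp
  | tmul ξ η => exact h ξ η
  | add x y hx hy =>
    rw [map_add, map_add]
    exact W.add_mem hx hy

theorem map_eq_of_tensor [T2Space V] {G : Type*} [NormedAddCommGroup G] [NormedSpace ℂ G]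
    (f g : (E.comp F).Cd →L[ℂ] G)
    (h : ∀ (ξ : E.Cd) (η : F.Cd), f (tensor ξ η) = g (tensor ξ η)) (ζ : (E.comp F).Cd) :
    f ζ = g ζ := by
  have := map_mem_of_tensor (f - g) (W := ⊥) (by simp) (fun ξ η => by simp [h]) ζ
  simpa [sub_eq_zero] using this

theorem inner_idGraph [T2Space V] [LocallyCompactSpace V] (ξ η : (idGraph V).Cd) :
    inner ξ η = star (cdZero ξ) * cdZero η := by
  ext v
  exact tsum_singleton (β := V) v (fun e : V => star (ξ e) * η e)

end Cd

/-- `C₀(E⁰)` is `C_{d⁰}(E⁰)`. -/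
theorem cdZero_surjective {V : Type u} [TopologicalSpace V] [T2Space V] [LocallyCompactSpace V]
    (f : C₀(V, ℂ)) : ∃ ξ : (idGraph V).Cd, cdZero ξ = f := by
  have h1 : ∀ v, ∑' e : (idGraph V).d ⁻¹' {v}, ‖f e.1‖ ^ 2 = ‖f v‖ ^ 2 := fun v =>
    tsum_singleton (β := V) v (fun e : V => ‖f e‖ ^ 2)
  refine ⟨Cd.mk (E := idGraph V) f (map_continuous f) ⟨fun v => ?_, ?_, ?_⟩, rfl⟩
  · exact summable_fibre (p := (id : V → V)) (O := Set.univ) (φ := fun e => ‖f e‖ ^ 2)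
      Function.injective_id.injOn (by simp) v
  · simp only [h1]
    exact (map_continuous f).norm.pow 2
  · simp only [h1]
    simpa using (tendsto_zero_iff_norm_tendsto_zero.1 (zero_at_infty f)).pow 2

end TopGraph

open TopGraph

namespace ToeplitzPair

variable {V : Type u} [TopologicalSpace V] {E F : TopGraph V}
  {A : Type*} [NonUnitalCStarAlgebra A] {B : Type*} [NonUnitalCStarAlgebra B]

/-! ### Relations in Toeplitz pairs -/

theorem T1_rightAct (T : ToeplitzPair E A) (f : C₀(V, ℂ)) (ξ : E.Cd) :
    T.T1 (Cd.rightAct f ξ) = T.T1 ξ * T.T0 f := by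
  rw [← sub_eq_zero, ← CStarRing.star_mul_self_eq_zero_iff]
  simp only [star_sub, star_mul, sub_mul, mul_sub, T.star_mul_T1, Cd.inner_rightAct_left,
    Cd.inner_rightAct_right, map_mul, map_star]
  have h : ∀ η, star (T.T1 η) * (T.T1 ξ * T.T0 f) = T.T0 (Cd.inner η ξ) * T.T0 f := fun η => by
    rw [← mul_assoc, T.star_mul_T1]
  have h' : star (T.T0 f) * star (T.T1 ξ) * (T.T1 ξ * T.T0 f) =
      star (T.T0 f) * (T.T0 (Cd.inner ξ ξ) * T.T0 f) := by
    rw [mul_assoc, h]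
  have h'' : star (T.T0 f) * star (T.T1 ξ) * T.T1 (Cd.rightAct f ξ) =
      star (T.T0 f) * (T.T0 (Cd.inner ξ ξ) * T.T0 f) := by
    rw [mul_assoc, T.star_mul_T1, Cd.inner_rightAct_right, map_mul]
  rw [h, h', h'', Cd.inner_rightAct_left, map_mul, map_star]
  simp [mul_assoc]

theorem star_T1_mul_T0 (T : ToeplitzPair E A) (f : C₀(V, ℂ)) (ξ : E.Cd) :
    star (T.T1 ξ) * T.T0 f = star (T.T1 (Cd.leftAct (star f) ξ)) := by
  rw [← T.T0_mul_T1, star_mul, map_star, star_star]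

theorem T1_theta (T : ToeplitzPair E A) (ξ η ζ : E.Cd) :
    T.T1 (Cd.theta ξ η ζ) = T.T1 ξ * star (T.T1 η) * T.T1 ζ := by
  rw [Cd.theta_apply, T.T1_rightAct, mul_assoc, T.star_mul_T1]

theorem continuous_T1 (T : ToeplitzPair E A) : Continuous T.T1 :=
  AddMonoidHomClass.continuous_of_bound T.T1 1 fun ξ => by simpa using T.norm_T1_le ξ

theorem norm_T0_of_injective (T : ToeplitzPair E A) (hT : Function.Injective T.T0)
    (f : C₀(V, ℂ)) : ‖T.T0 f‖ = ‖f‖ :=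
  NonUnitalStarAlgHom.norm_map T.T0 hT f

theorem norm_T1_of_injective (T : ToeplitzPair E A) (hT : Function.Injective T.T0)
    (ξ : E.Cd) : ‖T.T1 ξ‖ = ‖ξ‖ := by
  have h := CStarRing.norm_star_mul_self (x := T.T1 ξ)
  rw [T.star_mul_T1, T.norm_T0_of_injective hT, Cd.norm_inner_self, ← pow_two] at h
  exact ((pow_left_inj₀ (norm_nonneg _) (norm_nonneg _) two_ne_zero).1 h.symm)

/-! ### The map `Φ¹` on compact operators -/

/-- The finite sums `∑ cᵢ T¹(ξᵢ) T¹(ηᵢ)⋆`. -/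
def rankOneSum (T : ToeplitzPair E A) : (E.Cd × E.Cd →₀ ℂ) →ₗ[ℂ] A :=
  Finsupp.linearCombination ℂ fun p : E.Cd × E.Cd => T.T1 p.1 * star (T.T1 p.2)

/-- The finite sums `∑ cᵢ θ_{ξᵢ,ηᵢ}`. -/
def _root_.TopGraph.Cd.thetaSum (E : TopGraph V) : (E.Cd × E.Cd →₀ ℂ) →ₗ[ℂ] (E.Cd →L[ℂ] E.Cd) :=
  Finsupp.linearCombination ℂ fun p : E.Cd × E.Cd => Cd.theta p.1 p.2

theorem rankOneSum_mul_T1 (T : ToeplitzPair E A) (c : E.Cd × E.Cd →₀ ℂ) (ζ : E.Cd) :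
    T.rankOneSum c * T.T1 ζ = T.T1 (Cd.thetaSum E c ζ) := by
  induction c using Finsupp.induction_linear with
  | zero => simp
  | add c d hc hd => simp [add_mul, hc, hd]
  | single p a => simp [rankOneSum, Cd.thetaSum, T.T1_theta, smul_mul_assoc]

/-- The adjoint of a sum of rank one operators, together with the corresponding element of `A`. -/
theorem exists_star_rankOneSum (T : ToeplitzPair E A) (c : E.Cd × E.Cd →₀ ℂ) :
    ∃ d, star (T.rankOneSum c) = T.rankOneSum d ∧
      ∀ ζ ζ', Cd.inner (Cd.thetaSum E c ζ) ζ' = Cd.inner ζ (Cd.thetaSum E d ζ') := by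
  induction c using Finsupp.induction_linear with
  | zero => exact ⟨0, by simp, by simp [Cd.inner_zero_left, Cd.inner_zero_right]⟩
  | add c c' hc hc' =>
    obtain ⟨d, h1, h2⟩ := hc
    obtain ⟨d', h1', h2'⟩ := hc'
    refine ⟨d + d', by simp [h1, h1'], fun ζ ζ' => ?_⟩
    simp [Cd.inner_add_left, Cd.inner_add_right, h2, h2']
  | single p a =>
    refine ⟨Finsupp.single (p.2, p.1) (star a), by simp [rankOneSum], fun ζ ζ' => ?_⟩
    simp only [Cd.thetaSum, Finsupp.linearCombination_single, _root_.smul_apply,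
      Cd.theta_apply, Cd.inner_smul_left, Cd.inner_smul_right, Cd.inner_rightAct_left,
      Cd.inner_rightAct_right, Cd.star_inner]

theorem norm_thetaSum_le_of_adjoint {c d : E.Cd × E.Cd →₀ ℂ}
    (h : ∀ ζ ζ', Cd.inner (Cd.thetaSum E c ζ) ζ' = Cd.inner ζ (Cd.thetaSum E d ζ')) :
    ‖Cd.thetaSum E d‖ ≤ ‖Cd.thetaSum E c‖ := by
  refine ContinuousLinearMap.opNorm_le_bound _ (norm_nonneg _) fun ζ => ?_
  set ω := Cd.thetaSum E d ζ with hω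
  have h1 : ‖ω‖ ^ 2 ≤ ‖Cd.thetaSum E c‖ * ‖ω‖ * ‖ζ‖ := by
    rw [← Cd.norm_inner_self]
    conv_lhs => rw [hω, ← h]
    refine (Cd.norm_inner_le _ _).trans ?_
    gcongr
    exact ContinuousLinearMap.le_opNorm _ _
  rcases (norm_nonneg ω).eq_or_lt with h0 | h0
  · rw [← h0]
    positivity
  · refine le_of_mul_le_mul_left (a := ‖ω‖) ?_ h0
    linarith

/-- A bound for `w T¹(ζ)` gives a bound for `w ∑ cᵢ T¹(ξᵢ) T¹(ηᵢ)⋆`, with a constant `C` which does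
not depend on `w`. It is applied to the powers `w` of one element. -/
theorem exists_norm_mul_rankOneSum_le (T : ToeplitzPair E A) (c : E.Cd × E.Cd →₀ ℂ) :
    ∃ C, 0 ≤ C ∧ ∀ (w : A) (D : ℝ), 0 ≤ D → (∀ ζ, ‖w * T.T1 ζ‖ ≤ D * ‖ζ‖) →
      ‖w * T.rankOneSum c‖ ≤ C * D := by
  induction c using Finsupp.induction_linear with
  | zero => exact ⟨0, le_rfl, by simp⟩
  | add c d hc hd =>
    obtain ⟨C, hC, h⟩ := hc
    obtain ⟨C', hC', h'⟩ := hd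
    refine ⟨C + C', by positivity, fun w D hD hw => ?_⟩
    rw [map_add, mul_add, add_mul]
    exact (norm_add_le _ _).trans (add_le_add (h w D hD hw) (h' w D hD hw))
  | single p a =>
    refine ⟨‖a‖ * (‖p.1‖ * ‖p.2‖), by positivity, fun w D hD hw => ?_⟩
    rw [rankOneSum, Finsupp.linearCombination_single, mul_smul_comm, ← mul_assoc, norm_smul,
      mul_assoc ‖a‖]
    gcongr
    refine (norm_mul_le _ _).trans ?_
    rw [norm_star]
    calc ‖w * T.T1 p.1‖ * ‖T.T1 p.2‖ ≤ (D * ‖p.1‖) * ‖p.2‖ := by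
          gcongr
          · exact hw _
          · exact T.norm_T1_le _
      _ = _ := by ring

/-- The operator norm bounds `∑ cᵢ T¹(ξᵢ) T¹(ηᵢ)⋆`. For `x = b b⋆` the powers of `x` grow at most
like those of the corresponding operator, because `b T¹(ζ) = T¹(κ ζ)`. -/
theorem norm_rankOneSum_le (T : ToeplitzPair E A) (c : E.Cd × E.Cd →₀ ℂ) :
    ‖T.rankOneSum c‖ ≤ ‖Cd.thetaSum E c‖ := by
  obtain ⟨d, hd, hadj⟩ := T.exists_star_rankOneSum c
  obtain ⟨C, hC, hCb⟩ := T.exists_norm_mul_rankOneSum_le c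
  set b := T.rankOneSum c
  set κ := Cd.thetaSum E c
  have hstar : ∀ ζ, ‖Cd.thetaSum E d ζ‖ ≤ ‖κ‖ * ‖ζ‖ := fun ζ =>
    ((Cd.thetaSum E d).le_opNorm ζ).trans (by gcongr; exact norm_thetaSum_le_of_adjoint hadj)
  set x := b * star b with hx
  have hxsa : IsSelfAdjoint x := IsSelfAdjoint.mul_star_self b
  have hxT : ∀ ζ, x * T.T1 ζ = T.T1 (κ (Cd.thetaSum E d ζ)) := fun ζ => by
    rw [hx, hd, mul_assoc, T.rankOneSum_mul_T1, T.rankOneSum_mul_T1]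
  have hpow : ∀ N ζ, ‖succPow x N * T.T1 ζ‖ ≤ (‖κ‖ ^ 2) ^ (N + 1) * ‖ζ‖ := by
    intro N
    suffices h : ∀ ζ, ∃ ω, succPow x N * T.T1 ζ = T.T1 ω ∧ ‖ω‖ ≤ (‖κ‖ ^ 2) ^ (N + 1) * ‖ζ‖ by
      intro ζ
      obtain ⟨ω, h1, h2⟩ := h ζ
      rw [h1]
      exact (T.norm_T1_le ω).trans h2
    have hone : ∀ ζ, ‖κ (Cd.thetaSum E d ζ)‖ ≤ ‖κ‖ ^ 2 * ‖ζ‖ := fun ζ => by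
      refine (κ.le_opNorm _).trans ?_
      rw [sq, mul_assoc]
      gcongr
      exact hstar ζ
    induction N with
    | zero => exact fun ζ => ⟨_, hxT ζ, by simpa using hone ζ⟩
    | succ N ih =>
      intro ζ
      obtain ⟨ω, h1, h2⟩ := ih ζ
      refine ⟨_, by rw [succPow, mul_assoc, h1, hxT], (hone ω).trans ?_⟩
      rw [pow_succ' _ (N + 1), mul_assoc]
      gcongr
  have hmain : ‖x‖ ≤ ‖κ‖ ^ 2 := by
    refine norm_le_of_norm_succPow_le hxsa (C := C * ‖κ‖ ^ 2 * ‖b‖) (by positivity) 1 fun N => ?_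
    rw [← succPow_mul_succPow x N 0, succPow, hx, ← mul_assoc, ← hx]
    refine (norm_mul_le _ _).trans ?_
    rw [norm_star]
    refine (mul_le_mul_of_nonneg_right (hCb _ _ (by positivity) (hpow N))
      (norm_nonneg b)).trans_eq ?_
    ring
  rw [hx, CStarRing.norm_self_mul_star, ← sq] at hmain
  exact (pow_le_pow_iff_left₀ (norm_nonneg _) (norm_nonneg _) two_ne_zero).1 hmain

theorem denseRange_theta :
    DenseRange (Finsupp.linearCombination ℂ fun p : E.Cd × E.Cd =>
      (⟨Cd.theta p.1 p.2, Cd.theta_mem_compact p.1 p.2⟩ : Cd.compact E)) := by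
  rw [DenseRange, Subtype.dense_iff]
  intro x hx
  have hx' : x ∈ closure (Submodule.span ℂ (Set.range fun p : E.Cd × E.Cd => Cd.theta p.1 p.2) :
      Set (E.Cd →L[ℂ] E.Cd)) := hx
  refine closure_mono ?_ hx'
  intro y hy
  obtain ⟨c, rfl⟩ := (Finsupp.mem_span_range_iff_exists_finsupp).1 hy
  refine ⟨_, ⟨c, rfl⟩, ?_⟩
  simp [Finsupp.linearCombination_apply, Finsupp.sum]

theorem thetaSum_eq (c : E.Cd × E.Cd →₀ ℂ) :
    ((Finsupp.linearCombination ℂ fun p : E.Cd × E.Cd =>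
      (⟨Cd.theta p.1 p.2, Cd.theta_mem_compact p.1 p.2⟩ : Cd.compact E)) c : E.Cd →L[ℂ] E.Cd) =
      Cd.thetaSum E c := by
  simp [Cd.thetaSum, Finsupp.linearCombination_apply, Finsupp.sum]

theorem Phi_theta (T : ToeplitzPair E A) (ξ η : E.Cd) :
    T.Phi ⟨Cd.theta ξ η, Cd.theta_mem_compact ξ η⟩ = T.T1 ξ * star (T.T1 η) := by
  have h := LinearMap.extendOfNorm_eq
    (f := Finsupp.linearCombination ℂ fun p : E.Cd × E.Cd => T.T1 p.1 * star (T.T1 p.2))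
    (denseRange_theta (E := E)) ⟨1, fun c => ?_⟩ (Finsupp.single (ξ, η) 1)
  · rw [Finsupp.linearCombination_single, Finsupp.linearCombination_single, one_smul, one_smul] at h
    exact h
  · have h2 := T.norm_rankOneSum_le c
    rw [← thetaSum_eq] at h2
    rw [one_mul]
    exact h2

/-- A closed subspace contains the values of `Φ¹` if it contains the products `T¹(ξ) T¹(η)⋆`. -/
theorem map_mem_of_theta {G : Type*} [NormedAddCommGroup G] [NormedSpace ℂ G]
    (f : Cd.compact E →L[ℂ] G) {W : Submodule ℂ G} (hW : IsClosed (W : Set G))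
    (h : ∀ ξ η : E.Cd, f ⟨Cd.theta ξ η, Cd.theta_mem_compact ξ η⟩ ∈ W) (k : Cd.compact E) :
    f k ∈ W := by
  refine (denseRange_theta (E := E)).induction_on (p := fun k => f k ∈ W) k
    (hW.preimage f.continuous) fun c => ?_
  induction c using Finsupp.induction_linear with
  | zero => simp
  | add c d hc hd =>
    rw [map_add, map_add]
    exact W.add_mem hc hd
  | single p a =>
    rw [Finsupp.linearCombination_single, map_smul]
    exact W.smul_mem a (h _ _)

/-- A `*`-homomorphism of C⋆-algebras as a continuous linear map. -/
def _root_.NonUnitalStarAlgHom.toContinuousLinear (ψ : A →⋆ₙₐ[ℂ] B) : A →L[ℂ] B :=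
  LinearMap.mkContinuous (ψ : A →ₗ[ℂ] B) 1 fun a => by
    simpa using NonUnitalStarAlgHom.norm_apply_le ψ a

theorem map_Phi {T : ToeplitzPair E A} {S : ToeplitzPair E B} (ψ : A →⋆ₙₐ[ℂ] B)
    (h1 : ∀ ξ, ψ (T.T1 ξ) = S.T1 ξ) (k : Cd.compact E) : ψ (T.Phi k) = S.Phi k := by
  have h := map_mem_of_theta (ψ.toContinuousLinear ∘L T.Phi - S.Phi) (W := ⊥) (by simp)
    (fun ξ η => ?_) k
  · exact sub_eq_zero.1 h
  · change ψ (T.Phi _) - S.Phi _ = 0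
    rw [T.Phi_theta, S.Phi_theta, map_mul, map_star, h1, h1, sub_self]

/-! ### The maps `Tⁿ` -/

/-- The relation `T¹(ξ)⋆ T¹(η) = T⁰(⟨ξ, η⟩)` for sums of elementary tensors. It shows that
`ξ ⊗ η ↦ T¹(ξ) S¹(η)` is contractive for the norm of `C_d` of the composed graph. -/
theorem lift_tensor_relation [T2Space V] (T : ToeplitzPair E A) (S : ToeplitzPair F A)
    (h0 : S.T0 = T.T0) (x y : E.Cd ⊗[ℂ] F.Cd) :
    star (TensorProduct.lift ((LinearMap.mul ℂ A).compl₁₂ T.T1 S.T1) x) *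
        TensorProduct.lift ((LinearMap.mul ℂ A).compl₁₂ T.T1 S.T1) y =
      T.T0 (Cd.inner (TensorProduct.lift (tensor (E := E) (F := F)) x)
        (TensorProduct.lift (tensor (E := E) (F := F)) y)) := by
  induction x using TensorProduct.induction_on with
  | zero => simp [Cd.inner_zero_left]
  | add x x' hx hx' => simp [add_mul, hx, hx', Cd.inner_add_left]
  | tmul ξ η =>
    induction y using TensorProduct.induction_on with
    | zero => simp [Cd.inner_zero_right]
    | add y y' hy hy' => simp only [map_add, mul_add, hy, hy', Cd.inner_add_right]
    | tmul ξ' η' =>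
      simp only [TensorProduct.lift.tmul, LinearMap.compl₁₂_apply, LinearMap.mul_apply', star_mul]
      rw [mul_assoc, ← mul_assoc _ (T.T1 ξ'), T.star_mul_T1, ← h0, S.T0_mul_T1, S.star_mul_T1,
        Cd.inner_tensor]

theorem step_tensor [T2Space V] (T : ToeplitzPair E A) (S : ToeplitzPair F A)
    (h0 : S.T0 = T.T0) (ξ : E.Cd) (η : F.Cd) :
    T.step S.T1 (tensor ξ η) = T.T1 ξ * S.T1 η := by
  have h := LinearMap.extendOfNorm_eq
    (f := TensorProduct.lift ((LinearMap.mul ℂ A).compl₁₂ T.T1 S.T1))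
    (e := TensorProduct.lift (tensor (E := E) (F := F)))
    Cd.dense_range_tensor ⟨1, fun x => ?_⟩ (ξ ⊗ₜ η)
  · rw [TensorProduct.lift.tmul, TensorProduct.lift.tmul] at h
    exact h
  · rw [one_mul, ← pow_le_pow_iff_left₀ (norm_nonneg _) (norm_nonneg _) two_ne_zero, sq,
      ← CStarRing.norm_star_mul_self, T.lift_tensor_relation S h0, ← Cd.norm_inner_self]
    exact T.norm_T0_le _

theorem _root_.TopGraph.Cd.continuous_inner_left (η : E.Cd) :
    Continuous fun ξ : E.Cd => Cd.inner ξ η := by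
  refine (LipschitzWith.of_dist_le_mul (K := ⟨‖η‖, norm_nonneg η⟩) fun ξ ξ' => ?_).continuous
  rw [dist_eq_norm, dist_eq_norm, ← Cd.inner_sub_left, mul_comm]
  exact Cd.norm_inner_le _ _

theorem _root_.TopGraph.Cd.continuous_inner_right (η : E.Cd) :
    Continuous fun ξ : E.Cd => Cd.inner η ξ := by
  refine (LipschitzWith.of_dist_le_mul (K := ⟨‖η‖, norm_nonneg η⟩) fun ξ ξ' => ?_).continuous
  rw [dist_eq_norm, dist_eq_norm, ← Cd.inner_sub_right]
  exact Cd.norm_inner_le _ _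

theorem continuous_T0 (T : ToeplitzPair E A) : Continuous T.T0 :=
  AddMonoidHomClass.continuous_of_bound T.T0 1 fun f => by simpa using T.norm_T0_le f

/-- The Toeplitz pair of a composed graph. -/
def compPair [T2Space V] (T : ToeplitzPair E A) (S : ToeplitzPair F A) (h0 : S.T0 = T.T0) :
    ToeplitzPair (E.comp F) A where
  T0 := T.T0
  T1 := (T.step S.T1).toLinearMap
  star_mul_T1 ζ ζ' := by
    have hstar : Continuous fun a : A => star a := continuous_star
    refine Cd.dense_range_tensor.induction (P := fun ζ => star (T.step S.T1 ζ) * T.step S.T1 ζ' =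
      T.T0 (Cd.inner ζ ζ')) ?_ (isClosed_eq ((hstar.comp (T.step S.T1).continuous).mul
        continuous_const) (T.continuous_T0.comp (Cd.continuous_inner_left ζ'))) ζ
    rintro _ ⟨x, rfl⟩
    refine Cd.dense_range_tensor.induction (P := fun ζ' => star (T.step S.T1 _) * T.step S.T1 ζ' =
      T.T0 (Cd.inner _ ζ')) ?_ (isClosed_eq (continuous_const.mul (T.step S.T1).continuous)
        (T.continuous_T0.comp (Cd.continuous_inner_right _))) ζ'
    rintro _ ⟨y, rfl⟩
    have h : ∀ z, T.step S.T1 (TensorProduct.lift (tensor (E := E) (F := F)) z) =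
        TensorProduct.lift ((LinearMap.mul ℂ A).compl₁₂ T.T1 S.T1) z := fun z => by
      induction z using TensorProduct.induction_on with
      | zero => simp
      | add x y hx hy => rw [map_add, map_add, hx, hy, map_add]
      | tmul ξ η => simp [T.step_tensor S h0]
    rw [h, h, T.lift_tensor_relation S h0]
  T0_mul_T1 f ζ :=
    Cd.map_eq_of_tensor (ContinuousLinearMap.mul ℂ A (T.T0 f) ∘L T.step S.T1)
      (T.step S.T1 ∘L Cd.leftAct f) (fun ξ η => by
        simp only [ContinuousLinearMap.comp_apply, ContinuousLinearMap.mul_apply',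
          Cd.leftAct_tensor, T.step_tensor S h0]
        rw [← mul_assoc, T.T0_mul_T1]) ζ

section Path

variable [T2Space V] [LocallyCompactSpace V]

/-- The Toeplitz pair `(T⁰, T⁰)` of the graph of paths of length zero. -/
def idPair (T : ToeplitzPair E A) : ToeplitzPair (idGraph V) A where
  T0 := T.T0
  T1 := (T.T0 : C₀(V, ℂ) →ₗ[ℂ] A) ∘ₗ cdZero
  star_mul_T1 ξ η := by
    rw [Cd.inner_idGraph, map_mul, map_star]
    rfl
  T0_mul_T1 f ξ := (map_mul T.T0 f (cdZero ξ)).symm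

/-- The pair `(T⁰, Tⁿ)` is a Toeplitz pair of the graph of paths of length `n`. -/
theorem exists_pathPair (T : ToeplitzPair E A) (n : ℕ) :
    ∃ S : ToeplitzPair (E.path n) A, S.T0 = T.T0 ∧ S.T1 = T.pathMap n := by
  induction n with
  | zero => exact ⟨T.idPair, rfl, rfl⟩
  | succ n ih =>
    obtain ⟨S, h0, h1⟩ := ih
    exact ⟨T.compPair S h0, rfl, by rw [pathMap, ← h1]; rfl⟩

theorem pathMap_tensor (T : ToeplitzPair E A) (n : ℕ) (ξ : E.Cd) (η : (E.path n).Cd) :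
    T.pathMap (n + 1) (tensor ξ η : (E.comp (E.path n)).Cd) = T.T1 ξ * T.pathMap n η := by
  obtain ⟨S, h0, h1⟩ := T.exists_pathPair n
  rw [← h1, ← T.step_tensor S h0, h1]
  rfl

/-- `Tⁿ` as a continuous linear map. -/
def pathCLM (T : ToeplitzPair E A) (n : ℕ) : (E.path n).Cd →L[ℂ] A :=
  LinearMap.mkContinuous (T.pathMap n) 1 fun ξ => by
    obtain ⟨S, -, h1⟩ := T.exists_pathPair n
    rw [← h1, one_mul]
    exact S.norm_T1_le ξ

theorem T0_mul_pathMap (T : ToeplitzPair E A) (n : ℕ) (f : C₀(V, ℂ)) (ξ : (E.path n).Cd) :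
    T.T0 f * T.pathMap n ξ = T.pathMap n (Cd.leftAct f ξ) := by
  obtain ⟨S, h0, h1⟩ := T.exists_pathPair n
  rw [← h1, ← h0, S.T0_mul_T1]

theorem map_pathMap {T : ToeplitzPair E A} {S : ToeplitzPair E B} (ψ : A →⋆ₙₐ[ℂ] B)
    (h0 : ∀ f, ψ (T.T0 f) = S.T0 f) (h1 : ∀ ξ, ψ (T.T1 ξ) = S.T1 ξ) (n : ℕ)
    (ζ : (E.path n).Cd) : ψ (T.pathMap n ζ) = S.pathMap n ζ := by
  induction n with
  | zero => exact h0 _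
  | succ n ih =>
    refine Cd.map_eq_of_tensor (F := E.path n) (ψ.toContinuousLinear ∘L T.pathCLM (n + 1))
      (S.pathCLM (n + 1)) (fun ξ η => ?_) ζ
    change ψ (T.pathMap (n + 1) _) = S.pathMap (n + 1) _
    rw [pathMap_tensor, pathMap_tensor, map_mul, h1, ih]

/-- If `ψ` multiplies `T¹` by `z`, then it multiplies `Tⁿ` by `zⁿ`. -/
theorem gauge_pathMap {T : ToeplitzPair E A} (ψ : A →⋆ₙₐ[ℂ] A) (z : ℂ)
    (h0 : ∀ f, ψ (T.T0 f) = T.T0 f) (h1 : ∀ ξ, ψ (T.T1 ξ) = z • T.T1 ξ) (n : ℕ)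
    (ζ : (E.path n).Cd) : ψ (T.pathMap n ζ) = z ^ n • T.pathMap n ζ := by
  induction n with
  | zero => rw [pow_zero, one_smul]; exact h0 _
  | succ n ih =>
    refine Cd.map_eq_of_tensor (F := E.path n) (ψ.toContinuousLinear ∘L T.pathCLM (n + 1))
      (z ^ (n + 1) • T.pathCLM (n + 1)) (fun ξ η => ?_) ζ
    change ψ (T.pathMap (n + 1) _) = z ^ (n + 1) • T.pathMap (n + 1) _
    rw [pathMap_tensor, map_mul, h1, ih, smul_mul_smul_comm, ← pow_succ']

end Path

end ToeplitzPair

namespace ToeplitzPair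

variable {V : Type u} [TopologicalSpace V] {E : TopGraph V}
  {A : Type*} [NonUnitalCStarAlgebra A] {B : Type*} [NonUnitalCStarAlgebra B]

/-! ### Sums of the form `T⁰(g) + ∑ T¹(ξ) a T¹(η)⋆` -/

/-- The linear span of the elements `T¹(ξ) a T¹(η)⋆` with `a ∈ W`. -/
def sandwich (T : ToeplitzPair E A) (W : Submodule ℂ A) : Submodule ℂ A :=
  Submodule.span ℂ {x | ∃ ξ η, ∃ a ∈ W, x = T.T1 ξ * a * star (T.T1 η)}

theorem mem_sandwich (T : ToeplitzPair E A) {W : Submodule ℂ A} (ξ η : E.Cd) {a : A}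
    (ha : a ∈ W) : T.T1 ξ * a * star (T.T1 η) ∈ T.sandwich W :=
  Submodule.subset_span ⟨ξ, η, a, ha, rfl⟩

theorem sandwich_mono (T : ToeplitzPair E A) {W W' : Submodule ℂ A} (h : W ≤ W') :
    T.sandwich W ≤ T.sandwich W' := by
  refine Submodule.span_mono ?_
  rintro _ ⟨ξ, η, a, ha, rfl⟩
  exact ⟨ξ, η, a, h ha, rfl⟩

theorem sandwich_induction (T : ToeplitzPair E A) {W : Submodule ℂ A} {p : A → Prop}
    (h : ∀ ξ η, ∀ a ∈ W, p (T.T1 ξ * a * star (T.T1 η))) (h0 : p 0)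
    (hadd : ∀ x y, p x → p y → p (x + y)) {y : A} (hy : y ∈ T.sandwich W) : p y := by
  induction hy using Submodule.span_induction with
  | mem x hx =>
    obtain ⟨ξ, η, a, ha, rfl⟩ := hx
    exact h ξ η a ha
  | zero => exact h0
  | add x y _ _ hx hy => exact hadd x y hx hy
  | smul c x hx ih =>
    -- Scalars are absorbed into the first factor.
    clear ih
    induction hx using Submodule.span_induction generalizing c with
    | mem x hx =>
      obtain ⟨ξ, η, a, ha, rfl⟩ := hx
      rw [← smul_mul_assoc, ← smul_mul_assoc, ← map_smul]
      exact h (c • ξ) η a ha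
    | zero => rwa [smul_zero]
    | add x y _ _ hx hy =>
      rw [smul_add]
      exact hadd _ _ (hx c) (hy c)
    | smul d x _ ih =>
      rw [smul_smul]
      exact ih (c * d)

theorem map_sandwich {T : ToeplitzPair E A} {S : ToeplitzPair E B} (ψ : A →⋆ₙₐ[ℂ] B)
    (h1 : ∀ ξ, ψ (T.T1 ξ) = S.T1 ξ) {W : Submodule ℂ A} {y : A} (hy : y ∈ T.sandwich W) :
    ψ y ∈ S.sandwich ⊤ := by
  refine T.sandwich_induction (p := fun y => ψ y ∈ S.sandwich ⊤) (fun ξ η a _ => ?_) ?_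
    (fun x y hx hy => ?_) hy
  · rw [map_mul, map_mul, map_star, h1, h1]
    exact S.mem_sandwich ξ η trivial
  · rw [map_zero]
    exact Submodule.zero_mem _
  · rw [map_add]
    exact Submodule.add_mem _ hx hy

theorem T1_mul_mul_star_T1_mul (T : ToeplitzPair E A) (ξ η ξ' η' : E.Cd) (a b : A) :
    T.T1 ξ * a * star (T.T1 η) * (T.T1 ξ' * b * star (T.T1 η')) =
      T.T1 ξ * (a * T.T0 (Cd.inner η ξ') * b) * star (T.T1 η') := by
  rw [← T.star_mul_T1]
  simp only [mul_assoc]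

/-- A self-adjoint algebra which contains the range of `T⁰`. -/
structure IsStarAlg (T : ToeplitzPair E A) (W : Submodule ℂ A) : Prop where
  T0_mem : ∀ f, T.T0 f ∈ W
  mul_mem : ∀ a ∈ W, ∀ b ∈ W, a * b ∈ W
  star_mem : ∀ a ∈ W, star a ∈ W

theorem star_mem_sandwich (T : ToeplitzPair E A) {W : Submodule ℂ A} (hW : T.IsStarAlg W) {y : A}
    (hy : y ∈ T.sandwich W) : star y ∈ T.sandwich W := by
  refine T.sandwich_induction (p := fun y => star y ∈ T.sandwich W) (fun ξ η a ha => ?_) ?_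
    (fun x y hx hy => ?_) hy
  · rw [star_mul, star_mul, star_star, ← mul_assoc]
    exact T.mem_sandwich η ξ (hW.star_mem a ha)
  · rw [star_zero]
    exact Submodule.zero_mem _
  · rw [star_add]
    exact Submodule.add_mem _ hx hy

theorem mul_mem_sandwich (T : ToeplitzPair E A) {W : Submodule ℂ A} (hW : T.IsStarAlg W) {x y : A}
    (hx : x ∈ T.sandwich W) (hy : y ∈ T.sandwich W) : x * y ∈ T.sandwich W := by
  refine T.sandwich_induction (p := fun x => x * y ∈ T.sandwich W) (fun ξ η a ha => ?_) ?_
    (fun x x' hx hx' => ?_) hx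
  · refine T.sandwich_induction (p := fun y => T.T1 ξ * a * star (T.T1 η) * y ∈ T.sandwich W)
      (fun ξ' η' b hb => ?_) ?_ (fun x y hx hy => ?_) hy
    · rw [T1_mul_mul_star_T1_mul]
      exact T.mem_sandwich _ _ (hW.mul_mem _ (hW.mul_mem _ ha _ (hW.T0_mem _)) _ hb)
    · rw [mul_zero]
      exact Submodule.zero_mem _
    · rw [mul_add]
      exact Submodule.add_mem _ hx hy
  · rw [zero_mul]
    exact Submodule.zero_mem _
  · rw [add_mul]
    exact Submodule.add_mem _ hx hx'

theorem T0_mul_mem_sandwich (T : ToeplitzPair E A) {W : Submodule ℂ A} (f : C₀(V, ℂ)) {y : A}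
    (hy : y ∈ T.sandwich W) : T.T0 f * y ∈ T.sandwich W := by
  refine T.sandwich_induction (p := fun y => T.T0 f * y ∈ T.sandwich W) (fun ξ η a ha => ?_) ?_
    (fun x y hx hy => ?_) hy
  · rw [← mul_assoc, ← mul_assoc, T.T0_mul_T1]
    exact T.mem_sandwich _ _ ha
  · rw [mul_zero]
    exact Submodule.zero_mem _
  · rw [mul_add]
    exact Submodule.add_mem _ hx hy

theorem mul_T0_mem_sandwich (T : ToeplitzPair E A) {W : Submodule ℂ A} (hW : T.IsStarAlg W)
    (f : C₀(V, ℂ)) {y : A} (hy : y ∈ T.sandwich W) : y * T.T0 f ∈ T.sandwich W := by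
  have h := T.star_mem_sandwich hW (T.T0_mul_mem_sandwich (star f) (T.star_mem_sandwich hW hy))
  rwa [star_mul, star_star, map_star, star_star] at h

theorem compression_mem (T : ToeplitzPair E A) {W : Submodule ℂ A} (hW : T.IsStarAlg W)
    (α β : E.Cd) {y : A} (hy : y ∈ T.sandwich W) : star (T.T1 α) * y * T.T1 β ∈ W := by
  refine T.sandwich_induction (p := fun y => star (T.T1 α) * y * T.T1 β ∈ W) (fun ξ η a ha => ?_) ?_
    (fun x y hx hy => ?_) hy
  · have : star (T.T1 α) * (T.T1 ξ * a * star (T.T1 η)) * T.T1 β =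
        T.T0 (Cd.inner α ξ) * a * T.T0 (Cd.inner η β) := by
      rw [← T.star_mul_T1, ← T.star_mul_T1]
      simp only [mul_assoc]
    rw [this]
    exact hW.mul_mem _ (hW.mul_mem _ (hW.T0_mem _) _ ha) _ (hW.T0_mem _)
  · rw [mul_zero, zero_mul]
    exact Submodule.zero_mem _
  · rw [mul_add, add_mul]
    exact Submodule.add_mem _ hx hy

/-- The algebra `F₀ = T⁰(C₀(E⁰))`, `Fₙ₊₁ = T⁰(C₀(E⁰)) + span {T¹(ξ) a T¹(η)⋆ | a ∈ Fₙ}`. The union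
of these algebras is dense in the closed span of the elements `Tᵏ(ξ) Tᵏ(η)⋆`. -/
def level (T : ToeplitzPair E A) : ℕ → Submodule ℂ A
  | 0 => LinearMap.range (T.T0 : C₀(V, ℂ) →ₗ[ℂ] A)
  | n + 1 => LinearMap.range (T.T0 : C₀(V, ℂ) →ₗ[ℂ] A) ⊔ T.sandwich (level T n)

theorem mem_level_succ (T : ToeplitzPair E A) {n : ℕ} {x : A} :
    x ∈ T.level (n + 1) ↔ ∃ g, ∃ y ∈ T.sandwich (T.level n), x = T.T0 g + y := by
  rw [level, Submodule.mem_sup]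
  constructor
  · rintro ⟨_, ⟨g, rfl⟩, y, hy, rfl⟩
    exact ⟨g, y, hy, rfl⟩
  · rintro ⟨g, y, hy, rfl⟩
    exact ⟨_, ⟨g, rfl⟩, y, hy, rfl⟩

theorem sandwich_le_level (T : ToeplitzPair E A) (n : ℕ) :
    T.sandwich (T.level n) ≤ T.level (n + 1) := le_sup_right

theorem isStarAlg_level (T : ToeplitzPair E A) (n : ℕ) : T.IsStarAlg (T.level n) := by
  induction n with
  | zero =>
    refine ⟨fun f => ⟨f, rfl⟩, ?_, ?_⟩
    · rintro _ ⟨f, rfl⟩ _ ⟨g, rfl⟩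
      exact ⟨f * g, map_mul T.T0 f g⟩
    · rintro _ ⟨f, rfl⟩
      exact ⟨star f, map_star T.T0 f⟩
  | succ n ih =>
    refine ⟨fun f => T.mem_level_succ.2 ⟨f, 0, Submodule.zero_mem _, (add_zero _).symm⟩, ?_, ?_⟩
    · intro a ha b hb
      obtain ⟨f, x, hx, rfl⟩ := T.mem_level_succ.1 ha
      obtain ⟨g, y, hy, rfl⟩ := T.mem_level_succ.1 hb
      refine T.mem_level_succ.2 ⟨f * g, T.T0 f * y + (x * T.T0 g + x * y),
        Submodule.add_mem _ (T.T0_mul_mem_sandwich f hy)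
          (Submodule.add_mem _ (T.mul_T0_mem_sandwich ih g hx) (T.mul_mem_sandwich ih hx hy)), ?_⟩
      rw [map_mul, add_mul, mul_add, mul_add, add_assoc]
    · intro a ha
      obtain ⟨f, x, hx, rfl⟩ := T.mem_level_succ.1 ha
      exact T.mem_level_succ.2 ⟨star f, star x, T.star_mem_sandwich ih hx, by
        rw [star_add, map_star]⟩

theorem level_mono (T : ToeplitzPair E A) : Monotone T.level := by
  refine monotone_nat_of_le_succ fun n => ?_
  induction n with
  | zero => exact le_sup_left
  | succ n ih => exact sup_le_sup_left (T.sandwich_mono ih) _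

theorem level_mul_mem_sandwich (T : ToeplitzPair E A) {n : ℕ} {x y : A}
    (hx : x ∈ T.level (n + 1)) (hy : y ∈ T.sandwich (T.level n)) :
    x * y ∈ T.sandwich (T.level n) := by
  obtain ⟨f, x', hx', rfl⟩ := T.mem_level_succ.1 hx
  rw [add_mul]
  exact Submodule.add_mem _ (T.T0_mul_mem_sandwich f hy)
    (T.mul_mem_sandwich (T.isStarAlg_level n) hx' hy)

theorem succPow_mem {W : Submodule ℂ A} (hW : ∀ a ∈ W, ∀ b ∈ W, a * b ∈ W) {x : A} (hx : x ∈ W)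
    (n : ℕ) : succPow x n ∈ W := by
  induction n with
  | zero => exact hx
  | succ n ih => exact hW _ hx _ ih

/-! ### Injective pairs at vertices which are not regular -/

theorem norm_apply_le_of_mem_sce [T2Space V] [LocallyCompactSpace V] (T : ToeplitzPair E A)
    (hT : Function.Injective T.T0) (g : C₀(V, ℂ)) {y : A} (hy : y ∈ T.sandwich ⊤) {v : V}
    (hv : v ∈ E.sce) : ‖g v‖ ≤ ‖T.T0 g + y‖ := by
  obtain ⟨f, hf1, hf0, hf⟩ := ZeroAtInftyContinuousMap.exists_eq_one_on
    (isCompact_singleton (x := v)) (isClosed_closure.isOpen_compl : IsOpen E.sce)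
    (Set.singleton_subset_iff.2 hv)
  have hyf : y * T.T0 f = 0 := by
    refine T.sandwich_induction (p := fun y => y * T.T0 f = 0) (fun ξ η a _ => ?_) (zero_mul _)
      (fun x y hx hy => by rw [add_mul, hx, hy, add_zero]) hy
    have : Cd.leftAct (star f) η = 0 := by
      ext e
      have h0 : f (E.r e) = 0 := hf0 _ fun h => h (subset_closure ⟨e, rfl⟩)
      rw [Cd.leftAct_apply, ZeroAtInftyContinuousMap.star_apply, h0, star_zero, zero_mul,
        Cd.zero_apply]
    rw [mul_assoc, T.star_T1_mul_T0, this, map_zero, star_zero, mul_zero]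
  calc ‖g v‖ = ‖(g * f) v‖ := by
        rw [ZeroAtInftyContinuousMap.mul_apply, hf1 v rfl, mul_one]
    _ ≤ ‖g * f‖ := (g * f).norm_apply_le_norm v
    _ = ‖(T.T0 g + y) * T.T0 f‖ := by
        rw [add_mul, hyf, add_zero, ← map_mul, T.norm_T0_of_injective hT]
    _ ≤ ‖T.T0 g + y‖ * ‖T.T0 f‖ := norm_mul_le _ _
    _ ≤ ‖T.T0 g + y‖ := mul_le_of_le_one_right (norm_nonneg _) ((T.norm_T0_le f).trans hf)

/-- Up to a small error, an element of `T¹(E) A T¹(E)⋆` annihilates `T¹(ζ)` for all `ζ` which vanish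
on some compact set. -/
theorem mem_closure_annihilators (T : ToeplitzPair E A) {y : A} (hy : y ∈ T.sandwich ⊤) :
    y ∈ closure {x : A | ∃ K : Set E.Edge, IsCompact K ∧
      ∀ ζ : E.Cd, (∀ e ∈ K, ζ e = 0) → x * T.T1 ζ = 0} := by
  let Y : Submodule ℂ A :=
    { carrier := {x : A | ∃ K : Set E.Edge, IsCompact K ∧
        ∀ ζ : E.Cd, (∀ e ∈ K, ζ e = 0) → x * T.T1 ζ = 0}
      zero_mem' := ⟨∅, isCompact_empty, fun ζ _ => zero_mul _⟩
      add_mem' := by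
        rintro x y ⟨K, hK, h⟩ ⟨L, hL, h'⟩
        refine ⟨K ∪ L, hK.union hL, fun ζ hζ => ?_⟩
        rw [add_mul, h ζ fun e he => hζ e (Or.inl he), h' ζ fun e he => hζ e (Or.inr he), add_zero]
      smul_mem' := by
        rintro c x ⟨K, hK, h⟩
        exact ⟨K, hK, fun ζ hζ => by rw [smul_mul_assoc, h ζ hζ, smul_zero]⟩ }
  change y ∈ Y.topologicalClosure
  refine T.sandwich_induction (p := fun y => y ∈ Y.topologicalClosure) (fun ξ η a _ => ?_)
    (Submodule.zero_mem _) (fun x y hx hy => Submodule.add_mem _ hx hy) hy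
  have hc : Continuous fun η : E.Cd => T.T1 ξ * a * star (T.T1 η) :=
    continuous_const.mul (continuous_star.comp T.continuous_T1)
  refine map_mem_closure (f := fun η : E.Cd => T.T1 ξ * a * star (T.T1 η)) hc
    (Cd.dense_hasCompactSupport η) fun η hη => ?_
  refine ⟨tsupport η, hη, fun ζ hζ => ?_⟩
  have : Cd.inner η ζ = 0 := by
    ext v
    rw [Cd.inner_apply]
    refine (tsum_congr fun e => ?_).trans tsum_zero
    by_cases he : e.1 ∈ tsupport η
    · rw [hζ _ he, mul_zero]
    · rw [image_eq_zero_of_notMem_tsupport he, star_zero, zero_mul]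
  rw [mul_assoc, T.star_mul_T1, this, map_zero, mul_zero]

/-- For an injective pair, `g` can be recovered from `T⁰(g) + ∑ T¹(ξ) a T¹(η)⋆` at the vertices `v`
which are not regular. If `v` is a source, then multiplication by a bump function at `v` annihilates
the sum. If no neighbourhood of `v` has a compact preimage under `r`, then there are edges with
range close to `v` outside of any compact set, and bump functions there annihilate the sum up to a
small error. -/
theorem norm_apply_le_of_notMem_rg [T2Space V] [LocallyCompactSpace V] (T : ToeplitzPair E A)
    (hT : Function.Injective T.T0) (g : C₀(V, ℂ)) {y : A} (hy : y ∈ T.sandwich ⊤) {v : V}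
    (hv : v ∉ E.rg) : ‖g v‖ ≤ ‖T.T0 g + y‖ := by
  by_cases hs : v ∈ closure E.sce
  · have hcl : IsClosed {w | ‖g w‖ ≤ ‖T.T0 g + y‖} :=
      isClosed_le (map_continuous g).norm continuous_const
    exact closure_minimal (fun w hw => T.norm_apply_le_of_mem_sce hT g hy hw) hcl hs
  have hfin : v ∉ E.fin := fun h => hv ⟨h, hs⟩
  refine le_of_forall_pos_le_add fun ε hε => ?_
  obtain ⟨y', ⟨K, hK, hy'⟩, hyy'⟩ := Metric.mem_closure_iff.1 (T.mem_closure_annihilators hy)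
    (ε / 2) (half_pos hε)
  rw [dist_eq_norm] at hyy'
  have hUc : IsClosed {w | ‖g w - g v‖ ≤ ε / 2} :=
    isClosed_le ((map_continuous g).sub continuous_const).norm continuous_const
  have hU : {w | ‖g w - g v‖ ≤ ε / 2} ∈ 𝓝 v := by
    have h := Metric.continuousAt_iff'.1 ((map_continuous g).continuousAt (x := v)) (ε / 2)
      (half_pos hε)
    filter_upwards [h] with w hw
    rw [dist_eq_norm] at hw
    exact hw.le
  obtain ⟨e, heU, heK⟩ : ∃ e, E.r e ∈ {w | ‖g w - g v‖ ≤ ε / 2} ∧ e ∉ K := by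
    by_contra! h
    exact hfin ⟨_, hU, hK.of_isClosed_subset (hUc.preimage E.continuous_r) h⟩
  obtain ⟨O, hO, heO, hinj⟩ := E.exists_isOpen_injOn e
  obtain ⟨ζ, hζ1, hζ0, hζ⟩ := Cd.exists_bump (isCompact_singleton (x := e))
    (hO.inter hK.isClosed.isOpen_compl) (Set.singleton_subset_iff.2 ⟨heO, heK⟩)
    (hinj.mono Set.inter_subset_left)
  have hyζ : y' * T.T1 ζ = 0 := hy' ζ fun e' he' => hζ0 e' fun h => h.2 he'
  have h1 : ‖g (E.r e)‖ ≤ ‖T.T0 g + y'‖ :=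
    calc ‖g (E.r e)‖ = ‖Cd.leftAct g ζ e‖ := by rw [Cd.leftAct_apply, hζ1 e rfl, mul_one]
      _ ≤ ‖Cd.leftAct g ζ‖ := Cd.norm_apply_le _ e
      _ = ‖(T.T0 g + y') * T.T1 ζ‖ := by
          rw [add_mul, hyζ, add_zero, T.T0_mul_T1, T.norm_T1_of_injective hT]
      _ ≤ ‖T.T0 g + y'‖ * ‖T.T1 ζ‖ := norm_mul_le _ _
      _ ≤ ‖T.T0 g + y'‖ := mul_le_of_le_one_right (norm_nonneg _) ((T.norm_T1_le ζ).trans hζ)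
  have h2 : ‖T.T0 g + y'‖ ≤ ‖T.T0 g + y‖ + ‖y - y'‖ := by
    have := norm_sub_le (T.T0 g + y) (y - y')
    rwa [show T.T0 g + y - (y - y') = T.T0 g + y' by abel] at this
  have h3 : ‖g v‖ ≤ ‖g (E.r e)‖ + ‖g (E.r e) - g v‖ := by
    have := norm_sub_le (g (E.r e)) (g (E.r e) - g v)
    rwa [sub_sub_cancel] at this
  have h4 : ‖g (E.r e) - g v‖ ≤ ε / 2 := heU
  linarith

/-! ### A homomorphism into an injective pair is isometric on the levels -/

/-- A bound for the compressions `T¹(α)⋆ w T¹(β)` gives a bound for `x w y`, with a constant `C`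
which does not depend on `w`. It is applied to the powers `w` of one element. -/
theorem exists_norm_mul_mul_le (T : ToeplitzPair E A) {W : Submodule ℂ A} {x y : A}
    (hx : x ∈ T.sandwich W) (hy : y ∈ T.sandwich W) :
    ∃ C, ∀ (w : A) (D : ℝ), 0 ≤ D → (∀ α β, ‖star (T.T1 α) * w * T.T1 β‖ ≤ D * (‖α‖ * ‖β‖)) →
      ‖x * w * y‖ ≤ C * D := by
  refine T.sandwich_induction (p := fun x => ∃ C, ∀ (w : A) (D : ℝ), 0 ≤ D →
    (∀ α β, ‖star (T.T1 α) * w * T.T1 β‖ ≤ D * (‖α‖ * ‖β‖)) → ‖x * w * y‖ ≤ C * D)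
    (fun ξ η a _ => ?_) ⟨0, by simp⟩ ?_ hx
  · refine T.sandwich_induction (p := fun y => ∃ C, ∀ (w : A) (D : ℝ), 0 ≤ D →
      (∀ α β, ‖star (T.T1 α) * w * T.T1 β‖ ≤ D * (‖α‖ * ‖β‖)) →
        ‖T.T1 ξ * a * star (T.T1 η) * w * y‖ ≤ C * D)
      (fun ξ' η' b _ => ?_) ⟨0, by simp⟩ ?_ hy
    · refine ⟨‖T.T1 ξ * a‖ * ‖b * star (T.T1 η')‖ * (‖η‖ * ‖ξ'‖), fun w D hD hw => ?_⟩
      have : T.T1 ξ * a * star (T.T1 η) * w * (T.T1 ξ' * b * star (T.T1 η')) =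
          (T.T1 ξ * a) * (star (T.T1 η) * w * T.T1 ξ') * (b * star (T.T1 η')) := by
        simp only [mul_assoc]
      rw [this]
      calc _ ≤ ‖T.T1 ξ * a‖ * (D * (‖η‖ * ‖ξ'‖)) * ‖b * star (T.T1 η')‖ := by
            refine (norm_mul_le _ _).trans ?_
            gcongr
            refine (norm_mul_le _ _).trans ?_
            gcongr
            exact hw _ _
        _ = _ := by ring
    · rintro x y ⟨C, h⟩ ⟨C', h'⟩
      refine ⟨C + C', fun w D hD hw => ?_⟩
      rw [mul_add, add_mul]
      exact (norm_add_le _ _).trans (add_le_add (h w D hD hw) (h' w D hD hw))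
  · rintro x y ⟨C, h⟩ ⟨C', h'⟩
    refine ⟨C + C', fun w D hD hw => ?_⟩
    rw [add_mul, add_mul, add_mul]
    exact (norm_add_le _ _).trans (add_le_add (h w D hD hw) (h' w D hD hw))

variable {S : ToeplitzPair E B} {T : ToeplitzPair E A} (ρ : B →⋆ₙₐ[ℂ] A)

/-- If `ρ` is isometric on `W`, then it is isometric on the span of the `S¹(ξ) a S¹(η)⋆` with
`a ∈ W`: in `h hᴺ h` the powers `hᴺ` appear only through the elements `S¹(α)⋆ hᴺ S¹(β)` of `W`. -/
theorem norm_le_norm_map_of_mem_sandwich (h1 : ∀ ξ, ρ (S.T1 ξ) = T.T1 ξ) {W : Submodule ℂ B}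
    (hW : S.IsStarAlg W) (hρ : ∀ a ∈ W, ‖a‖ ≤ ‖ρ a‖) {y : B} (hy : y ∈ S.sandwich W) :
    ‖y‖ ≤ ‖ρ y‖ := by
  set h := star y * y with hh
  have hsa : IsSelfAdjoint h := IsSelfAdjoint.star_mul_self y
  have hmem : h ∈ S.sandwich W := S.mul_mem_sandwich hW (S.star_mem_sandwich hW hy) hy
  obtain ⟨C, hC⟩ := S.exists_norm_mul_mul_le hmem hmem
  have hbound : ‖h‖ ≤ ‖ρ h‖ := by
    refine norm_le_of_norm_succPow_le hsa (C := C * ‖ρ h‖) (norm_nonneg _) 2 fun N => ?_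
    have hpow : succPow h (N + 2) = h * succPow h N * h := by
      rw [← succPow_mul_succPow h (N + 1) 0]
      rfl
    rw [hpow, mul_assoc C, ← pow_succ']
    refine hC _ _ (by positivity) fun α β => ?_
    refine (hρ _ (S.compression_mem hW α β
      (succPow_mem (fun a ha b hb => S.mul_mem_sandwich hW ha hb) hmem N))).trans ?_
    rw [map_mul, map_mul, map_star, h1, h1, map_succPow]
    calc _ ≤ ‖T.T1 α‖ * ‖ρ h‖ ^ (N + 1) * ‖T.T1 β‖ := by
          refine (norm_mul_le _ _).trans ?_
          gcongr
          refine (norm_mul_le _ _).trans ?_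
          rw [norm_star]
          gcongr
          exact norm_succPow_le _ _
      _ ≤ ‖α‖ * ‖ρ h‖ ^ (N + 1) * ‖β‖ := by
          gcongr
          · exact T.norm_T1_le α
          · exact T.norm_T1_le β
      _ = _ := by ring
  rw [hh, map_mul, map_star, CStarRing.norm_star_mul_self, CStarRing.norm_star_mul_self, ← sq,
    ← sq] at hbound
  exact (pow_le_pow_iff_left₀ (norm_nonneg _) (norm_nonneg _) two_ne_zero).1 hbound

variable [T2Space V] [LocallyCompactSpace V]

/-- The inductive step from `Fₙ` to `Fₙ₊₁`. A power `w` of a self-adjoint element of `Fₙ₊₁` is at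
distance at most `2 m` from an element `j` of the ideal, where `m` is a power of a number slightly
larger than the norm of the image: the value of its first component at vertices which are not
regular is bounded by `m`, and the Cuntz-Krieger relation removes the part at regular vertices. On
the ideal `ρ` is isometric. -/
theorem norm_le_norm_map_of_mem_level_succ (h0 : ∀ f, ρ (S.T0 f) = T.T0 f)
    (h1 : ∀ ξ, ρ (S.T1 ξ) = T.T1 ξ) (hT : Function.Injective T.T0) {n : ℕ}
    (hS : ∀ g : C₀(V, ℂ), (∀ v ∉ E.rg, g v = 0) → S.T0 g ∈ closure (S.sandwich (S.level n) : Set B))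
    (hρ : ∀ a ∈ S.level n, ‖a‖ ≤ ‖ρ a‖) {x : B} (hx : x ∈ S.level (n + 1))
    (hsa : IsSelfAdjoint x) : ‖x‖ ≤ ‖ρ x‖ := by
  refine le_of_forall_pos_le_add fun ε hε => ?_
  set M := ‖ρ x‖ + ε
  have hM : 0 < M := by positivity
  refine norm_le_of_norm_succPow_le hsa (C := 4 * M) hM.le 0 fun N => ?_
  set w := succPow x N
  have hw : w ∈ S.level (n + 1) := succPow_mem (S.isStarAlg_level (n + 1)).mul_mem hx N
  set m := M ^ (N + 1) with hm
  have hmpos : 0 < m := by positivity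
  have hρw : ‖ρ w‖ ≤ m := by
    rw [map_succPow]
    refine (norm_succPow_le _ _).trans ?_
    rw [hm]
    gcongr
    simp [M, hε.le]
  obtain ⟨g, y, hy, hwy⟩ := S.mem_level_succ.1 hw
  obtain ⟨g', hg', hgg'⟩ := g.exists_truncation hmpos
  have hrg : ∀ v ∉ E.rg, (g - g') v = 0 := fun v hv => by
    have h := T.norm_apply_le_of_notMem_rg hT g (map_sandwich ρ h1 hy) hv
    rw [← h0, ← map_add, ← hwy] at h
    rw [ZeroAtInftyContinuousMap.sub_apply, hgg' v (h.trans hρw), sub_self]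
  obtain ⟨k, hk, hkd⟩ := Metric.mem_closure_iff.1 (hS _ hrg) m hmpos
  rw [dist_eq_norm] at hkd
  set j := k + y
  have hj : j ∈ S.sandwich (S.level n) := Submodule.add_mem _ hk hy
  have hwj : ‖w - j‖ ≤ 2 * m := by
    have : w - j = S.T0 g' + (S.T0 (g - g') - k) := by
      rw [hwy, map_sub]
      simp only [j]
      abel
    rw [this, two_mul]
    exact (norm_add_le _ _).trans (add_le_add ((S.norm_T0_le _).trans hg') hkd.le)
  have hprod : ‖w * j‖ ≤ m * ‖j‖ := by
    refine (norm_le_norm_map_of_mem_sandwich ρ h1 (S.isStarAlg_level n) hρ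
      (S.level_mul_mem_sandwich hw hj)).trans ?_
    rw [map_mul]
    refine (norm_mul_le _ _).trans ?_
    gcongr
    exact NonUnitalStarAlgHom.norm_apply_le ρ j
  have hjn : ‖j‖ ≤ ‖w‖ + 2 * m := by
    have := norm_sub_le w (w - j)
    rw [sub_sub_cancel] at this
    linarith
  have hww : ‖w‖ ^ 2 ≤ ‖w‖ * (2 * m) + m * (‖w‖ + 2 * m) := by
    rw [← norm_mul_self_of_isSelfAdjoint (isSelfAdjoint_succPow hsa N)]
    have : w * w = w * (w - j) + w * j := by rw [mul_sub, sub_add_cancel]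
    rw [this]
    refine (norm_add_le _ _).trans (add_le_add ((norm_mul_le _ _).trans ?_) (hprod.trans ?_))
    · gcongr
    · gcongr
  have h4 : ‖w‖ ≤ 4 * m := by
    -- The bound `hww` reads `‖w‖ ^ 2 ≤ 3 m ‖w‖ + 2 m ^ 2`.
    by_contra! hlt
    nlinarith
  calc ‖succPow x (N + 0)‖ = ‖w‖ := rfl
    _ ≤ 4 * m := h4
    _ = 4 * M * M ^ N := by rw [hm, pow_succ']; ring

/-- A `*`-homomorphism from a pair with the Cuntz-Krieger relation to an injective pair is isometric
on the algebras `Fₙ`. -/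
theorem norm_le_norm_map_of_mem_level (h0 : ∀ f, ρ (S.T0 f) = T.T0 f)
    (h1 : ∀ ξ, ρ (S.T1 ξ) = T.T1 ξ) (hT : Function.Injective T.T0) (hS : S.IsCuntzKrieger)
    (n : ℕ) : ∀ x ∈ S.level n, ‖x‖ ≤ ‖ρ x‖ := by
  induction n with
  | zero =>
    rintro _ ⟨f, rfl⟩
    change ‖S.T0 f‖ ≤ ‖ρ (S.T0 f)‖
    rw [h0, T.norm_T0_of_injective hT]
    exact S.norm_T0_le f
  | succ n ih =>
    have hCK : ∀ g : C₀(V, ℂ), (∀ v ∉ E.rg, g v = 0) →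
        S.T0 g ∈ (S.sandwich (S.level n)).topologicalClosure := by
      intro g hg
      obtain ⟨hc, h⟩ := hS g hg
      rw [h]
      refine map_mem_of_theta S.Phi (Submodule.isClosed_topologicalClosure _) (fun ξ η => ?_) _
      rw [S.Phi_theta]
      have hcont : Continuous fun ξ : E.Cd => S.T1 ξ * star (S.T1 η) :=
        S.continuous_T1.mul continuous_const
      refine map_mem_closure (f := fun ξ : E.Cd => S.T1 ξ * star (S.T1 η)) hcont
        (Cd.dense_rightAct ξ) fun ξ hξ => ?_
      obtain ⟨f, hf⟩ := hξ
      rw [← hf]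
      change S.T1 (Cd.rightAct f ξ) * star (S.T1 η) ∈ S.sandwich (S.level n)
      rw [S.T1_rightAct]
      exact S.mem_sandwich ξ η ((S.isStarAlg_level n).T0_mem f)
    intro x hx
    have h := norm_le_norm_map_of_mem_level_succ ρ h0 h1 hT hCK ih
      ((S.isStarAlg_level (n + 1)).mul_mem _ ((S.isStarAlg_level (n + 1)).star_mem _ hx) _ hx)
      (IsSelfAdjoint.star_mul_self x)
    rw [map_mul, map_star, CStarRing.norm_star_mul_self, CStarRing.norm_star_mul_self, ← sq,
      ← sq] at h
    exact (pow_le_pow_iff_left₀ (norm_nonneg _) (norm_nonneg _) two_ne_zero).1 h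

end ToeplitzPair

namespace ToeplitzPair

variable {V : Type u} [TopologicalSpace V] [T2Space V] [LocallyCompactSpace V] {E : TopGraph V}
  {A : Type*} [NonUnitalCStarAlgebra A] {B : Type*} [NonUnitalCStarAlgebra B]

/-! ### The elements `Tⁿ(ξ) Tᵐ(η)⋆` span a dense subspace -/

/-- The linear span of the elements `Tⁿ(ξ) Tᵐ(η)⋆`. -/
def monomials (T : ToeplitzPair E A) : Submodule ℂ A :=
  Submodule.span ℂ {x | ∃ (n m : ℕ) (ξ : (E.path n).Cd) (η : (E.path m).Cd),
    x = T.pathMap n ξ * star (T.pathMap m η)}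

theorem mem_monomials (T : ToeplitzPair E A) (n m : ℕ) (ξ : (E.path n).Cd) (η : (E.path m).Cd) :
    T.pathMap n ξ * star (T.pathMap m η) ∈ T.monomials :=
  Submodule.subset_span ⟨n, m, ξ, η, rfl⟩

theorem map_mem_of_monomials (T : ToeplitzPair E A) {G : Type*} [NormedAddCommGroup G]
    [NormedSpace ℂ G] (f : A →L[ℂ] G) {W : Submodule ℂ G} (hW : IsClosed (W : Set G))
    (h : ∀ (n m : ℕ) (ξ : (E.path n).Cd) (η : (E.path m).Cd),
      f (T.pathMap n ξ * star (T.pathMap m η)) ∈ W) {x : A}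
    (hx : x ∈ T.monomials.topologicalClosure) : f x ∈ W := by
  have hle : T.monomials ≤ W.comap (f : A →ₗ[ℂ] G) := by
    refine Submodule.span_le.2 ?_
    rintro _ ⟨n, m, ξ, η, rfl⟩
    exact h n m ξ η
  exact Submodule.topologicalClosure_minimal _ hle (hW.preimage f.continuous) hx

theorem exists_pathMap_zero (T : ToeplitzPair E A) (f : C₀(V, ℂ)) :
    ∃ ζ : (E.path 0).Cd, T.pathMap 0 ζ = T.T0 f := by
  obtain ⟨ζ, hζ⟩ := cdZero_surjective f
  exact ⟨ζ, by rw [← hζ]; rfl⟩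

theorem star_mem_closure_monomials (T : ToeplitzPair E A) {x : A}
    (hx : x ∈ T.monomials.topologicalClosure) : star x ∈ T.monomials.topologicalClosure := by
  refine map_mem_closure (f := fun x : A => star x) continuous_star hx fun x hx => ?_
  change star x ∈ T.monomials
  change x ∈ T.monomials at hx
  induction hx using Submodule.span_induction with
  | mem x hx =>
    obtain ⟨n, m, ξ, η, rfl⟩ := hx
    rw [star_mul, star_star]
    exact T.mem_monomials m n η ξ
  | zero => rw [star_zero]; exact Submodule.zero_mem _
  | add x y _ _ hx hy => rw [star_add]; exact Submodule.add_mem _ hx hy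
  | smul c x _ hx => rw [star_smul]; exact Submodule.smul_mem _ _ hx

theorem star_pathMap_mem (T : ToeplitzPair E A) (n : ℕ) (ξ : (E.path n).Cd) :
    star (T.pathMap n ξ) ∈ T.monomials.topologicalClosure := by
  refine map_mem_closure (f := fun ξ : (E.path n).Cd => star (T.pathMap n ξ))
    (continuous_star.comp (T.pathCLM n).continuous) (Cd.dense_rightAct ξ) fun ξ hξ => ?_
  obtain ⟨f, hf⟩ := hξ
  change star (T.pathMap n ξ) ∈ T.monomials
  obtain ⟨S, h0, h1⟩ := T.exists_pathPair n
  obtain ⟨ζ, hζ⟩ := T.exists_pathMap_zero (star f)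
  have : star (T.pathMap n ξ) = T.pathMap 0 ζ * star (T.pathMap n ξ) := by
    conv_lhs => rw [← hf, ← h1, S.T1_rightAct, h0, h1, star_mul, ← map_star, ← hζ]
  rw [this]
  exact T.mem_monomials _ _ _ _

theorem T1_mem_closure_range (T : ToeplitzPair E A) (ξ : E.Cd) :
    T.T1 ξ ∈ (LinearMap.range (T.pathMap 1)).topologicalClosure := by
  refine map_mem_closure (f := fun ξ : E.Cd => T.T1 ξ) T.continuous_T1 (Cd.dense_rightAct ξ)
    fun ξ hξ => ?_
  obtain ⟨f, hf⟩ := hξ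
  obtain ⟨ζ, hζ⟩ := T.exists_pathMap_zero f
  refine ⟨(tensor ξ ζ : (E.comp (E.path 0)).Cd), ?_⟩
  change T.pathMap 1 _ = T.T1 ξ
  rw [pathMap_tensor, hζ, ← T.T1_rightAct, hf]

theorem pathMap_mul_T1_mem (T : ToeplitzPair E A) (m : ℕ) (η : (E.path m).Cd) (ξ : E.Cd) :
    T.pathMap m η * T.T1 ξ ∈ (LinearMap.range (T.pathMap (m + 1))).topologicalClosure := by
  induction m with
  | zero =>
    change T.T0 (cdZero η) * T.T1 ξ ∈ _
    rw [T.T0_mul_T1]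
    exact T.T1_mem_closure_range _
  | succ m ih =>
    refine Cd.map_mem_of_tensor (F := E.path m)
      ((ContinuousLinearMap.mul ℂ A).flip (T.T1 ξ) ∘L T.pathCLM (m + 1))
      (Submodule.isClosed_topologicalClosure _) (fun ξ' ζ => ?_) η
    change T.pathMap (m + 1) _ * T.T1 ξ ∈ _
    rw [pathMap_tensor, mul_assoc]
    refine map_mem_closure (f := fun a : A => T.T1 ξ' * a) (continuous_const.mul continuous_id)
      (ih ζ) ?_
    rintro _ ⟨ω, rfl⟩
    exact ⟨(tensor ξ' ω : (E.comp (E.path (m + 1))).Cd), T.pathMap_tensor (m + 1) ξ' ω⟩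

theorem star_T1_mul_monomial_mem (T : ToeplitzPair E A) (ξ : E.Cd) (n m : ℕ) (ζ : (E.path n).Cd)
    (η : (E.path m).Cd) : star (T.T1 ξ) * (T.pathMap n ζ * star (T.pathMap m η)) ∈
      T.monomials.topologicalClosure := by
  cases n with
  | zero =>
    have : star (T.T1 ξ) * (T.pathMap 0 ζ * star (T.pathMap m η)) =
        star (T.pathMap m η * T.T1 (Cd.leftAct (star (cdZero ζ)) ξ)) := by
      change star (T.T1 ξ) * (T.T0 (cdZero ζ) * star (T.pathMap m η)) = _
      rw [star_mul, ← T.star_T1_mul_T0, mul_assoc]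
    rw [this]
    refine closure_minimal (s := (LinearMap.range (T.pathMap (m + 1)) : Set A))
      (t := {a | star a ∈ T.monomials.topologicalClosure}) ?_
      ((Submodule.isClosed_topologicalClosure _).preimage continuous_star)
      (T.pathMap_mul_T1_mem m η _)
    rintro _ ⟨ω, rfl⟩
    exact T.star_pathMap_mem (m + 1) ω
  | succ n =>
    refine Cd.map_mem_of_tensor (F := E.path n)
      (ContinuousLinearMap.mul ℂ A (star (T.T1 ξ)) ∘L
        (ContinuousLinearMap.mul ℂ A).flip (star (T.pathMap m η)) ∘L T.pathCLM (n + 1))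
      (Submodule.isClosed_topologicalClosure _) (fun ξ' ω => ?_) ζ
    change star (T.T1 ξ) * (T.pathMap (n + 1) _ * star (T.pathMap m η)) ∈ _
    rw [pathMap_tensor, ← mul_assoc, ← mul_assoc, T.star_mul_T1, T.T0_mul_pathMap]
    exact Submodule.le_topologicalClosure _ (T.mem_monomials _ _ _ _)

theorem generator_mul_mem (T : ToeplitzPair E A) {a : A}
    (ha : a ∈ Set.range T.T0 ∪ Set.range T.T1) {x : A}
    (hx : x ∈ T.monomials.topologicalClosure) :
    a * x ∈ T.monomials.topologicalClosure ∧ star a * x ∈ T.monomials.topologicalClosure := by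
  have hT0 : ∀ f, T.T0 f * x ∈ T.monomials.topologicalClosure := fun f =>
    T.map_mem_of_monomials (ContinuousLinearMap.mul ℂ A (T.T0 f))
      (Submodule.isClosed_topologicalClosure _) (fun n m ξ η => by
        rw [ContinuousLinearMap.mul_apply', ← mul_assoc, T.T0_mul_pathMap]
        exact Submodule.le_topologicalClosure _ (T.mem_monomials _ _ _ _)) hx
  rcases ha with ⟨f, rfl⟩ | ⟨ξ, rfl⟩
  · exact ⟨hT0 f, by rw [← map_star]; exact hT0 _⟩
  · refine ⟨T.map_mem_of_monomials (ContinuousLinearMap.mul ℂ A (T.T1 ξ))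
      (Submodule.isClosed_topologicalClosure _) (fun n m ζ η => ?_) hx,
      T.map_mem_of_monomials (ContinuousLinearMap.mul ℂ A (star (T.T1 ξ)))
      (Submodule.isClosed_topologicalClosure _) (fun n m ζ η => ?_) hx⟩
    · rw [ContinuousLinearMap.mul_apply', ← mul_assoc, ← pathMap_tensor]
      exact Submodule.le_topologicalClosure _ (T.mem_monomials _ _ _ _)
    · exact T.star_T1_mul_monomial_mem ξ n m ζ η

theorem generator_mem (T : ToeplitzPair E A) {a : A}
    (ha : a ∈ Set.range T.T0 ∪ Set.range T.T1) : a ∈ T.monomials.topologicalClosure := by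
  have hp : ∀ n ξ, T.pathMap n ξ ∈ T.monomials.topologicalClosure := fun n ξ => by
    rw [← star_star (T.pathMap n ξ)]
    exact T.star_mem_closure_monomials (T.star_pathMap_mem n ξ)
  rcases ha with ⟨f, rfl⟩ | ⟨ξ, rfl⟩
  · obtain ⟨ζ, hζ⟩ := T.exists_pathMap_zero f
    rw [← hζ]
    exact hp 0 ζ
  · refine closure_minimal ?_ (Submodule.isClosed_topologicalClosure T.monomials)
      (T.T1_mem_closure_range ξ)
    rintro _ ⟨ζ, rfl⟩
    exact hp 1 ζ

/-- The elements `a` for which `a` and `a⋆` multiply the closed span of the `Tⁿ(ξ) Tᵐ(η)⋆` into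
itself form a `*`-algebra, which contains the generators. -/
theorem adjoin_le_closure_monomials (T : ToeplitzPair E A) {a : A}
    (ha : a ∈ NonUnitalStarAlgebra.adjoin ℂ (Set.range T.T0 ∪ Set.range T.T1)) :
    a ∈ T.monomials.topologicalClosure := by
  suffices h : a ∈ T.monomials.topologicalClosure ∧ ∀ x ∈ T.monomials.topologicalClosure,
      a * x ∈ T.monomials.topologicalClosure ∧ star a * x ∈ T.monomials.topologicalClosure from h.1
  induction ha using NonUnitalStarAlgebra.adjoin_induction with
  | mem a ha => exact ⟨T.generator_mem ha, fun x hx => T.generator_mul_mem ha hx⟩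
  | zero => exact ⟨Submodule.zero_mem _, fun x _ => by simp⟩
  | add a b _ _ ha hb =>
    refine ⟨Submodule.add_mem _ ha.1 hb.1, fun x hx => ?_⟩
    rw [star_add, add_mul, add_mul]
    exact ⟨Submodule.add_mem _ (ha.2 x hx).1 (hb.2 x hx).1,
      Submodule.add_mem _ (ha.2 x hx).2 (hb.2 x hx).2⟩
  | mul a b _ _ ha hb =>
    refine ⟨(ha.2 b hb.1).1, fun x hx => ?_⟩
    rw [star_mul, mul_assoc, mul_assoc]
    exact ⟨(ha.2 _ (hb.2 x hx).1).1, (hb.2 _ (ha.2 x hx).2).2⟩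
  | smul c a _ ha =>
    refine ⟨Submodule.smul_mem _ c ha.1, fun x hx => ?_⟩
    rw [star_smul, smul_mul_assoc, smul_mul_assoc]
    exact ⟨Submodule.smul_mem _ _ (ha.2 x hx).1, Submodule.smul_mem _ _ (ha.2 x hx).2⟩
  | star a _ ha =>
    refine ⟨T.star_mem_closure_monomials ha.1, fun x hx => ?_⟩
    rw [star_star]
    exact ⟨(ha.2 x hx).2, (ha.2 x hx).1⟩

/-- The inclusion of `C⋆(T)`. -/
def incl (T : ToeplitzPair E A) : T.cstar →⋆ₙₐ[ℂ] A :=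
  NonUnitalStarSubalgebraClass.subtype T.cstar

theorem coe_Tn (T : ToeplitzPair E A) (n : ℕ) (ξ : (E.path n).Cd) :
    (T.Tn n ξ : A) = T.pathMap n ξ :=
  map_pathMap (T := T.restrict) (S := T) T.incl (fun _ => rfl) (fun _ => rfl) n ξ

/-- `C⋆(T)` is the closed span of the elements `Tⁿ(ξ) Tᵐ(η)⋆`. -/
theorem mem_closure_monomials_restrict (T : ToeplitzPair E A) (x : T.cstar) :
    x ∈ T.restrict.monomials.topologicalClosure := by
  have hd : Dense (T.restrict.monomials : Set T.cstar) := by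
    rw [Subtype.dense_iff]
    intro a ha
    have h1 : a ∈ T.monomials.topologicalClosure := by
      refine closure_minimal (fun b hb => T.adjoin_le_closure_monomials hb)
        (Submodule.isClosed_topologicalClosure _) ha
    refine closure_mono ?_ h1
    intro b hb
    have hle : T.monomials ≤ T.restrict.monomials.map (T.incl : T.cstar →ₗ[ℂ] A) := by
      refine Submodule.span_le.2 ?_
      rintro _ ⟨n, m, ξ, η, rfl⟩
      refine ⟨_, T.restrict.mem_monomials n m ξ η, ?_⟩
      change ((T.Tn n ξ * star (T.Tn m η) : T.cstar) : A) = _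
      rw [← T.coe_Tn, ← T.coe_Tn]
      rfl
    obtain ⟨c, hc, rfl⟩ := hle hb
    exact ⟨c, hc, rfl⟩
  exact hd x

/-! ### The core as a closure of the levels -/

theorem pathMap_mul_star_mem_closure_level (T : ToeplitzPair E A) (n : ℕ)
    (ξ η : (E.path n).Cd) :
    T.pathMap n ξ * star (T.pathMap n η) ∈ (T.level n).topologicalClosure := by
  induction n with
  | zero =>
    refine Submodule.le_topologicalClosure _ ⟨cdZero ξ * star (cdZero η), ?_⟩
    change T.T0 _ = T.T0 (cdZero ξ) * star (T.T0 (cdZero η))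
    rw [map_mul, map_star]
  | succ n ih =>
    have hcl := Submodule.isClosed_topologicalClosure (T.level (n + 1))
    refine Cd.map_mem_of_tensor (F := E.path n)
      ((ContinuousLinearMap.mul ℂ A).flip (star (T.pathMap (n + 1) η)) ∘L T.pathCLM (n + 1))
      hcl (fun α ζ => ?_) ξ
    change T.pathMap (n + 1) _ * star (T.pathMap (n + 1) η) ∈ _
    -- The closed condition in `η` is conjugate linear, so it is verified for the adjoint.
    have hstar : ∀ a b : A, b * star a ∈ (T.level (n + 1)).topologicalClosure →
        a * star b ∈ (T.level (n + 1)).topologicalClosure := fun a b h => by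
      have h' := map_mem_closure (f := fun x : A => star x) continuous_star h
        (T.isStarAlg_level (n + 1)).star_mem
      rw [star_mul, star_star] at h'
      exact h'
    refine hstar _ _ ?_
    refine Cd.map_mem_of_tensor (F := E.path n)
      ((ContinuousLinearMap.mul ℂ A).flip (star (T.pathMap (n + 1)
        (tensor α ζ : (E.comp (E.path n)).Cd))) ∘L T.pathCLM (n + 1)) hcl (fun β ω => ?_) η
    change T.pathMap (n + 1) _ * star (T.pathMap (n + 1) _) ∈ _
    rw [pathMap_tensor, pathMap_tensor, star_mul, mul_assoc, ← mul_assoc (T.pathMap n ω),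
      ← mul_assoc]
    refine map_mem_closure (f := fun a : A => T.T1 β * a * star (T.T1 α))
      ((continuous_const.mul continuous_id).mul continuous_const) (ih ω ζ) fun a ha => ?_
    exact T.sandwich_le_level n (T.mem_sandwich β α ha)

theorem core_le (T : ToeplitzPair E A) :
    T.core ≤ (⨆ n, T.restrict.level n).topologicalClosure := by
  refine Submodule.topologicalClosure_minimal _ (Submodule.span_le.2 ?_)
    (Submodule.isClosed_topologicalClosure _)
  rintro _ ⟨k, ξ, η, rfl⟩
  exact Submodule.topologicalClosure_mono (le_iSup T.restrict.level k)
    (T.restrict.pathMap_mul_star_mem_closure_level k ξ η)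

end ToeplitzPair

namespace ToeplitzPair

variable {V : Type u} [TopologicalSpace V] [T2Space V] [LocallyCompactSpace V] {E : TopGraph V}
  {A : Type*} [NonUnitalCStarAlgebra A]

/-! ### Averaging over a gauge action -/

/-- A family `(β_z)` of endomorphisms which fix `T⁰` and multiply `T¹` by `z`. -/
structure IsGauge (T : ToeplitzPair E A) (β : Circle → A →⋆ₙₐ[ℂ] A) : Prop where
  map_T0 : ∀ z f, β z (T.T0 f) = T.T0 f
  map_T1 : ∀ z ξ, β z (T.T1 ξ) = (z : ℂ) • T.T1 ξ

/-- The closed linear span of the elements `Tᵏ(ξ) Tᵏ(η)⋆`. -/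
def diagonal (T : ToeplitzPair E A) : Submodule ℂ A :=
  (Submodule.span ℂ
    {x | ∃ (k : ℕ) (ξ η : (E.path k).Cd),
      x = T.pathMap k ξ * star (T.pathMap k η)}).topologicalClosure

theorem mem_diagonal (T : ToeplitzPair E A) (k : ℕ) (ξ η : (E.path k).Cd) :
    T.pathMap k ξ * star (T.pathMap k η) ∈ T.diagonal :=
  Submodule.le_topologicalClosure _ (Submodule.subset_span ⟨k, ξ, η, rfl⟩)

/-- Two continuous linear maps on `A` agree if they agree on the elements `Tⁿ(ξ) Tᵐ(η)⋆`. -/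
theorem map_eq_of_monomials (T : ToeplitzPair E A) {G : Type*} [NormedAddCommGroup G]
    [NormedSpace ℂ G] (f g : A →L[ℂ] G)
    (h : ∀ (n m : ℕ) (ξ : (E.path n).Cd) (η : (E.path m).Cd),
      f (T.pathMap n ξ * star (T.pathMap m η)) = g (T.pathMap n ξ * star (T.pathMap m η))) {x : A}
    (hx : x ∈ T.monomials.topologicalClosure) : f x = g x := by
  have := T.map_mem_of_monomials (f - g) (W := ⊥) (by simp) (fun n m ξ η => by simp [h]) hx
  simpa [sub_eq_zero] using this

theorem map_eq_of_diagonal (T : ToeplitzPair E A) {G : Type*} [NormedAddCommGroup G]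
    [NormedSpace ℂ G] (f g : A →L[ℂ] G)
    (h : ∀ (n : ℕ) (ξ η : (E.path n).Cd),
      f (T.pathMap n ξ * star (T.pathMap n η)) = g (T.pathMap n ξ * star (T.pathMap n η))) {x : A}
    (hx : x ∈ T.diagonal) : f x = g x := by
  have hle : Submodule.span ℂ {x | ∃ (k : ℕ) (ξ η : (E.path k).Cd),
      x = T.pathMap k ξ * star (T.pathMap k η)} ≤ LinearMap.eqLocus (f : A →ₗ[ℂ] G) g := by
    refine Submodule.span_le.2 ?_
    rintro _ ⟨n, ξ, η, rfl⟩
    exact h n ξ η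
  exact closure_minimal (fun x hx => hle hx) (isClosed_eq f.continuous g.continuous) hx

section Gauge

variable {T : ToeplitzPair E A} {β : Circle → A →⋆ₙₐ[ℂ] A}

theorem IsGauge.map_monomial (hβ : T.IsGauge β) (z : Circle) (n m : ℕ) (ξ : (E.path n).Cd)
    (η : (E.path m).Cd) : β z (T.pathMap n ξ * star (T.pathMap m η)) =
      ((z : ℂ) ^ n * star (z : ℂ) ^ m) • (T.pathMap n ξ * star (T.pathMap m η)) := by
  rw [map_mul, map_star, gauge_pathMap (β z) z (hβ.map_T0 z) (hβ.map_T1 z),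
    gauge_pathMap (β z) z (hβ.map_T0 z) (hβ.map_T1 z), star_smul, smul_mul_smul_comm, star_pow]

theorem IsGauge.continuous (hβ : T.IsGauge β) {x : A} (hx : x ∈ T.monomials.topologicalClosure) :
    Continuous fun z => β z x := by
  refine continuous_of_uniform_approx_of_continuous fun U hU => ?_
  obtain ⟨ε, hε, hεU⟩ := Metric.mem_uniformity_dist.1 hU
  obtain ⟨y, hy, hxy⟩ := Metric.mem_closure_iff.1 hx ε hε
  refine ⟨fun z => β z y, ?_, fun z => hεU ?_⟩
  · change y ∈ T.monomials at hy
    clear hxy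
    induction hy using Submodule.span_induction with
    | mem y hy =>
      obtain ⟨n, m, ξ, η, rfl⟩ := hy
      simp only [hβ.map_monomial]
      have hc : Continuous fun z : Circle => (z : ℂ) := continuous_subtype_val
      exact ((hc.pow n).mul (hc.star.pow m)).smul continuous_const
    | zero => simpa using continuous_const
    | add x y _ _ hx hy =>
      simp only [map_add]
      exact hx.add hy
    | smul c x _ hx =>
      simp only [map_smul]
      exact hx.const_smul c
  · rw [dist_eq_norm, ← map_sub]
    rw [dist_eq_norm] at hxy
    exact (NonUnitalStarAlgHom.norm_apply_le (β z) _).trans_lt hxy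

theorem IsGauge.map_of_mem_diagonal (hβ : T.IsGauge β) (z : Circle) {x : A}
    (hx : x ∈ T.diagonal) : β z x = x :=
  T.map_eq_of_diagonal (β z).toContinuousLinear (ContinuousLinearMap.id ℂ A) (fun n ξ η => by
    change β z _ = _
    have hz : (z : ℂ) * star (z : ℂ) = 1 := by
      rw [← starRingEnd_apply, Complex.mul_conj, Circle.normSq_coe, Complex.ofReal_one]
    rw [hβ.map_monomial, ← mul_pow, hz, one_pow, one_smul]
    rfl) hx

theorem IsGauge.inv_map (hβ : T.IsGauge β) (hT : ∀ x, x ∈ T.monomials.topologicalClosure)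
    (z : Circle) (x : A) : β z⁻¹ (β z x) = x :=
  T.map_eq_of_monomials ((β z⁻¹).toContinuousLinear ∘L (β z).toContinuousLinear)
    (ContinuousLinearMap.id ℂ A) (fun n m ξ η => by
      change β z⁻¹ (β z _) = _
      have hz : ((z⁻¹ : Circle) : ℂ) * (z : ℂ) = 1 := by
        rw [← Circle.coe_mul, inv_mul_cancel, Circle.coe_one]
      have hz' : star ((z⁻¹ : Circle) : ℂ) * star (z : ℂ) = 1 := by
        rw [mul_comm, ← star_mul, hz, star_one]
      rw [hβ.map_monomial, map_smul, hβ.map_monomial, smul_smul, mul_mul_mul_comm, ← mul_pow,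
        ← mul_pow, mul_comm (z : ℂ), mul_comm (star (z : ℂ)), hz, hz', one_pow, one_pow, one_mul,
        one_smul]
      rfl) (hT x)

theorem IsGauge.norm_map (hβ : T.IsGauge β) (hT : ∀ x, x ∈ T.monomials.topologicalClosure)
    (z : Circle) (x : A) : ‖β z x‖ = ‖x‖ := by
  refine le_antisymm (NonUnitalStarAlgHom.norm_apply_le _ _) ?_
  conv_lhs => rw [← hβ.inv_map hT z x]
  exact NonUnitalStarAlgHom.norm_apply_le _ _

/-- The point `exp (2 π i t)` of the circle. -/
def circlePt (t : ℝ) : Circle := Circle.exp (2 * Real.pi * t)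

theorem continuous_circlePt : Continuous circlePt :=
  Circle.exp.continuous.comp (continuous_const.mul continuous_id)

open MeasureTheory

/-- The Lebesgue measure on the unit interval. -/
def unitMeasure : Measure ℝ := volume.restrict (Set.Ioc 0 1)

instance : IsProbabilityMeasure unitMeasure := ⟨by simp [unitMeasure]⟩

theorem integral_circlePt (n m : ℕ) :
    ∫ t, ((circlePt t : ℂ) ^ n * star (circlePt t : ℂ) ^ m) ∂unitMeasure =
      if n = m then 1 else 0 := by
  have h : ∀ t : ℝ, (circlePt t : ℂ) ^ n * star (circlePt t : ℂ) ^ m =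
      Complex.exp ((2 * Real.pi * Complex.I * ((n : ℤ) - (m : ℤ) : ℤ)) * t) := fun t => by
    rw [circlePt, Circle.coe_exp, ← starRingEnd_apply, ← Complex.exp_conj, ← Complex.exp_nat_mul,
      ← Complex.exp_nat_mul, ← Complex.exp_add]
    congr 1
    simp only [map_mul, Complex.conj_ofReal, Complex.conj_I, Complex.ofReal_mul,
      Complex.ofReal_ofNat, map_ofNat, Int.cast_sub, Int.cast_natCast]
    ring
  simp only [h]
  rw [unitMeasure, ← intervalIntegral.integral_of_le zero_le_one]
  split_ifs with hnm
  · simp [hnm]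
  · have hk : ((n : ℤ) - (m : ℤ) : ℤ) ≠ 0 := by omega
    have hc : (2 * Real.pi * Complex.I * ((n : ℤ) - (m : ℤ) : ℤ) : ℂ) ≠ 0 :=
      mul_ne_zero Complex.two_pi_I_ne_zero (Int.cast_ne_zero.2 hk)
    rw [integral_exp_mul_complex hc]
    have : Complex.exp (2 * Real.pi * Complex.I * ((n : ℤ) - (m : ℤ) : ℤ) * (1 : ℝ)) = 1 := by
      rw [Complex.ofReal_one, mul_one, mul_comm]
      exact Complex.exp_int_mul_two_pi_mul_I _
    rw [this]
    simp

theorem IsGauge.integrable (hβ : T.IsGauge β) {x : A}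
    (hx : x ∈ T.monomials.topologicalClosure) :
    Integrable (fun t => β (circlePt t) x) unitMeasure :=
  Integrable.of_bound ((hβ.continuous hx).comp continuous_circlePt).aestronglyMeasurable ‖x‖
    (Eventually.of_forall fun _ => NonUnitalStarAlgHom.norm_apply_le _ _)

/-- The average `x ↦ ∫ β_z(x) dz` of a gauge action. -/
def IsGauge.average (hβ : T.IsGauge β) (hT : ∀ x, x ∈ T.monomials.topologicalClosure) :
    A →L[ℂ] A :=
  LinearMap.mkContinuous
    { toFun := fun x => ∫ t, β (circlePt t) x ∂unitMeasure
      map_add' := fun x y => by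
        simp only [map_add]
        exact integral_add (hβ.integrable (hT x)) (hβ.integrable (hT y))
      map_smul' := fun c x => by
        simp only [map_smul]
        exact integral_smul c _ }
    1 fun x => by
      have h := norm_integral_le_of_norm_le_const (μ := unitMeasure)
        (f := fun t => β (circlePt t) x) (C := ‖x‖)
        (Eventually.of_forall fun _ => NonUnitalStarAlgHom.norm_apply_le _ _)
      simpa using h

theorem IsGauge.average_apply (hβ : T.IsGauge β)
    (hT : ∀ x, x ∈ T.monomials.topologicalClosure) (x : A) :
    hβ.average hT x = ∫ t, β (circlePt t) x ∂unitMeasure := rfl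

theorem IsGauge.average_monomial (hβ : T.IsGauge β)
    (hT : ∀ x, x ∈ T.monomials.topologicalClosure) (n m : ℕ) (ξ : (E.path n).Cd)
    (η : (E.path m).Cd) : hβ.average hT (T.pathMap n ξ * star (T.pathMap m η)) =
      if n = m then T.pathMap n ξ * star (T.pathMap m η) else 0 := by
  rw [hβ.average_apply]
  simp only [hβ.map_monomial]
  rw [integral_smul_const, integral_circlePt]
  split_ifs <;> simp

theorem IsGauge.average_star_mul_self (hβ : T.IsGauge β)
    (hT : ∀ x, x ∈ T.monomials.topologicalClosure) (x : A) :
    ∃ y, hβ.average hT (star x * x) = star y * y := by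
  let := CStarAlgebra.spectralOrder A
  have := CStarAlgebra.spectralOrderedRing A
  rw [← CStarAlgebra.nonneg_iff_eq_star_mul_self, hβ.average_apply]
  refine integral_nonneg fun t => ?_
  change 0 ≤ β (circlePt t) (star x * x)
  rw [map_mul, map_star]
  exact star_mul_self_nonneg _

/-- The average of a gauge action is faithful: if the average of `x⋆ x` is zero, then
so are the integrals of the positive function `z ↦ β_z(x⋆ x)` over all measurable sets. -/
theorem IsGauge.eq_zero_of_average_eq_zero (hβ : T.IsGauge β)
    (hT : ∀ x, x ∈ T.monomials.topologicalClosure) {x : A}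
    (hx : hβ.average hT (star x * x) = 0) : x = 0 := by
  let := CStarAlgebra.spectralOrder A
  have := CStarAlgebra.spectralOrderedRing A
  have hpos : ∀ t, 0 ≤ β (circlePt t) (star x * x) := fun t => by
    rw [map_mul, map_star]
    exact star_mul_self_nonneg _
  have hint := hβ.integrable (hT (star x * x))
  have hae : (fun t => β (circlePt t) (star x * x)) =ᵐ[unitMeasure] 0 := by
    refine hint.ae_eq_zero_of_forall_setIntegral_eq_zero fun s hs _ => ?_
    have hsum := integral_add_compl hs hint
    rw [← hβ.average_apply hT, hx] at hsum
    have h1 : 0 ≤ ∫ t in s, β (circlePt t) (star x * x) ∂unitMeasure := integral_nonneg hpos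
    have h2 : 0 ≤ ∫ t in sᶜ, β (circlePt t) (star x * x) ∂unitMeasure := integral_nonneg hpos
    exact ((add_eq_zero_iff_of_nonneg h1 h2).1 hsum).1
  obtain ⟨t, ht⟩ := hae.exists
  have h0 : ‖star x * x‖ = 0 := by
    rw [← hβ.norm_map hT (circlePt t)]
    exact norm_eq_zero.2 ht
  rw [CStarRing.norm_star_mul_self, mul_self_eq_zero, norm_eq_zero] at h0
  exact h0

theorem IsGauge.average_mem (hβ : T.IsGauge β)
    (hT : ∀ x, x ∈ T.monomials.topologicalClosure) (x : A) : hβ.average hT x ∈ T.diagonal := by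
  refine T.map_mem_of_monomials (hβ.average hT) (Submodule.isClosed_topologicalClosure _)
    (fun n m ξ η => ?_) (hT x)
  rw [hβ.average_monomial]
  split_ifs with h
  · subst h
    exact T.mem_diagonal n ξ η
  · exact Submodule.zero_mem _

theorem IsGauge.isConditionalExpectation_average (hβ : T.IsGauge β)
    (hT : ∀ x, x ∈ T.monomials.topologicalClosure) :
    IsConditionalExpectation T.diagonal (hβ.average hT : A →ₗ[ℂ] A) where
  mem := hβ.average_mem hT
  apply_of_mem b hb := by
    change hβ.average hT b = b
    rw [hβ.average_apply]
    simp only [hβ.map_of_mem_diagonal _ hb]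
    simp
  norm_le x := by
    refine ((hβ.average hT).le_opNorm x).trans ?_
    exact mul_le_of_le_one_left (norm_nonneg _)
      (LinearMap.mkContinuous_norm_le _ zero_le_one _)
  positive := hβ.average_star_mul_self hT
  map_mul_left b hb x := by
    change hβ.average hT (b * x) = b * hβ.average hT x
    simp only [hβ.average_apply, map_mul, hβ.map_of_mem_diagonal _ hb]
    exact (ContinuousLinearMap.mul ℂ A b).integral_comp_comm (hβ.integrable (hT x))
  map_mul_right b hb x := by
    change hβ.average hT (x * b) = hβ.average hT x * b
    simp only [hβ.average_apply, map_mul, hβ.map_of_mem_diagonal _ hb]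
    exact ((ContinuousLinearMap.mul ℂ A).flip b).integral_comp_comm (hβ.integrable (hT x))

end Gauge

end ToeplitzPair

/-! ### The gauge action on the universal algebra -/

section Universal

variable {V : Type u} [TopologicalSpace V] {E : TopGraph V}

/-- The pair `(T⁰, z T¹)`. -/
def ToeplitzPair.twist {A : Type*} [NonUnitalCStarAlgebra A] (T : ToeplitzPair E A) (z : Circle) :
    ToeplitzPair E A where
  T0 := T.T0
  T1 := (z : ℂ) • T.T1
  star_mul_T1 ξ η := by
    have hz : star (z : ℂ) * (z : ℂ) = 1 := by
      rw [← starRingEnd_apply, mul_comm, Complex.mul_conj, Circle.normSq_coe, Complex.ofReal_one]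
    rw [LinearMap.smul_apply, LinearMap.smul_apply, star_smul, smul_mul_smul_comm, hz, one_smul,
      T.star_mul_T1]
  T0_mul_T1 f ξ := by
    rw [LinearMap.smul_apply, LinearMap.smul_apply, mul_smul_comm, T.T0_mul_T1]

theorem ToeplitzPair.IsCuntzKrieger.twist {A : Type*} [NonUnitalCStarAlgebra A]
    {T : ToeplitzPair E A} (hT : T.IsCuntzKrieger) (z : Circle) : (T.twist z).IsCuntzKrieger := by
  intro f hf
  obtain ⟨h, h'⟩ := hT f hf
  refine ⟨h, h'.trans ?_⟩
  have hPhi : T.Phi = (T.twist z).Phi := by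
    ext k
    have hk := ToeplitzPair.map_mem_of_theta (T.Phi - (T.twist z).Phi) (W := ⊥) (by simp)
      (fun ξ η => ?_) k
    · exact sub_eq_zero.1 hk
    · have hz : (z : ℂ) * star (z : ℂ) = 1 := by
        rw [← starRingEnd_apply, Complex.mul_conj, Circle.normSq_coe, Complex.ofReal_one]
      change T.Phi _ - (T.twist z).Phi _ = 0
      rw [T.Phi_theta, (T.twist z).Phi_theta]
      change _ - ((z : ℂ) • T.T1 ξ) * star ((z : ℂ) • T.T1 η) = 0
      rw [star_smul, smul_mul_smul_comm, hz, one_smul, sub_self]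
  rw [hPhi]

/-- The pair `(S⁰, z S¹)` on the algebra of `S`. -/
def CKPair.twist (S : CKPair E) (z : Circle) : CKPair E where
  Alg := S.Alg
  pair := S.pair.twist z
  isCuntzKrieger := S.isCuntzKrieger.twist z

/-- The endomorphism of the product which replaces the coordinate at `S` by the coordinate at
`(S⁰, z S¹)`, a pair on the same algebra. -/
def gaugeProd (z : Circle) : CKProd E →⋆ₙₐ[ℂ] CKProd E where
  toFun x := ⟨fun S => x (S.twist z), memℓp_infty ⟨‖x‖, by
    rintro _ ⟨S, rfl⟩
    exact lp.norm_apply_le_norm ENNReal.top_ne_zero x (S.twist z)⟩⟩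
  map_smul' c x := by ext S; rfl
  map_zero' := by ext S; rfl
  map_add' x y := by ext S; rfl
  map_mul' x y := by ext S; rfl
  map_star' x := by ext S; rfl

theorem continuous_gaugeProd (z : Circle) : Continuous (gaugeProd (E := E) z) :=
  AddMonoidHomClass.continuous_of_bound _ 1 fun x => by
    simpa using NonUnitalStarAlgHom.norm_apply_le (gaugeProd z) x

theorem gaugeProd_mem (z : Circle) (x : OE E) : gaugeProd z x ∈ (univPair E).cstar := by
  have h : (univPair E).cstar ≤ (univPair E).cstar.comap (gaugeProd z) := by
    refine NonUnitalStarSubalgebra.topologicalClosure_minimal _ (NonUnitalStarAlgebra.adjoin_le ?_)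
      ((NonUnitalStarSubalgebra.isClosed_topologicalClosure _).preimage (continuous_gaugeProd z))
    rintro _ (⟨f, rfl⟩ | ⟨ξ, rfl⟩)
    · exact (univPair E).T0_mem f
    · exact SMulMemClass.smul_mem (z : ℂ) ((univPair E).T1_mem ξ)
  exact h x.2

/-- The gauge action on `O(E)`. -/
def gaugeOE (z : Circle) : OE E →⋆ₙₐ[ℂ] OE E :=
  NonUnitalStarAlgHom.codRestrict
    ((gaugeProd z).comp (NonUnitalStarSubalgebraClass.subtype (univPair E).cstar))
    (univPair E).cstar (gaugeProd_mem z)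

theorem isGauge_gaugeOE : (univPair E).restrict.IsGauge gaugeOE where
  map_T0 _ _ := rfl
  map_T1 _ _ := rfl

end Universal

/-! ### The Cuntz-Krieger pair on the boundary path space -/

namespace TopGraph

variable {V : Type u} [TopologicalSpace V]

/-- A set `X` of finite or infinite paths in `E`, given by the range of each path and the
concatenation `(x, e) ↦ e x` for `d e` equal to the range of `x`. Each path whose range is regular
is of the form `e x`, with `e` and `x` unique. -/
structure PathSystem (E : TopGraph V) where
  Path : Type u
  rng : Path → V
  cons : (Σ x : Path, E.d ⁻¹' {rng x}) → Path
  cons_injective : Function.Injective cons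
  rng_cons : ∀ q, rng (cons q) = E.r q.2
  mem_range_cons : ∀ x, rng x ∈ E.rg → x ∈ Set.range cons

namespace PathSystem

theorem memℓp_two_iff {ι : Type*} {g : ι → ℂ} :
    Memℓp g 2 ↔ Summable fun i => ‖g i‖ ^ 2 := by
  rw [memℓp_gen_iff (by simp)]
  simp

theorem norm_sq_eq_tsum {ι : Type*} (g : lp (fun _ : ι => ℂ) 2) :
    ‖g‖ ^ 2 = ∑' i, ‖g i‖ ^ 2 := by
  have := lp.norm_rpow_eq_tsum (p := 2) (by simp) g
  simpa using this

theorem summable_norm_sq {ι : Type*} (g : lp (fun _ : ι => ℂ) 2) :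
    Summable fun i => ‖g i‖ ^ 2 :=
  memℓp_two_iff.1 (lp.memℓp g)

variable {E : TopGraph V} (X : PathSystem E)

/-- The Hilbert space `ℓ²(X)`. -/
abbrev Hilb : Type u := lp (fun _ : X.Path => ℂ) 2

theorem norm_sq_mul_le (f : C₀(V, ℂ)) (h : X.Hilb) (x : X.Path) :
    ‖f (X.rng x) * h x‖ ^ 2 ≤ ‖f‖ ^ 2 * ‖h x‖ ^ 2 := by
  rw [norm_mul, mul_pow]
  gcongr
  exact ZeroAtInftyContinuousMap.norm_apply_le_norm f _

/-- Multiplication by `f ∘ r` on `ℓ²(X)`. -/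
def mulRng (f : C₀(V, ℂ)) : X.Hilb →L[ℂ] X.Hilb :=
  LinearMap.mkContinuous
    { toFun := fun h => ⟨fun x => f (X.rng x) * h x, memℓp_two_iff.2
        (Summable.of_nonneg_of_le (fun _ => by positivity) (X.norm_sq_mul_le f h)
          ((summable_norm_sq h).mul_left _))⟩
      map_add' := fun h k => by ext x; exact mul_add _ _ _
      map_smul' := fun c h => by ext x; exact mul_left_comm _ _ _ }
    ‖f‖ fun h => by
      refine abs_le_of_sq_le_sq' ?_ (by positivity) |>.2
      rw [mul_pow, norm_sq_eq_tsum, norm_sq_eq_tsum, ← tsum_mul_left]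
      exact Summable.tsum_le_tsum (X.norm_sq_mul_le f h) (summable_norm_sq _)
        ((summable_norm_sq h).mul_left _)

theorem mulRng_apply (f : C₀(V, ℂ)) (h : X.Hilb) (x : X.Path) :
    X.mulRng f h x = f (X.rng x) * h x := rfl

theorem tsum_fibre_le (ξ : E.Cd) (w : V) : ∑' e : E.d ⁻¹' {w}, ‖ξ e‖ ^ 2 ≤ ‖ξ‖ ^ 2 := by
  have := Cd.norm_res_le w ξ
  rw [Cd.norm_res] at this
  exact (Real.sqrt_le_left (norm_nonneg _)).1 this

theorem hasSum_fibre (ξ : E.Cd) (h : X.Hilb) (x : X.Path) :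
    HasSum (fun e : E.d ⁻¹' {X.rng x} => ‖ξ e * h x‖ ^ 2)
      ((∑' e : E.d ⁻¹' {X.rng x}, ‖ξ e‖ ^ 2) * ‖h x‖ ^ 2) := by
  simp only [norm_mul, mul_pow]
  exact (ξ.fibreSummable.summable (X.rng x)).hasSum.mul_right _

theorem summable_fibre_mul (ξ : E.Cd) (h : X.Hilb) : Summable fun x : X.Path =>
    (∑' e : E.d ⁻¹' {X.rng x}, ‖ξ e‖ ^ 2) * ‖h x‖ ^ 2 :=
  Summable.of_nonneg_of_le (fun _ => by positivity)
    (fun _ => mul_le_mul_of_nonneg_right (tsum_fibre_le ξ _) (by positivity))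
    ((summable_norm_sq h).mul_left (‖ξ‖ ^ 2))

theorem summable_cons (ξ : E.Cd) (h : X.Hilb) :
    Summable fun q : (Σ x : X.Path, E.d ⁻¹' {X.rng x}) => ‖ξ q.2 * h q.1‖ ^ 2 := by
  refine (summable_sigma_of_nonneg fun q => by positivity).2
    ⟨fun x => (X.hasSum_fibre ξ h x).summable, ?_⟩
  exact (X.summable_fibre_mul ξ h).congr fun x => (X.hasSum_fibre ξ h x).tsum_eq.symm

/-- The function `e x ↦ ξ e * h x` on `X`, which vanishes at the points which are not of the form
`e x`. -/
def consFun (ξ : E.Cd) (h : X.Path → ℂ) : X.Path → ℂ :=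
  Function.extend X.cons (fun q => ξ q.2 * h q.1) 0

theorem consFun_cons (ξ : E.Cd) (h : X.Path → ℂ) (q : Σ x : X.Path, E.d ⁻¹' {X.rng x}) :
    X.consFun ξ h (X.cons q) = ξ q.2 * h q.1 :=
  X.cons_injective.extend_apply _ _ _

theorem consFun_of_notMem (ξ : E.Cd) (h : X.Path → ℂ) {y : X.Path} (hy : y ∉ Set.range X.cons) :
    X.consFun ξ h y = 0 :=
  Function.extend_apply' _ _ _ hy

theorem consFun_add (ξ : E.Cd) (h k : X.Path → ℂ) :
    X.consFun ξ (h + k) = X.consFun ξ h + X.consFun ξ k := by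
  funext y
  by_cases hy : y ∈ Set.range X.cons
  · obtain ⟨q, rfl⟩ := hy
    simp only [Pi.add_apply, consFun_cons, mul_add]
  · simp only [Pi.add_apply, X.consFun_of_notMem _ _ hy, add_zero]

theorem consFun_smul (ξ : E.Cd) (c : ℂ) (h : X.Path → ℂ) :
    X.consFun ξ (c • h) = c • X.consFun ξ h := by
  funext y
  by_cases hy : y ∈ Set.range X.cons
  · obtain ⟨q, rfl⟩ := hy
    simp only [Pi.smul_apply, consFun_cons, smul_eq_mul, mul_left_comm]
  · simp only [Pi.smul_apply, X.consFun_of_notMem _ _ hy, smul_zero]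

theorem hasSum_consFun (ξ : E.Cd) (h : X.Hilb) :
    HasSum (fun y => ‖X.consFun ξ h y‖ ^ 2)
      (∑' q : (Σ x : X.Path, E.d ⁻¹' {X.rng x}), ‖ξ q.2 * h q.1‖ ^ 2) := by
  refine (X.cons_injective.hasSum_iff fun y hy => ?_).1 ?_
  · rw [X.consFun_of_notMem _ _ hy]
    simp
  · simp only [Function.comp_def, consFun_cons]
    exact (X.summable_cons ξ h).hasSum

/-- The operator `δ_x ↦ ∑_{d e = r x} ξ(e) δ_{e x}` on `ℓ²(X)`. -/
def consOp (ξ : E.Cd) : X.Hilb →L[ℂ] X.Hilb :=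
  LinearMap.mkContinuous
    { toFun := fun h => ⟨X.consFun ξ h, memℓp_two_iff.2 (X.hasSum_consFun ξ h).summable⟩
      map_add' := fun h k => Subtype.ext (X.consFun_add ξ h k)
      map_smul' := fun c h => Subtype.ext (X.consFun_smul ξ c h) }
    ‖ξ‖ fun h => by
      refine abs_le_of_sq_le_sq' ?_ (by positivity) |>.2
      rw [norm_sq_eq_tsum]
      change ∑' y, ‖X.consFun ξ h y‖ ^ 2 ≤ _
      rw [(X.hasSum_consFun ξ h).tsum_eq, (X.summable_cons ξ h).tsum_sigma, mul_pow,
        norm_sq_eq_tsum, ← tsum_mul_left]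
      refine Summable.tsum_le_tsum (fun x => ?_) ?_ ((summable_norm_sq h).mul_left _)
      · rw [(X.hasSum_fibre ξ h x).tsum_eq]
        exact mul_le_mul_of_nonneg_right (tsum_fibre_le ξ _) (by positivity)
      · exact (X.summable_fibre_mul ξ h).congr fun x => (X.hasSum_fibre ξ h x).tsum_eq.symm

theorem consOp_cons (ξ : E.Cd) (h : X.Hilb) (q : Σ x : X.Path, E.d ⁻¹' {X.rng x}) :
    X.consOp ξ h (X.cons q) = ξ q.2 * h q.1 :=
  X.consFun_cons ξ h q

theorem consOp_of_notMem (ξ : E.Cd) (h : X.Hilb) {y : X.Path} (hy : y ∉ Set.range X.cons) :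
    X.consOp ξ h y = 0 :=
  X.consFun_of_notMem ξ h hy

theorem hilb_ext_cons {h k : X.Hilb} (h1 : ∀ q, h (X.cons q) = k (X.cons q))
    (h2 : ∀ y ∉ Set.range X.cons, h y = k y) : h = k := by
  ext y
  by_cases hy : y ∈ Set.range X.cons
  · obtain ⟨q, rfl⟩ := hy
    exact h1 q
  · exact h2 y hy

theorem inner_consOp (ξ η : E.Cd) (h k : X.Hilb) :
    inner ℂ (X.consOp ξ h) (X.consOp η k) = inner ℂ h (X.mulRng (Cd.inner ξ η) k) := by
  have hs := lp.summable_inner (𝕜 := ℂ) (X.consOp ξ h) (X.consOp η k)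
  have hsupp : Function.support (fun y => inner ℂ (X.consOp ξ h y) (X.consOp η k y)) ⊆
      Set.range X.cons := fun y hy => by
    by_contra hy'
    exact hy (by simp only [X.consOp_of_notMem ξ h hy', inner_zero_left])
  have hs' := (X.cons_injective.summable_iff fun y hy =>
    Function.notMem_support.1 fun h => hy (hsupp h)).2 hs
  rw [lp.inner_eq_tsum, lp.inner_eq_tsum, ← X.cons_injective.tsum_eq hsupp]
  refine hs'.tsum_sigma.trans (tsum_congr fun x => ?_)
  simp only [Function.comp_apply, consOp_cons, mulRng_apply, Cd.inner_apply]
  rw [RCLike.inner_apply, mul_assoc, ← tsum_mul_right]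
  refine tsum_congr fun e => ?_
  rw [RCLike.inner_apply, map_mul, starRingEnd_apply (ξ e)]
  ring

theorem mulRng_star (f : C₀(V, ℂ)) : X.mulRng (star f) = star (X.mulRng f) := by
  rw [ContinuousLinearMap.star_eq_adjoint, ContinuousLinearMap.eq_adjoint_iff]
  intro h k
  rw [lp.inner_eq_tsum, lp.inner_eq_tsum]
  refine tsum_congr fun x => ?_
  simp only [mulRng_apply, RCLike.inner_apply, map_mul, ZeroAtInftyContinuousMap.star_apply]
  rw [starRingEnd_apply (star _), star_star]
  ring

theorem consOp_add (ξ η : E.Cd) : X.consOp (ξ + η) = X.consOp ξ + X.consOp η := by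
  ext1 h
  refine X.hilb_ext_cons (fun q => ?_) fun y hy => ?_
  · change _ = X.consOp ξ h _ + X.consOp η h _
    simp only [consOp_cons, Cd.add_apply, add_mul]
  · change _ = X.consOp ξ h _ + X.consOp η h _
    simp only [X.consOp_of_notMem _ _ hy, add_zero]

theorem consOp_smul (c : ℂ) (ξ : E.Cd) : X.consOp (c • ξ) = c • X.consOp ξ := by
  ext1 h
  refine X.hilb_ext_cons (fun q => ?_) fun y hy => ?_
  · change _ = c * X.consOp ξ h _
    simp only [consOp_cons, Cd.smul_apply, mul_assoc]
  · change _ = c * X.consOp ξ h _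
    simp only [X.consOp_of_notMem _ _ hy, mul_zero]

theorem star_consOp_mul (ξ η : E.Cd) :
    star (X.consOp ξ) * X.consOp η = X.mulRng (Cd.inner ξ η) := by
  ext1 k
  refine ext_inner_left ℂ fun h => ?_
  rw [ContinuousLinearMap.star_eq_adjoint, mul_apply_eq_comp,
    ContinuousLinearMap.adjoint_inner_right]
  exact X.inner_consOp ξ η h k

theorem mulRng_mul_consOp (f : C₀(V, ℂ)) (ξ : E.Cd) :
    X.mulRng f * X.consOp ξ = X.consOp (Cd.leftAct f ξ) := by
  ext1 h
  rw [mul_apply_eq_comp]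
  refine X.hilb_ext_cons (fun q => ?_) fun y hy => ?_
  · rw [mulRng_apply, consOp_cons, consOp_cons, X.rng_cons, ← mul_assoc]
    rfl
  · rw [mulRng_apply, X.consOp_of_notMem _ _ hy, X.consOp_of_notMem _ _ hy, mul_zero]

/-- The Toeplitz pair on `ℓ²(X)`. -/
def pair : ToeplitzPair E (X.Hilb →L[ℂ] X.Hilb) where
  T0 :=
    { toFun := X.mulRng
      map_smul' := fun c f => by ext h x; exact mul_assoc _ _ _
      map_zero' := by ext h x; exact zero_mul _
      map_add' := fun f g => by ext h x; exact add_mul _ _ _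
      map_mul' := fun f g => by ext h x; exact mul_assoc _ _ _
      map_star' := X.mulRng_star }
  T1 :=
    { toFun := X.consOp
      map_add' := X.consOp_add
      map_smul' := X.consOp_smul }
  star_mul_T1 := X.star_consOp_mul
  T0_mul_T1 := X.mulRng_mul_consOp

theorem pair_T0_injective (hX : Function.Surjective X.rng) : Function.Injective X.pair.T0 := by
  classical
  refine (injective_iff_map_eq_zero _).2 fun f hf => ?_
  ext v
  obtain ⟨x, rfl⟩ := hX v
  have h1 : X.mulRng f (lp.single 2 x 1) x = 0 := by
    change X.pair.T0 f (lp.single 2 x 1) x = 0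
    rw [hf]
    rfl
  rwa [mulRng_apply, lp.single_apply_self, mul_one] at h1

theorem Phi_mul_T1 {A : Type*} [NonUnitalCStarAlgebra A] (T : ToeplitzPair E A)
    (k : Cd.compact E) (ζ : E.Cd) : T.Phi k * T.T1 ζ = T.T1 ((k : E.Cd →L[ℂ] E.Cd) ζ) := by
  let a : Cd.compact E →L[ℂ] A := (ContinuousLinearMap.mul ℂ A).flip (T.T1 ζ) ∘L T.Phi
  let b : Cd.compact E →L[ℂ] A :=
    (T.T1.mkContinuous 1 fun ξ => by simpa using T.norm_T1_le ξ) ∘L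
      (ContinuousLinearMap.apply ℂ E.Cd ζ) ∘L
        LinearMap.mkContinuous (Cd.compact E).subtype 1 fun k => by rw [one_mul]; rfl
  have h := ToeplitzPair.map_mem_of_theta (a - b) (W := ⊥) (by simp) (fun ξ η => by
    change T.Phi _ * T.T1 ζ - T.T1 (Cd.theta ξ η ζ) = 0
    rw [T.Phi_theta, T.T1_theta, sub_self]) k
  exact sub_eq_zero.1 h

/-- The pair on `ℓ²(X)` is a Cuntz-Krieger pair: `T⁰(f)` and `Φ(π_r(f))` agree on the range of `T¹`,
which contains every `δ_{e x}`, and both vanish at the other basis vectors. -/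
theorem isCuntzKrieger_pair [T2Space V] [LocallyCompactSpace V] : X.pair.IsCuntzKrieger := by
  classical
  intro f hf
  refine ⟨Cd.leftAct_mem_compact hf, ?_⟩
  set k : Cd.compact E := ⟨Cd.leftAct f, Cd.leftAct_mem_compact hf⟩ with hk
  have hT1 : ∀ ζ, X.pair.T0 f * X.pair.T1 ζ = X.pair.Phi k * X.pair.T1 ζ := fun ζ => by
    rw [Phi_mul_T1, X.pair.T0_mul_T1]
  have hbasis : ∀ y : X.Path,
      X.pair.T0 f (lp.single 2 y 1) = X.pair.Phi k (lp.single 2 y 1) := fun y => by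
    by_cases hy : y ∈ Set.range X.cons
    · obtain ⟨⟨x, e⟩, rfl⟩ := hy
      obtain ⟨O, hO, heO, hinj⟩ := E.exists_isOpen_injOn e.1
      obtain ⟨ζ, hζ1, hζ0, -⟩ := Cd.exists_bump (isCompact_singleton (x := e.1)) hO
        (Set.singleton_subset_iff.2 heO) hinj
      have hδ : (lp.single 2 (X.cons ⟨x, e⟩) (1 : ℂ) : X.Hilb) =
          X.pair.T1 ζ (lp.single 2 x 1) := by
        refine X.hilb_ext_cons (fun q => ?_) fun y hy => ?_
        · change _ = X.consOp ζ _ _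
          rw [consOp_cons]
          by_cases hq : q = ⟨x, e⟩
          · subst hq
            rw [lp.single_apply_self, lp.single_apply_self, hζ1 _ rfl, mul_one]
          · rw [lp.single_apply_ne _ _ _ fun h => hq (X.cons_injective h)]
            by_cases hx : q.1 = x
            · have he : q.2.1 ∉ O := fun h => hq (by
                obtain ⟨x', e'⟩ := q
                change x' = x at hx
                subst hx
                have := hinj h heO (e'.2.trans e.2.symm)
                exact Sigma.ext rfl (heq_of_eq (Subtype.ext this)))
              rw [hζ0 _ he, zero_mul]
            · rw [lp.single_apply_ne _ _ _ hx, mul_zero]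
        · change _ = X.consOp ζ _ _
          rw [X.consOp_of_notMem _ _ hy, lp.single_apply_ne]
          rintro rfl
          exact hy ⟨_, rfl⟩
      rw [hδ]
      exact DFunLike.congr_fun (hT1 ζ) (lp.single 2 x 1)
    · have h0 : X.pair.T0 f (lp.single 2 y 1) = 0 := by
        ext x
        change X.mulRng f _ x = 0
        rw [mulRng_apply]
        by_cases hx : x = y
        · subst hx
          rw [hf _ fun h => hy (X.mem_range_cons x h), zero_mul]
        · rw [lp.single_apply_ne _ _ _ hx, mul_zero]
      rw [h0]
      have h1 : ∀ η, star (X.pair.T1 η) (lp.single 2 y 1) = 0 := fun η => by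
        refine ext_inner_left ℂ fun h => ?_
        rw [ContinuousLinearMap.star_eq_adjoint, ContinuousLinearMap.adjoint_inner_right,
          inner_zero_right, lp.inner_single_right]
        change inner ℂ (X.consOp η h y) 1 = 0
        rw [X.consOp_of_notMem _ _ hy, inner_zero_left]
      have h2 := ToeplitzPair.map_mem_of_theta
        (ContinuousLinearMap.apply ℂ X.Hilb (lp.single 2 y (1 : ℂ)) ∘L X.pair.Phi) (W := ⊥)
        (by simp) (fun ξ η => by
          change X.pair.Phi _ (lp.single 2 y 1) = 0
          rw [X.pair.Phi_theta]
          change X.pair.T1 ξ (star (X.pair.T1 η) (lp.single 2 y 1)) = 0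
          rw [h1, map_zero]) k
      exact h2.symm
  refine lp.ext_continuousLinearMap (by simp) fun y => ContinuousLinearMap.ext_ring ?_
  exact hbasis y

end PathSystem

/-! ### Boundary paths -/

section Boundary

variable (E : TopGraph V)

/-- The range of an edge or of a vertex. -/
def entryRange : E.Edge ⊕ V → V := Sum.elim E.r id

/-- An infinite path, or a finite path whose domain is not regular. A path `(e₀, …, eₙ₋₁)` with
`d eₙ₋₁ = v` is the sequence `e₀, …, eₙ₋₁, v, v, …`. -/
def BoundaryPath : Type u :=
  {x : ℕ → E.Edge ⊕ V // (∀ n e, x n = Sum.inl e → E.d e = E.entryRange (x (n + 1))) ∧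
    ∀ n v, x n = Sum.inr v → v ∉ E.rg ∧ x (n + 1) = Sum.inr v}

variable {E}

/-- The path `e x`. -/
def BoundaryPath.cons (x : E.BoundaryPath) (e : E.Edge) (he : E.d e = E.entryRange (x.1 0)) :
    E.BoundaryPath :=
  ⟨fun n => Nat.casesOn n (Sum.inl e) x.1, by
    rintro (_ | n) e' h
    · obtain rfl := Sum.inl.inj h
      exact he
    · exact x.2.1 n e' h, by
    rintro (_ | n) v h
    · cases h
    · exact x.2.2 n v h⟩

variable (E) in
/-- The boundary paths of `E` with the concatenation of an edge and a path. -/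
def boundary : PathSystem E where
  Path := E.BoundaryPath
  rng x := E.entryRange (x.1 0)
  cons q := q.1.cons q.2.1 q.2.2
  cons_injective := by
    rintro ⟨x, e, he⟩ ⟨x', e', he'⟩ h
    have h0 : (Sum.inl e : E.Edge ⊕ V) = Sum.inl e' := congrFun (congrArg Subtype.val h) 0
    obtain rfl := Sum.inl.inj h0
    have hx : x = x' := Subtype.ext (funext fun n => congrFun (congrArg Subtype.val h) (n + 1))
    subst hx
    rfl
  rng_cons _ := rfl
  mem_range_cons x hx := by
    cases h : x.1 0 with
    | inl e =>
      refine ⟨⟨⟨fun n => x.1 (n + 1), fun n => x.2.1 (n + 1), fun n => x.2.2 (n + 1)⟩,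
        e, x.2.1 0 e h⟩, Subtype.ext (funext ?_)⟩
      rintro (_ | n)
      · exact h.symm
      · rfl
    | inr v =>
      rw [h] at hx
      exact absurd hx (x.2.2 0 v h).1

/-- Every vertex is the range of a boundary path, since every regular vertex receives an edge. -/
theorem surjective_rng_boundary [T2Space V] : Function.Surjective E.boundary.rng := by
  classical
  have hstart : ∀ v : V, ∃ a : E.Edge ⊕ V, E.entryRange a = v ∧
      ∀ w, a = Sum.inr w → w ∉ E.rg := fun v => by
    by_cases hv : v ∈ E.rg
    · obtain ⟨e, he⟩ := mem_range_r_of_mem_rg hv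
      exact ⟨Sum.inl e, he, fun w h => by cases h⟩
    · exact ⟨Sum.inr v, rfl, fun w h => by
        obtain rfl := Sum.inr.inj h
        exact hv⟩
  choose start hs1 hs2 using hstart
  intro v
  let next : E.Edge ⊕ V → E.Edge ⊕ V := Sum.elim (fun e => start (E.d e)) Sum.inr
  let x : ℕ → E.Edge ⊕ V := fun n => next^[n] (start v)
  have hx : ∀ n, x (n + 1) = next (x n) := fun n => Function.iterate_succ_apply' next n _
  have hxs : ∀ n w, x n = Sum.inr w → w ∉ E.rg := by
    intro n
    induction n with
    | zero => exact hs2 v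
    | succ n ih =>
      intro w hw
      rw [hx] at hw
      cases h : x n with
      | inl e =>
        rw [h] at hw
        exact hs2 _ w hw
      | inr w' =>
        rw [h] at hw
        obtain rfl := Sum.inr.inj hw
        exact ih _ h
  refine ⟨⟨x, fun n e h => ?_, fun n w h => ⟨hxs n w h, ?_⟩⟩, hs1 v⟩
  · rw [hx, h]
    exact (hs1 _).symm
  · rw [hx, h]
    rfl

end Boundary

end TopGraph

/-- The canonical map `t⁰` is injective: its coordinate at the pair on the boundary paths is. -/
theorem t0_injective {V : Type u} [TopologicalSpace V] [T2Space V] [LocallyCompactSpace V]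
    (E : TopGraph V) : Function.Injective (t0 E) := by
  intro f g h
  have h1 := congrArg (fun a : OE E => evalCK
    ⟨E.boundary.Hilb →L[ℂ] E.boundary.Hilb, E.boundary.pair, E.boundary.isCuntzKrieger_pair⟩
      (a : CKProd E)) h
  exact E.boundary.pair_T0_injective surjective_rng_boundary h1

/-! ### The uniqueness theorem -/

/-- The canonical pair on `O(E)` is a Cuntz-Krieger pair, since its coordinates are. -/
theorem isCuntzKrieger_univPair {V : Type u} [TopologicalSpace V] [T2Space V] {E : TopGraph V} :
    (univPair E).restrict.IsCuntzKrieger := by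
  intro f hf
  refine ⟨Cd.leftAct_mem_compact hf, Subtype.ext (lp.ext (funext fun S => ?_))⟩
  obtain ⟨h, h'⟩ := S.isCuntzKrieger f hf
  exact h'.trans (ToeplitzPair.map_Phi (T := (univPair E).restrict) (S := S.pair)
    ((evalCK S).comp (univPair E).incl) (fun _ => rfl) _).symm

section Uniqueness

variable {V : Type u} [TopologicalSpace V] [T2Space V] [LocallyCompactSpace V] {E : TopGraph V}
  {A : Type u} [NonUnitalCStarAlgebra A]

/-- The automorphism of `O(E)` given by the gauge action at `z`; its inverse is the one at `z⁻¹`. -/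
def gaugeEquiv (z : Circle) : OE E ≃⋆ₐ[ℂ] OE E :=
  StarAlgEquiv.ofBijective (gaugeOE z) <| by
    have h := fun z => isGauge_gaugeOE.inv_map (univPair E).mem_closure_monomials_restrict z
    refine ⟨Function.LeftInverse.injective (h z), fun x => ⟨gaugeOE z⁻¹ x, ?_⟩⟩
    have := h z⁻¹ x
    rwa [inv_inv] at this

theorem exists_gauge_of_bijective (T : ToeplitzPair E A) (hT : T.IsCuntzKrieger)
    (h : Function.Bijective (rho T hT)) (z : Circle) :
    ∃ β : T.cstar ≃⋆ₐ[ℂ] T.cstar,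
      (∀ f, β (T.restrict.T0 f) = T.restrict.T0 f) ∧
      ∀ ξ, β (T.restrict.T1 ξ) = (z : ℂ) • T.restrict.T1 ξ := by
  let e : OE E ≃⋆ₐ[ℂ] T.cstar := StarAlgEquiv.ofBijective (rho T hT) h
  have h0 : ∀ f, e.symm (T.restrict.T0 f) = t0 E f := fun f => e.symm_apply_apply (t0 E f)
  have h1 : ∀ ξ, e.symm (T.restrict.T1 ξ) = t1 E ξ := fun ξ => e.symm_apply_apply (t1 E ξ)
  refine ⟨(e.symm.trans (gaugeEquiv z)).trans e, fun f => ?_, fun ξ => ?_⟩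
  · change e (gaugeOE z (e.symm _)) = _
    rw [h0]
    rfl
  · change e (gaugeOE z (e.symm _)) = _
    rw [h1]
    rfl

theorem injective_T0_of_injective_rho (T : ToeplitzPair E A) (hT : T.IsCuntzKrieger)
    (h : Function.Injective (rho T hT)) : Function.Injective T.T0 := by
  intro f g hfg
  refine t0_injective E (h ?_)
  rw [rho_t0, rho_t0]
  exact Subtype.ext hfg

theorem exists_conditionalExpectation (T : ToeplitzPair E A)
    (h : ∀ z : Circle, ∃ β : T.cstar ≃⋆ₐ[ℂ] T.cstar,
      (∀ f, β (T.restrict.T0 f) = T.restrict.T0 f) ∧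
      ∀ ξ, β (T.restrict.T1 ξ) = (z : ℂ) • T.restrict.T1 ξ) :
    ∃ P : T.cstar →ₗ[ℂ] T.cstar, IsConditionalExpectation T.core P ∧
      ∀ (n m : ℕ) (ξ : (E.path n).Cd) (η : (E.path m).Cd),
        P (T.Tn n ξ * star (T.Tn m η)) =
          if n = m then T.Tn n ξ * star (T.Tn m η) else 0 := by
  choose β h0 h1 using h
  have hβ : T.restrict.IsGauge fun z => (β z : T.cstar →⋆ₙₐ[ℂ] T.cstar) := ⟨h0, h1⟩
  exact ⟨_, hβ.isConditionalExpectation_average T.mem_closure_monomials_restrict,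
    hβ.average_monomial T.mem_closure_monomials_restrict⟩

theorem rho_Tn (T : ToeplitzPair E A) (hT : T.IsCuntzKrieger) (n : ℕ) (ξ : (E.path n).Cd) :
    rho T hT ((univPair E).Tn n ξ) = T.Tn n ξ :=
  ToeplitzPair.map_pathMap (T := (univPair E).restrict) (S := T.restrict) (rho T hT)
    (fun _ => rfl) (fun _ => rfl) n ξ

/-- If `T⁰` is injective, then `ρ_T` is isometric on the core of `O(E)`. -/
theorem norm_le_norm_rho_of_mem_core (T : ToeplitzPair E A) (hT : T.IsCuntzKrieger)
    (h0 : Function.Injective T.T0) {x : OE E} (hx : x ∈ (univPair E).core) :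
    ‖x‖ ≤ ‖rho T hT x‖ := by
  have hinj : Function.Injective T.restrict.T0 := fun f g h => h0 (congrArg Subtype.val h)
  have hcl : IsClosed {x : OE E | ‖x‖ ≤ ‖rho T hT x‖} :=
    isClosed_le continuous_norm (rho T hT).toContinuousLinear.continuous.norm
  refine closure_minimal (fun y hy => ?_) hcl ((univPair E).core_le hx)
  obtain ⟨n, hn⟩ := (Submodule.mem_iSup_of_directed _
    (univPair E).restrict.level_mono.directed_le).1 hy
  exact ToeplitzPair.norm_le_norm_map_of_mem_level (rho T hT) (fun _ => rfl) (fun _ => rfl) hinj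
    isCuntzKrieger_univPair n y hn

/-- A conditional expectation as in the statement turns `ρ_T(x) = 0` into `ρ_T(Ψ(x⋆ x)) = 0` for the
faithful average `Ψ` of the gauge action on `O(E)`. Its values are in the core, where `ρ_T` is
isometric. -/
theorem injective_rho (T : ToeplitzPair E A) (hT : T.IsCuntzKrieger)
    (h0 : Function.Injective T.T0) (P : T.cstar →ₗ[ℂ] T.cstar)
    (hP : ∀ x, ‖P x‖ ≤ ‖x‖)
    (hP' : ∀ (n m : ℕ) (ξ : (E.path n).Cd) (η : (E.path m).Cd),
      P (T.Tn n ξ * star (T.Tn m η)) = if n = m then T.Tn n ξ * star (T.Tn m η) else 0) :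
    Function.Injective (rho T hT) := by
  have hd := (univPair E).mem_closure_monomials_restrict
  refine (injective_iff_map_eq_zero _).2 fun x hx =>
    isGauge_gaugeOE.eq_zero_of_average_eq_zero hd ?_
  have hcomm : rho T hT (isGauge_gaugeOE.average hd (star x * x)) =
      P (rho T hT (star x * x)) :=
    (univPair E).restrict.map_eq_of_monomials
      ((rho T hT).toContinuousLinear ∘L isGauge_gaugeOE.average hd)
      (P.mkContinuous 1 (fun x => by simpa using hP x) ∘L (rho T hT).toContinuousLinear)
      (fun n m ξ η => by
        change rho T hT (isGauge_gaugeOE.average hd _) =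
          P (rho T hT ((univPair E).Tn n ξ * star ((univPair E).Tn m η)))
        rw [isGauge_gaugeOE.average_monomial, map_mul, map_star, rho_Tn, rho_Tn, hP']
        split_ifs
        · rw [map_mul, map_star, rho_Tn, rho_Tn]
        · exact map_zero _) (hd _)
  have hz : rho T hT (star x * x) = 0 := by rw [map_mul, hx, mul_zero]
  rw [hz, map_zero] at hcomm
  have := norm_le_norm_rho_of_mem_core T hT h0 (isGauge_gaugeOE.average_mem hd (star x * x))
  rw [hcomm, norm_zero] at this
  exact norm_le_zero_iff.1 this

theorem surjective_rho (T : ToeplitzPair E A) (hT : T.IsCuntzKrieger)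
    (h : Function.Injective (rho T hT)) : Function.Surjective (rho T hT) := by
  have hcl : IsClosed (Set.range (rho T hT)) :=
    (NonUnitalStarAlgHom.isometry (rho T hT) h).isClosedEmbedding.isClosed_range
  intro y
  have hle : T.restrict.monomials ≤ LinearMap.range (rho T hT).toContinuousLinear.toLinearMap := by
    refine Submodule.span_le.2 ?_
    rintro _ ⟨n, m, ξ, η, rfl⟩
    refine ⟨(univPair E).Tn n ξ * star ((univPair E).Tn m η), ?_⟩
    change rho T hT _ = _
    rw [map_mul, map_star, rho_Tn, rho_Tn]
  exact closure_minimal (fun z hz => hle hz) hcl (T.mem_closure_monomials_restrict y)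

end Uniqueness

end

theorem theorem4p5 {V : Type u} [TopologicalSpace V] [T2Space V] [LocallyCompactSpace V]
    (E : TopGraph V) {A : Type u} [NonUnitalCStarAlgebra A] (T : ToeplitzPair E A)
    (hT : T.IsCuntzKrieger) :
    List.TFAE [
      Function.Bijective (rho T hT),
      Function.Injective T.T0 ∧
        ∀ z : Circle, ∃ β : T.cstar ≃⋆ₐ[ℂ] T.cstar,
          (∀ f, β (T.restrict.T0 f) = T.restrict.T0 f) ∧
          ∀ ξ, β (T.restrict.T1 ξ) = (z : ℂ) • T.restrict.T1 ξ,
      Function.Injective T.T0 ∧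
        ∃ P : T.cstar →ₗ[ℂ] T.cstar, IsConditionalExpectation T.core P ∧
          ∀ (n m : ℕ) (ξ : (E.path n).Cd) (η : (E.path m).Cd),
            P (T.Tn n ξ * star (T.Tn m η)) =
              if n = m then T.Tn n ξ * star (T.Tn m η) else 0] := by
  tfae_have 1 → 2 := fun h =>
    ⟨injective_T0_of_injective_rho T hT h.1, exists_gauge_of_bijective T hT h⟩
  tfae_have 2 → 3 := fun ⟨h0, h⟩ => ⟨h0, exists_conditionalExpectation T h⟩
  tfae_have 3 → 1 := fun ⟨h0, P, hP, hP'⟩ =>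
    have h := injective_rho T hT h0 P hP.norm_le hP'
    ⟨h, surjective_rho T hT h⟩
  tfae_finish
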